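/- Let $N\ge 2$, $p_1,\dots,p_N\ge 2$, and $\alpha\ge\max_i p_i$. There is a constant $C>0$ depending only on $N,p_1,\dots,p_N,\alpha$ such that the following holds. **Setting.** Let $\Omega\subset\mathbb R^N$ be a bounded domain, $T>0$, $\Omega_T=\Omega\times(0,T]$, and $\phi\in C^0(\Omega_T)$. Let $K_\phi$ be the set of $u\in C([0,T];L^2(\Omega))$ with $u\in L^{p_i}(\Omega_T)$ and weak derivative $\partial_iu\in L^{p_i}(\Omega_T)$ for every $i$, and $u\ge\phi$ a.e. in $\Omega_T$. Let $K'_\phi$ be the set of $v\in K_\phi$ with weak time derivative $v_t\in L^2(\Omega_T)$, and assume $K'_\phi\neq\emptyset$. Let $u$ be a local weak solution of the obstacle problem for $u_t-\sum_i\partial_i(|\partial_iu|^{p_i-2}\partial_iu)=0$, that is, $u\in K_\phi$ and $$\int_{\Omega_T}\Big\{\eta_t\big[\tfrac12u^2-uv\big]-\eta\,u\,v_t\Big\}\,dx\,dt+\sum_{i=1}^N\int_{\Omega_T}|\partial_iu|^{p_i-2}\,\partial_iu\;\partial_i\big(\eta(v-u)\big)\,dx\,dt\ \ge 0$$ for all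 $v\in K'_\phi$ and all nonnegative $\eta\in C_0^\infty(\Omega\times(0,T))$. Let $s,\rho>0$ and let $Q=B_\rho(x_0)\times(t_0-s,t_0)\subset\Omega_T$. Let $\xi$ be smooth up to the boundary of $Q$, with $0\le\xi\le1$ in $Q$ and $\xi=0$ on $\partial B_\rho(x_0)\times(t_0-s,t_0)$. Write $(u-k)_+=\max\{u-k,0\}$ and $(u-k)_-=\max\{k-u,0\}$. **Claim.** Let $w=(u-k)_-$ with any $k>0$, or $w=(u-k)_+$ with any real $k\ge\sup_Q\phi$. Then the weak derivatives $\partial_iw$ exist and belong to $L^{p_i}(\Omega_T)$ for every $i$. With $$R=\sum_{i=1}^N\Big\{\int_Q|\partial_t\xi|\,w^2\,dx\,dt+\int_Q|\partial_i\xi|^{p_i}\,w^{p_i}\,dx\,dt\Big\},$$ one has, for every $t\in(t_0-s,t_0)$, $$\int_{B_\rho(x_0)\times\{t\}}\xi^\alpha w^2\,dx+C^{-1}\sum_{i=1}^N\int_{t_0-s}^{t}\int_{B_\rho(x_0)}\xi^\alpha|\partial_iw|^{p_i}\,dx\,d\tau\ \le\ \int_{B_\rho(x_0)\times\{t_0-s\}}\xi^\alpha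 w^2\,dx+C\,R ,$$ and consequently $$\sup_{t_0-s<t<t_0}\int_{B_\rho(x_0)\times\{t\}}\xi^\alpha w^2\,dx+C^{-1}\sum_{i=1}^N\int_Q\xi^\alpha|\partial_iw|^{p_i}\,dx\,dt\ \le\ 2\int_{B_\rho(x_0)\times\{t_0-s\}}\xi^\alpha w^2\,dx+C\,R ,$$ where the supremum is finite. -/

import Mathlib

open Set Filter Topology MeasureTheory
open scoped ContDiff

namespace AnisoObstacle

/-- Points of space-time `ℝᴺ × ℝ`, written `(x, t)`. -/
abbrev SpaceTime (N : ℕ) : Type := EuclideanSpace ℝ (Fin N) × ℝ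

/-- The direction `x_i` in space-time. -/
noncomputable def dirX {N : ℕ} (i : Fin N) : SpaceTime N := (EuclideanSpace.single i 1, 0)

/-- The direction `t` in space-time. -/
def dirT (N : ℕ) : SpaceTime N := (0, 1)

/-- `η ∈ C₀^∞(U)`. -/
structure IsTestFunction {N : ℕ} (U : Set (SpaceTime N)) (η : SpaceTime N → ℝ) : Prop where
  smooth : ContDiff ℝ ∞ η
  compact_support : HasCompactSupport η
  support_subset : tsupport η ⊆ U

/-- `g` is the weak derivative of `f` on `U` in the direction `e`. -/
structure HasWeakDeriv {N : ℕ} (U : Set (SpaceTime N)) (e : SpaceTime N)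
    (f g : SpaceTime N → ℝ) : Prop where
  locallyIntegrable : LocallyIntegrableOn f U
  locallyIntegrable_deriv : LocallyIntegrableOn g U
  integral_eq : ∀ η : SpaceTime N → ℝ, IsTestFunction U η →
    ∫ z in U, f z * fderiv ℝ η z e = - ∫ z in U, g z * η z

open Classical in
/-- A representative of the weak derivative of `f` on `U` in the direction `e`
(on open `U` the weak derivative is unique up to null sets); `0` if there is none. -/
noncomputable def weakDeriv {N : ℕ} (U : Set (SpaceTime N)) (e : SpaceTime N)
    (f : SpaceTime N → ℝ) : SpaceTime N → ℝ :=
  if h : ∃ g, HasWeakDeriv U e f g then h.choose else 0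

/-- `f` has a weak derivative on `U` in the direction `e`, and it belongs to `L^q(U)`. -/
def WeakDerivMemLp {N : ℕ} (U : Set (SpaceTime N)) (e : SpaceTime N) (q : ℝ)
    (f : SpaceTime N → ℝ) : Prop :=
  (∃ g, HasWeakDeriv U e f g) ∧
    MemLp (weakDeriv U e f) (ENNReal.ofReal q) (volume.restrict U)

/-- The open space-time cylinder `Ω × (0,T)`. -/
def openCyl {N : ℕ} (Ω : Set (EuclideanSpace ℝ (Fin N))) (T : ℝ) : Set (SpaceTime N) :=
  Ω ×ˢ Ioo 0 T

/-- The space-time cylinder `Ω_T = Ω × (0,T]`. -/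
def cyl {N : ℕ} (Ω : Set (EuclideanSpace ℝ (Fin N))) (T : ℝ) : Set (SpaceTime N) :=
  Ω ×ˢ Ioc 0 T

/-- The cylinder `(x₀,t₀) + Q(s,ρ) = B_ρ(x₀) × (t₀ - s, t₀)`. -/
def Q {N : ℕ} (x₀ : EuclideanSpace ℝ (Fin N)) (t₀ s ρ : ℝ) : Set (SpaceTime N) :=
  Metric.ball x₀ ρ ×ˢ Ioo (t₀ - s) t₀

/-- `u ∈ C(0,T; L²(Ω))`: every time slice `u(·,t)`, `t ∈ [0,T]`, is in `L²(Ω)` and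
`t ↦ u(·,t)` is continuous from `[0,T]` to `L²(Ω)`. -/
def ContinuousInL2 {N : ℕ} (Ω : Set (EuclideanSpace ℝ (Fin N))) (T : ℝ)
    (u : SpaceTime N → ℝ) : Prop :=
  (∀ t ∈ Icc 0 T, MemLp (fun x => u (x, t)) 2 (volume.restrict Ω)) ∧
  ∀ t ∈ Icc 0 T, Tendsto
    (fun τ => eLpNorm (fun x => u (x, τ) - u (x, t)) 2 (volume.restrict Ω))
    (𝓝[Icc 0 T] t) (𝓝 0)

/-- The class `K_φ(Ω_T)`: functions `u ∈ C(0,T; L²(Ω))` with `u, ∂u/∂x_i ∈ L^{p_i}(Ω_T)` for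
every `i`, and `u ≥ φ` a.e. in `Ω_T`. -/
structure MemK {N : ℕ} (Ω : Set (EuclideanSpace ℝ (Fin N))) (T : ℝ) (p : Fin N → ℝ)
    (φ : SpaceTime N → ℝ) (u : SpaceTime N → ℝ) : Prop where
  continuous_L2 : ContinuousInL2 Ω T u
  memLp : ∀ i, MemLp u (ENNReal.ofReal (p i)) (volume.restrict (openCyl Ω T))
  weakDeriv_memLp : ∀ i, WeakDerivMemLp (openCyl Ω T) (dirX i) (p i) u
  obstacle_le : ∀ᵐ z ∂(volume.restrict (cyl Ω T)), φ z ≤ u z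

/-- The class `K'_φ(Ω_T)` of admissible comparison functions: `v ∈ K_φ(Ω_T)` with
`v_t ∈ L²(Ω_T)`. -/
structure MemK' {N : ℕ} (Ω : Set (EuclideanSpace ℝ (Fin N))) (T : ℝ) (p : Fin N → ℝ)
    (φ : SpaceTime N → ℝ) (v : SpaceTime N → ℝ) : Prop where
  memK : MemK Ω T p φ v
  timeDeriv_memLp : WeakDerivMemLp (openCyl Ω T) (dirT N) 2 v

/-- The pairing `⟨⟨u_t, η (v - u)⟩⟩ = ∫_{Ω_T} { η_t [u²/2 - u v] - η u v_t } dx dt`. -/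
noncomputable def timePairing {N : ℕ} (Ω : Set (EuclideanSpace ℝ (Fin N))) (T : ℝ)
    (u v η : SpaceTime N → ℝ) : ℝ :=
  ∫ z in openCyl Ω T,
    (fderiv ℝ η z (dirT N) * (1 / 2 * u z ^ 2 - u z * v z)
      - η z * u z * weakDeriv (openCyl Ω T) (dirT N) v z)

/-- The `i`-th diffusion term `∫_{Ω_T} |∂_i u|^{p_i - 2} ∂_i u ∂_i (η (v - u)) dx dt`. -/
noncomputable def diffusionTerm {N : ℕ} (Ω : Set (EuclideanSpace ℝ (Fin N))) (T : ℝ)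
    (p : Fin N → ℝ) (u v η : SpaceTime N → ℝ) (i : Fin N) : ℝ :=
  ∫ z in openCyl Ω T,
    |weakDeriv (openCyl Ω T) (dirX i) u z| ^ (p i - 2)
      * weakDeriv (openCyl Ω T) (dirX i) u z
      * weakDeriv (openCyl Ω T) (dirX i) (fun y => η y * (v y - u y)) z

/-- `u` is a local weak solution of the obstacle problem for
`u_t - ∑ ∂_i (|∂_i u|^{p_i - 2} ∂_i u) = 0` in `Ω_T` with obstacle `φ`. -/
structure IsLocalWeakSolution {N : ℕ} (Ω : Set (EuclideanSpace ℝ (Fin N))) (T : ℝ)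
    (p : Fin N → ℝ) (φ : SpaceTime N → ℝ) (u : SpaceTime N → ℝ) : Prop where
  memK : MemK Ω T p φ u
  variational_ineq : ∀ v : SpaceTime N → ℝ, MemK' Ω T p φ v →
    ∀ η : SpaceTime N → ℝ, IsTestFunction (openCyl Ω T) η → (∀ z, 0 ≤ η z) →
      0 ≤ timePairing Ω T u v η + ∑ i, diffusionTerm Ω T p u v η i

/-- The truncation `(u - k)_- = max {k - u, 0}`. -/
def truncNeg {N : ℕ} (u : SpaceTime N → ℝ) (k : ℝ) : SpaceTime N → ℝ := fun z => max (k - u z) 0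

/-- The truncation `(u - k)_+ = max {u - k, 0}`. -/
def truncPos {N : ℕ} (u : SpaceTime N → ℝ) (k : ℝ) : SpaceTime N → ℝ := fun z => max (u z - k) 0

/-- `ξ` is a cutoff function on `Q = B_ρ(x₀) × (t₀ - s, t₀)`: smooth up to the boundary of `Q`,
with `0 ≤ ξ ≤ 1` in `Q`, and vanishing on the lateral boundary `∂B_ρ(x₀) × (t₀ - s, t₀)`. -/
structure IsCutoff {N : ℕ} (x₀ : EuclideanSpace ℝ (Fin N)) (t₀ s ρ : ℝ)
    (ξ : SpaceTime N → ℝ) : Prop where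
  smooth : ContDiff ℝ ∞ ξ
  nonneg : ∀ z ∈ Q x₀ t₀ s ρ, 0 ≤ ξ z
  le_one : ∀ z ∈ Q x₀ t₀ s ρ, ξ z ≤ 1
  lateral : ∀ x ∈ Metric.sphere x₀ ρ, ∀ t ∈ Ioo (t₀ - s) t₀, ξ (x, t) = 0

/-- `∫_{B_ρ(x₀) × {t}} ξ^α w² dx`. -/
noncomputable def sliceEnergy {N : ℕ} (x₀ : EuclideanSpace ℝ (Fin N)) (ρ α : ℝ)
    (ξ w : SpaceTime N → ℝ) (t : ℝ) : ℝ :=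
  ∫ x in Metric.ball x₀ ρ, ξ (x, t) ^ α * w (x, t) ^ 2

/-- `∑_i ∫_{B_ρ(x₀) × (t₁,t₂)} ξ^α |∂_i w|^{p_i} dx dt`, with `∂_i` the weak derivative on `U`. -/
noncomputable def gradEnergy {N : ℕ} (U : Set (SpaceTime N)) (p : Fin N → ℝ)
    (x₀ : EuclideanSpace ℝ (Fin N)) (ρ α : ℝ) (ξ w : SpaceTime N → ℝ) (t₁ t₂ : ℝ) : ℝ :=
  ∑ i, ∫ z in Metric.ball x₀ ρ ×ˢ Ioo t₁ t₂, ξ z ^ α * |weakDeriv U (dirX i) w z| ^ (p i)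

/-- `∑_i { ∫_Q |∂_t ξ| w² dx dt + ∫_Q |∂_i ξ|^{p_i} w^{p_i} dx dt }`. -/
noncomputable def cutoffTerm {N : ℕ} (p : Fin N → ℝ)
    (x₀ : EuclideanSpace ℝ (Fin N)) (t₀ s ρ : ℝ) (ξ w : SpaceTime N → ℝ) : ℝ :=
  ∑ i, ((∫ z in Q x₀ t₀ s ρ, |fderiv ℝ ξ z (dirT N)| * w z ^ 2)
    + ∫ z in Q x₀ t₀ s ρ, |fderiv ℝ ξ z (dirX i)| ^ (p i) * w z ^ (p i))

end AnisoObstacle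

/-! This is the energy (Caccioppoli) inequality obtained by testing with a truncation of `u`.
Formally one takes `v = max u k` for `(u-k)_-` and `v = min u k` for `(u-k)_+`; the first stays
above the obstacle because it is at least `u`, the second because `k ≥ φ` on `Q`. Then `v - u = ±w`,
the time pairing collapses to `½ ∫ w² η_t`, and the diffusion terms become `-η |∂_i w|^{p_i}` plus a
cross term with `∂_i η`. For `η = ξ^α χ(t)` Young's inequality absorbs the cross term, `α ≥ p_i`
leaving no negative power of `ξ`, and `χ` is then sent to the indicator of a time interval.

The difficulty is that a comparison function needs a time derivative in `L²`, which `u` does not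
have. A cut-off copy `f` of `u` is therefore replaced by its exponential mollification `M` into the
past, which satisfies `M_t = (f - M)/h`. Mollifying may violate the obstacle constraint; since `φ`
is continuous, adding constants that tend to zero restores it (`exists_mollifying_sequence`), and
gluing the truncated result into a given member of `K'_φ` gives an admissible function
(`memK'_comparison`). For `W = G (M + ε)` one has `(f - M) W_t ≥ 0`, so in the time term `f` may be
replaced by `M`, and what remains is an exact derivative (`integral_time_mollify_le`). The limit is
`IsLocalWeakSolution.truncation_inequality`, and `IsEnergySubsolution` records what is kept from it.

The calculus of truncations rests on difference quotients: `HasWeakDeriv.max_const` and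
`HasWeakDeriv.ae_eq_zero_of_eq`. The second also handles the level set `{u = k}`, where the
derivative of the truncation is discontinuous.

The estimate itself is `exists_const_weighted_energy`, then `exists_const_energy_between` for
interior times, then `exists_const_energy_estimate`, where continuity of the slice energies reaches
the initial time. The supremum and the gradient energy are each bounded by the initial energy plus a
multiple of `R`, whence the factor 2 in the last claim. -/

namespace AnisoObstacle

/-! ### Averages of translates in `L^p`. -/

section Averages

open scoped ENNReal

variable {E : Type*} [NormedAddCommGroup E] [NormedSpace ℝ E] [FiniteDimensional ℝ E]
  [MeasurableSpace E] [BorelSpace E] {μ : Measure E} [μ.IsAddHaarMeasure]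

/-- Composition of an `L^p` function with measure-preserving maps is continuous in the map for the
compact-open topology when `p` is finite, and the translation by `a` depends continuously on `a` in
that topology. -/
theorem tendsto_eLpNorm_translate {p : ℝ≥0∞} (hp1 : 1 ≤ p) (hp : p ≠ ⊤) {f : E → ℝ}
    (hf : MemLp f p μ) :
    Tendsto (fun a : E => eLpNorm (fun z => f (z + a) - f z) p μ) (𝓝 0) (𝓝 0) := by
  have : Fact (1 ≤ p) := ⟨hp1⟩
  let c : C(E, C(E, E)) := (ContinuousMap.mk (fun a : E × E => a.2 + a.1) (by fun_prop)).curry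
  have hmp : ∀ a, MeasurePreserving (c a) μ μ := fun a => measurePreserving_add_right μ a
  have hcont := Continuous.compMeasurePreservingLp (μ := μ) (ν := μ) (p := p)
    (f := fun _ : E => hf.toLp f) (g := fun a => c a) continuous_const c.continuous hmp hp
  have h1 : Tendsto (fun a => edist (Lp.compMeasurePreserving (c a) (hmp a) (hf.toLp f))
      (Lp.compMeasurePreserving (c 0) (hmp 0) (hf.toLp f))) (𝓝 0) (𝓝 0) := by
    have := (hcont.tendsto 0)
    exact (tendsto_iff_edist_tendsto_0.1 this)
  refine h1.congr fun a => ?_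
  rw [Lp.edist_def]
  refine eLpNorm_congr_ae ?_
  have hL : ∀ a, (Lp.compMeasurePreserving (c a) (hmp a) (hf.toLp f) : E → ℝ) =ᵐ[μ]
      fun z => f (z + a) := by
    intro a
    refine (Lp.coeFn_compMeasurePreserving _ (hmp a)).trans ?_
    exact (hmp a).quasiMeasurePreserving.ae_eq_comp hf.coeFn_toLp
  filter_upwards [hL a, hL 0] with z h1 h2
  rw [Pi.sub_apply]
  rw [h1, h2, add_zero]

theorem eLpNorm_translate {p : ℝ≥0∞} {f : E → ℝ} (hf : AEStronglyMeasurable f μ) (a : E) :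
    eLpNorm (fun z => f (z + a)) p μ = eLpNorm f p μ :=
  eLpNorm_comp_measurePreserving hf (measurePreserving_add_right μ a)

/-- Jensen's inequality for averages over a probability measure, integrated in a parameter. -/
theorem lintegral_enorm_integral_rpow_le {X : Type*} [MeasurableSpace X] {m : Measure X}
    [SFinite m] {ν : Measure ℝ} [IsProbabilityMeasure ν] {r : ℝ} (hr : 1 ≤ r) {F : X × ℝ → ℝ}
    (hF : AEStronglyMeasurable F (m.prod ν)) :
    ∫⁻ z, ‖∫ θ, F (z, θ) ∂ν‖ₑ ^ r ∂m ≤ ∫⁻ θ, ∫⁻ z, ‖F (z, θ)‖ₑ ^ r ∂m ∂ν := by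
  have h0 : 0 < r := by linarith
  rw [lintegral_lintegral_swap]
  · refine lintegral_mono_ae ?_
    filter_upwards [hF.prodMk_left] with z hz
    have h1 : ‖∫ θ, F (z, θ) ∂ν‖ₑ ≤ eLpNorm (fun θ => F (z, θ)) 1 ν := by
      rw [eLpNorm_one_eq_lintegral_enorm]
      exact enorm_integral_le_lintegral_enorm _
    have h2 : eLpNorm (fun θ => F (z, θ)) 1 ν
        ≤ eLpNorm (fun θ => F (z, θ)) (ENNReal.ofReal r) ν :=
      eLpNorm_le_eLpNorm_of_exponent_le (by simpa using hr) hz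
    calc ‖∫ θ, F (z, θ) ∂ν‖ₑ ^ r ≤ (eLpNorm (fun θ => F (z, θ)) (ENNReal.ofReal r) ν) ^ r := by
          gcongr; exact h1.trans h2
      _ = _ := by
          rw [eLpNorm_eq_lintegral_rpow_enorm_toReal (by simpa using h0) (by simp),
            ENNReal.toReal_ofReal h0.le, ← ENNReal.rpow_mul]
          simp [h0.ne']
  · have : AEMeasurable (fun q => ‖F q‖ₑ ^ r) (m.prod ν) := hF.enorm.pow_const r
    exact this.prod_swap

variable (ν : Measure ℝ) [IsProbabilityMeasure ν]

/-- The average of the translates `g (· + (s θ) e)` over the law `ν` of `θ`. -/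
noncomputable def avg (e : E) (s : ℝ) (g : E → ℝ) (z : E) : ℝ := ∫ θ, g (z + (s * θ) • e) ∂ν

/-- For fixed `θ` the map is a translation, so null sets pull back to null sets. This gives the
joint measurability behind every use of Fubini for `avg` and lets a.e. inequalities pass to its
integrand. -/
theorem quasiMeasurePreserving_shear (e : E) (s : ℝ) :
    Measure.QuasiMeasurePreserving (fun q : E × ℝ => q.1 + (s * q.2) • e) (μ.prod ν) μ := by
  refine QuasiMeasurePreserving.prod_of_left (by fun_prop) (Eventually.of_forall fun θ => ?_)
  exact (measurePreserving_add_right μ ((s * θ) • e)).quasiMeasurePreserving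

variable {ν}

theorem aestronglyMeasurable_shear {g : E → ℝ} (hg : AEStronglyMeasurable g μ) (e : E) (s : ℝ) :
    AEStronglyMeasurable (fun q : E × ℝ => g (q.1 + (s * q.2) • e)) (μ.prod ν) :=
  hg.comp_quasiMeasurePreserving (quasiMeasurePreserving_shear ν e s)

theorem aestronglyMeasurable_avg {g : E → ℝ} (hg : AEStronglyMeasurable g μ) (e : E) (s : ℝ) :
    AEStronglyMeasurable (avg ν e s g) μ :=
  (aestronglyMeasurable_shear hg e s).integral_prod_right'

theorem eLpNorm_avg_le {p : ℝ≥0∞} (hp1 : 1 ≤ p) (hp : p ≠ ⊤) {g : E → ℝ}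
    (hg : AEStronglyMeasurable g μ) (e : E) (s : ℝ) :
    eLpNorm (avg ν e s g) p μ ≤ eLpNorm g p μ := by
  have hr : 1 ≤ p.toReal := by simpa using ENNReal.toReal_mono hp hp1
  have h0 : p ≠ 0 := (one_pos.trans_le hp1).ne'
  rw [eLpNorm_eq_lintegral_rpow_enorm_toReal h0 hp, eLpNorm_eq_lintegral_rpow_enorm_toReal h0 hp]
  refine ENNReal.rpow_le_rpow ?_ (by positivity)
  refine (lintegral_enorm_integral_rpow_le hr (aestronglyMeasurable_shear (ν := ν) hg e s)).trans ?_
  have : ∀ θ : ℝ, ∫⁻ z, ‖g (z + (s * θ) • e)‖ₑ ^ p.toReal ∂μ = ∫⁻ z, ‖g z‖ₑ ^ p.toReal ∂μ :=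
    fun θ => lintegral_add_right_eq_self (fun z => ‖g z‖ₑ ^ p.toReal) _
  simp [this]

theorem memLp_avg {p : ℝ≥0∞} (hp1 : 1 ≤ p) (hp : p ≠ ⊤) {g : E → ℝ}
    (hg : MemLp g p μ) (e : E) (s : ℝ) : MemLp (avg ν e s g) p μ :=
  ⟨aestronglyMeasurable_avg hg.1 e s, (eLpNorm_avg_le hp1 hp hg.1 e s).trans_lt hg.2⟩

theorem integrable_shear_ae {g : E → ℝ} (hg : Integrable g μ) (e : E) (s : ℝ) :
    Integrable (fun q : E × ℝ => g (q.1 + (s * q.2) • e)) (μ.prod ν) := by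
  rw [integrable_prod_iff' (aestronglyMeasurable_shear hg.1 e s)]
  refine ⟨Eventually.of_forall fun θ => hg.comp_add_right ((s * θ) • e), ?_⟩
  have : ∀ θ : ℝ, ∫ z, ‖g (z + (s * θ) • e)‖ ∂μ = ∫ z, ‖g z‖ ∂μ :=
    fun θ => integral_add_right_eq_self (fun z => ‖g z‖) _
  simp only [this]
  exact integrable_const _

/-- By Jensen the error is controlled by the `ν`-average of the translation modulus `w ((s θ) e)`.
The modulus is bounded and tends to zero at the origin, so dominated convergence works for any law
`ν`, without moment conditions. -/
theorem tendsto_eLpNorm_avg_sub {p : ℝ≥0∞} (hp1 : 1 ≤ p) (hp : p ≠ ⊤) {g : E → ℝ}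
    (hg : MemLp g p μ) (hg1 : Integrable g μ) (e : E) :
    Tendsto (fun s => eLpNorm (fun z => avg ν e s g z - g z) p μ) (𝓝 0) (𝓝 0) := by
  have hr : 1 ≤ p.toReal := by simpa using ENNReal.toReal_mono hp hp1
  have hr0 : 0 < p.toReal := by linarith
  have h0 : p ≠ 0 := (one_pos.trans_le hp1).ne'
  have hpow : ∀ f : E → ℝ, ∫⁻ z, ‖f z‖ₑ ^ p.toReal ∂μ = eLpNorm f p μ ^ p.toReal := by
    intro f
    rw [eLpNorm_eq_lintegral_rpow_enorm_toReal h0 hp, ← ENNReal.rpow_mul]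
    simp [hr0.ne']
  set w : E → ℝ≥0∞ := fun a => eLpNorm (fun z => g (z + a) - g z) p μ ^ p.toReal with hw
  have hw_zero : Tendsto w (𝓝 0) (𝓝 0) := by
    have := (tendsto_eLpNorm_translate hp1 hp hg).ennrpow_const p.toReal
    simpa [ENNReal.zero_rpow_of_pos hr0] using this
  have hwb : ∀ a, w a ≤ (2 * eLpNorm g p μ) ^ p.toReal := by
    intro a
    simp only [hw]
    gcongr
    have hga : AEStronglyMeasurable (fun z => g (z + a)) μ :=
      hg.1.comp_measurePreserving (measurePreserving_add_right μ a)
    refine (eLpNorm_sub_le hga hg.1 hp1).trans ?_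
    rw [eLpNorm_translate hg.1, two_mul]
  have hwm : ∀ s : ℝ, AEMeasurable (fun θ : ℝ => w ((s * θ) • e)) ν := by
    intro s
    have hm : AEStronglyMeasurable (fun q : E × ℝ => g (q.1 + (s * q.2) • e) - g q.1) (μ.prod ν) :=
      (aestronglyMeasurable_shear hg.1 e s).sub
        (hg.1.comp_quasiMeasurePreserving Measure.quasiMeasurePreserving_fst)
    have := (hm.enorm.pow_const p.toReal).lintegral_prod_left'
    refine this.congr (Eventually.of_forall fun θ => ?_)
    exact hpow _
  have hle : ∀ s, eLpNorm (fun z => avg ν e s g z - g z) p μ ^ p.toReal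
      ≤ ∫⁻ θ, w ((s * θ) • e) ∂ν := by
    intro s
    have hm : AEStronglyMeasurable (fun q : E × ℝ => g (q.1 + (s * q.2) • e) - g q.1) (μ.prod ν) :=
      (aestronglyMeasurable_shear hg.1 e s).sub
        (hg.1.comp_quasiMeasurePreserving Measure.quasiMeasurePreserving_fst)
    have h1 := lintegral_enorm_integral_rpow_le hr hm
    have h2 : ∫⁻ z, ‖avg ν e s g z - g z‖ₑ ^ p.toReal ∂μ
        = ∫⁻ z, ‖∫ θ, g (z + (s * θ) • e) - g z ∂ν‖ₑ ^ p.toReal ∂μ := by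
      refine lintegral_congr_ae ?_
      filter_upwards [(integrable_shear_ae (ν := ν) hg1 e s).prod_right_ae] with z hz
      rw [integral_sub hz (integrable_const _)]
      simp [avg]
    rw [← hpow, h2]
    refine h1.trans (le_of_eq ?_)
    refine lintegral_congr fun θ => ?_
    exact hpow _
  have hlim : Tendsto (fun s : ℝ => ∫⁻ θ, w ((s * θ) • e) ∂ν) (𝓝 0) (𝓝 0) := by
    refine tendsto_of_seq_tendsto fun x hx => ?_
    have := tendsto_lintegral_of_dominated_convergence' (μ := ν)
      (F := fun n θ => w ((x n * θ) • e)) (f := fun _ => 0)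
      (fun _ => (2 * eLpNorm g p μ) ^ p.toReal) (fun n => hwm (x n))
      (fun n => Eventually.of_forall fun θ => hwb _) ?_ (Eventually.of_forall fun θ => ?_)
    · simpa [Function.comp_def] using this
    · simp only [lintegral_const, measure_univ, mul_one]
      exact ENNReal.rpow_ne_top_of_nonneg hr0.le (ENNReal.mul_ne_top (by simp) hg.2.ne)
    · refine hw_zero.comp ?_
      have : Continuous (fun s : ℝ => (s * θ) • e) := by fun_prop
      exact (by simpa using this.tendsto 0 : Tendsto (fun s : ℝ => (s * θ) • e) (𝓝 0) (𝓝 0)).comp hx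
  have h3 : Tendsto (fun s => eLpNorm (fun z => avg ν e s g z - g z) p μ ^ p.toReal)
      (𝓝 0) (𝓝 0) :=
    tendsto_of_tendsto_of_tendsto_of_le_of_le tendsto_const_nhds hlim (fun _ => zero_le) hle
  have h4 := h3.ennrpow_const (1 / p.toReal)
  rw [ENNReal.zero_rpow_of_pos (by positivity)] at h4
  refine h4.congr fun s => ?_
  rw [← ENNReal.rpow_mul]
  simp [hr0.ne']

end Averages

end AnisoObstacle

namespace AnisoObstacle

/-! ### Cutoffs, test functions and the algebra of weak derivatives. -/

section Cutoffs

open scoped Manifold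

theorem exists_contDiff_one_nhds {E : Type*} [NormedAddCommGroup E] [NormedSpace ℝ E]
    [FiniteDimensional ℝ E] {K U : Set E} (hK : IsCompact K) (hU : IsOpen U) (hKU : K ⊆ U) :
    ∃ ζ : E → ℝ, ContDiff ℝ ∞ ζ ∧ HasCompactSupport ζ ∧ tsupport ζ ⊆ U ∧
      (∀ᶠ z in 𝓝ˢ K, ζ z = 1) ∧ ∀ z, ζ z ∈ Icc (0 : ℝ) 1 := by
  obtain ⟨L, hL, hKL, hLU⟩ := exists_compact_between hK hU hKU
  obtain ⟨f, h1, h0, h01⟩ := exists_contMDiffMap_one_nhds_of_subset_interior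
    (n := (⊤ : ℕ∞)) (𝓘(ℝ, E)) hK.isClosed hKL
  have hts : tsupport (f : E → ℝ) ⊆ L := by
    refine closure_minimal (fun x hx => ?_) hL.isClosed
    by_contra hxL
    exact hx (h0 x hxL)
  exact ⟨f, f.contMDiff.contDiff, hL.of_isClosed_subset (isClosed_tsupport _) hts,
    hts.trans hLU, h1, h01⟩

end Cutoffs

instance instIsAddHaarMeasureSpaceTime (N : ℕ) :
    (volume : Measure (SpaceTime N)).IsAddHaarMeasure :=
  inferInstanceAs ((volume : Measure (EuclideanSpace ℝ (Fin N))).prod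
    (volume : Measure ℝ)).IsAddHaarMeasure

variable {N : ℕ} {U V : Set (SpaceTime N)} {e : SpaceTime N} {f g f' g' η ζ : SpaceTime N → ℝ}

theorem exists_testFunction_one_nhds {K : Set (SpaceTime N)} (hK : IsCompact K) (hU : IsOpen U)
    (hKU : K ⊆ U) : ∃ ζ : SpaceTime N → ℝ, IsTestFunction U ζ ∧
      (∀ᶠ z in 𝓝ˢ K, ζ z = 1) ∧ ∀ z, ζ z ∈ Icc (0 : ℝ) 1 := by
  obtain ⟨ζ, h1, h2, h3, h4, h5⟩ := exists_contDiff_one_nhds hK hU hKU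
  exact ⟨ζ, ⟨h1, h2, h3⟩, h4, h5⟩

namespace IsTestFunction

theorem continuous (h : IsTestFunction U η) : Continuous η := h.smooth.continuous

theorem differentiable (h : IsTestFunction U η) : Differentiable ℝ η :=
  h.smooth.differentiable (by simp)

theorem eq_zero_of_notMem (h : IsTestFunction U η) {z : SpaceTime N} (hz : z ∉ U) : η z = 0 :=
  image_eq_zero_of_notMem_tsupport fun hz' => hz (h.support_subset hz')

theorem mono (h : IsTestFunction U η) (hUV : U ⊆ V) : IsTestFunction V η :=
  ⟨h.smooth, h.compact_support, h.support_subset.trans hUV⟩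

theorem fderiv_apply (h : IsTestFunction U η) (e : SpaceTime N) :
    IsTestFunction U fun z => fderiv ℝ η z e where
  smooth := (h.smooth.fderiv_right (m := ∞) (by simp)).clm_apply contDiff_const
  compact_support := h.compact_support.fderiv_apply ℝ e
  support_subset := (tsupport_fderiv_apply_subset ℝ e).trans h.support_subset

theorem mul_left (h : IsTestFunction U η) (hζ : ContDiff ℝ ∞ ζ) :
    IsTestFunction U fun z => ζ z * η z where
  smooth := hζ.mul h.smooth
  compact_support := h.compact_support.mul_left
  support_subset := (tsupport_mul_subset_right (f := ζ)).trans h.support_subset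

theorem translate (h : IsTestFunction univ η) (a : SpaceTime N) :
    IsTestFunction univ fun z => η (z + a) where
  smooth := h.smooth.comp (contDiff_id.add contDiff_const)
  compact_support := h.compact_support.comp_homeomorph (Homeomorph.addRight a)
  support_subset := subset_univ _

theorem setIntegral_eq (h : IsTestFunction U η) (F : SpaceTime N → ℝ) :
    ∫ z in U, F z * η z = ∫ z, F z * η z :=
  setIntegral_eq_integral_of_forall_compl_eq_zero fun z hz => by simp [h.eq_zero_of_notMem hz]

theorem integrable_mul (h : IsTestFunction U η) (hf : LocallyIntegrableOn f U) :
    Integrable fun z => f z * η z := by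
  have h1 : IntegrableOn f (tsupport η) :=
    hf.integrableOn_compact_subset h.support_subset h.compact_support
  have h2 := h1.mul_continuousOn (g' := η) h.continuous.continuousOn h.compact_support
  refine (integrableOn_iff_integrable_of_support_subset ?_).1 h2
  exact (Function.support_mul_subset_right f η).trans (subset_tsupport η)

theorem bounded (h : IsTestFunction U η) : ∃ C, 0 ≤ C ∧ ∀ z, |η z| ≤ C := by
  obtain ⟨C, hC⟩ := h.continuous.bounded_above_of_compact_support h.compact_support
  exact ⟨C, (norm_nonneg _).trans (hC 0), hC⟩

theorem memLp (h : IsTestFunction U η) (p : ENNReal) (m : Measure (SpaceTime N))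
    [IsFiniteMeasureOnCompacts m] : MemLp η p m :=
  h.continuous.memLp_of_hasCompactSupport h.compact_support

end IsTestFunction

theorem fderiv_mul_apply (hζ : Differentiable ℝ ζ) (hη : Differentiable ℝ η) (z e : SpaceTime N) :
    fderiv ℝ (fun y => ζ y * η y) z e = ζ z * fderiv ℝ η z e + fderiv ℝ ζ z e * η z := by
  rw [fderiv_fun_mul (hζ z) (hη z)]
  simp only [add_apply, smul_apply, smul_eq_mul]
  ring

namespace HasWeakDeriv

theorem integral_eq' (h : HasWeakDeriv U e f g) (hη : IsTestFunction U η) :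
    ∫ z, f z * fderiv ℝ η z e = -∫ z, g z * η z := by
  rw [← hη.setIntegral_eq, ← (hη.fderiv_apply e).setIntegral_eq]
  exact h.integral_eq η hη

theorem of_integral_eq (hf : LocallyIntegrableOn f U) (hg : LocallyIntegrableOn g U)
    (h : ∀ η : SpaceTime N → ℝ, IsTestFunction U η →
      ∫ z, f z * fderiv ℝ η z e = -∫ z, g z * η z) : HasWeakDeriv U e f g where
  locallyIntegrable := hf
  locallyIntegrable_deriv := hg
  integral_eq η hη := by
    rw [hη.setIntegral_eq, (hη.fderiv_apply e).setIntegral_eq, h η hη]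

theorem ae_eq (hU : IsOpen U) (h : HasWeakDeriv U e f g) (h' : HasWeakDeriv U e f g') :
    g =ᵐ[volume.restrict U] g' := by
  have key : ∀ᵐ z : SpaceTime N, z ∈ U → g z - g' z = 0 := by
    refine hU.ae_eq_zero_of_integral_contDiff_smul_eq_zero
      (h.locallyIntegrable_deriv.sub h'.locallyIntegrable_deriv) fun η h1 h2 h3 => ?_
    have hη : IsTestFunction U η := ⟨h1, h2, h3⟩
    have e1 := h.integral_eq' hη
    have e2 := h'.integral_eq' hη
    have e3 : ∫ z, g z * η z = ∫ z, g' z * η z := by linarith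
    have : ∫ z, (g z * η z - g' z * η z) = 0 := by
      rw [integral_sub (hη.integrable_mul h.locallyIntegrable_deriv)
        (hη.integrable_mul h'.locallyIntegrable_deriv), e3, sub_self]
    rw [← this]
    refine integral_congr_ae (Eventually.of_forall fun z => ?_)
    simp only [smul_eq_mul]
    ring
  rw [EventuallyEq, ae_restrict_iff' hU.measurableSet]
  filter_upwards [key] with z hz hzU using sub_eq_zero.1 (hz hzU)

/-- The bridge from the representative picked by choice to any explicit formula for the derivative.
-/
theorem weakDeriv_ae_eq (hU : IsOpen U) (h : HasWeakDeriv U e f g) :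
    weakDeriv U e f =ᵐ[volume.restrict U] g := by
  have hex : ∃ g, HasWeakDeriv U e f g := ⟨g, h⟩
  rw [weakDeriv, dif_pos hex]
  exact hex.choose_spec.ae_eq hU h

theorem weakDerivMemLp (hU : IsOpen U) (h : HasWeakDeriv U e f g) {q : ℝ}
    (hg : MemLp g (ENNReal.ofReal q) (volume.restrict U)) : WeakDerivMemLp U e q f :=
  ⟨⟨g, h⟩, (memLp_congr_ae (h.weakDeriv_ae_eq hU)).2 hg⟩

theorem _root_.AnisoObstacle.hasWeakDeriv_weakDeriv (h : ∃ g, HasWeakDeriv U e f g) :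
    HasWeakDeriv U e f (weakDeriv U e f) := by
  rw [weakDeriv, dif_pos h]
  exact h.choose_spec

theorem _root_.AnisoObstacle.locallyIntegrableOn_congr_ae
    (h : f =ᵐ[volume.restrict U] f') (hf : LocallyIntegrableOn f U) :
    LocallyIntegrableOn f' U := by
  intro x hx
  obtain ⟨s, hs, hfs⟩ := hf x hx
  refine ⟨s ∩ U, inter_mem hs self_mem_nhdsWithin, ?_⟩
  refine (hfs.mono_set inter_subset_left).congr_fun_ae ?_
  exact ae_restrict_of_ae_restrict_of_subset inter_subset_right h

theorem congr_ae (h : HasWeakDeriv U e f g) (hf : f =ᵐ[volume.restrict U] f')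
    (hg : g =ᵐ[volume.restrict U] g') : HasWeakDeriv U e f' g' where
  locallyIntegrable := locallyIntegrableOn_congr_ae hf h.locallyIntegrable
  locallyIntegrable_deriv :=
    locallyIntegrableOn_congr_ae hg h.locallyIntegrable_deriv
  integral_eq η hη := by
    have h1 : ∫ z in U, f' z * fderiv ℝ η z e = ∫ z in U, f z * fderiv ℝ η z e :=
      integral_congr_ae (hf.mono fun z hz => by simp only [hz])
    have h2 : ∫ z in U, g' z * η z = ∫ z in U, g z * η z :=
      integral_congr_ae (hg.mono fun z hz => by simp only [hz])
    rw [h1, h2, h.integral_eq η hη]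

theorem mono (h : HasWeakDeriv U e f g) (hVU : V ⊆ U) : HasWeakDeriv V e f g :=
  of_integral_eq (h.locallyIntegrable.mono_set hVU) (h.locallyIntegrable_deriv.mono_set hVU)
    fun _ hη => h.integral_eq' (hη.mono hVU)

theorem add (h : HasWeakDeriv U e f g) (h' : HasWeakDeriv U e f' g') :
    HasWeakDeriv U e (fun z => f z + f' z) fun z => g z + g' z := by
  refine of_integral_eq (h.locallyIntegrable.add h'.locallyIntegrable)
    (h.locallyIntegrable_deriv.add h'.locallyIntegrable_deriv) fun η hη => ?_
  simp only [add_mul]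
  rw [integral_add ((hη.fderiv_apply e).integrable_mul h.locallyIntegrable)
    ((hη.fderiv_apply e).integrable_mul h'.locallyIntegrable),
    integral_add (hη.integrable_mul h.locallyIntegrable_deriv)
      (hη.integrable_mul h'.locallyIntegrable_deriv), h.integral_eq' hη, h'.integral_eq' hη]
  ring

theorem neg (h : HasWeakDeriv U e f g) :
    HasWeakDeriv U e (fun z => -f z) fun z => -g z := by
  refine of_integral_eq h.locallyIntegrable.neg h.locallyIntegrable_deriv.neg fun η hη => ?_
  simp only [neg_mul]
  rw [integral_neg, integral_neg, h.integral_eq' hη]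

theorem sub (h : HasWeakDeriv U e f g) (h' : HasWeakDeriv U e f' g') :
    HasWeakDeriv U e (fun z => f z - f' z) fun z => g z - g' z := by
  simpa only [sub_eq_add_neg] using h.add h'.neg

theorem _root_.AnisoObstacle.hasWeakDeriv_const (c : ℝ) :
    HasWeakDeriv U e (fun _ => c) fun _ => 0 := by
  refine of_integral_eq ((locallyIntegrable_const c).locallyIntegrableOn _)
    ((locallyIntegrable_const 0).locallyIntegrableOn _) fun η hη => ?_
  have := integral_mul_fderiv_eq_neg_fderiv_mul_of_integrable (μ := (volume : Measure (SpaceTime N)))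
    (f := fun _ => c) (g := η) (v := e) (by simp)
    (((hη.fderiv_apply e).continuous.integrable_of_hasCompactSupport
      (hη.fderiv_apply e).compact_support).const_mul c)
    ((hη.continuous.integrable_of_hasCompactSupport hη.compact_support).const_mul c)
    (fun x _ => by fun_prop) (fun x _ => hη.differentiable x)
  simpa using this

theorem mul_smooth (hU : IsOpen U) (h : HasWeakDeriv U e f g) (hζ : ContDiff ℝ ∞ ζ) :
    HasWeakDeriv U e (fun z => ζ z * f z) fun z => ζ z * g z + fderiv ℝ ζ z e * f z := by
  have hζd : Differentiable ℝ ζ := hζ.differentiable (by simp)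
  have hζ' : Continuous fun z => fderiv ℝ ζ z e :=
    ((hζ.fderiv_right (m := ∞) (by simp)).clm_apply contDiff_const).continuous
  refine of_integral_eq
    (h.locallyIntegrable.continuousOn_mul hζ.continuous.continuousOn hU.isLocallyClosed)
    ((h.locallyIntegrable_deriv.continuousOn_mul hζ.continuous.continuousOn hU.isLocallyClosed).add
      (h.locallyIntegrable.continuousOn_mul hζ'.continuousOn hU.isLocallyClosed)) fun η hη => ?_
  have hζη := hη.mul_left hζ
  have h1 := h.integral_eq' hζη
  have h2 : Integrable fun z => f z * (ζ z * fderiv ℝ η z e) :=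
    ((hη.fderiv_apply e).mul_left hζ).integrable_mul h.locallyIntegrable
  have h3 : Integrable fun z => f z * (fderiv ℝ ζ z e * η z) :=
    (hη.mul_left ((hζ.fderiv_right (m := ∞) (by simp)).clm_apply contDiff_const)).integrable_mul
      h.locallyIntegrable
  have h4 : Integrable fun z => g z * (ζ z * η z) := hζη.integrable_mul h.locallyIntegrable_deriv
  simp only [fderiv_mul_apply hζd hη.differentiable, mul_add] at h1
  rw [integral_add h2 h3] at h1
  have e1 : ∫ z, ζ z * f z * fderiv ℝ η z e = ∫ z, f z * (ζ z * fderiv ℝ η z e) :=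
    integral_congr_ae (Eventually.of_forall fun z => by ring)
  have e2 : ∫ z, (ζ z * g z + fderiv ℝ ζ z e * f z) * η z
      = (∫ z, g z * (ζ z * η z)) + ∫ z, f z * (fderiv ℝ ζ z e * η z) := by
    rw [← integral_add h4 h3]
    exact integral_congr_ae (Eventually.of_forall fun z => by ring)
  rw [e1, e2]
  linarith

/-- Multiplication by a test function extends a weak derivative to the whole space. -/
theorem mul_testFunction (h : HasWeakDeriv U e f g) (hζ : IsTestFunction U ζ) :
    HasWeakDeriv univ e (fun z => ζ z * f z) fun z => ζ z * g z + fderiv ℝ ζ z e * f z := by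
  have hc : ∀ {ψ F : SpaceTime N → ℝ}, IsTestFunction U ψ → LocallyIntegrableOn F U →
      Integrable fun z => ψ z * F z := fun hψ hF => by
    simpa only [mul_comm] using hψ.integrable_mul hF
  have i1 := hc hζ h.locallyIntegrable
  have i2 := hc hζ h.locallyIntegrable_deriv
  have i3 := hc (hζ.fderiv_apply e) h.locallyIntegrable
  refine of_integral_eq (i1.locallyIntegrable.locallyIntegrableOn _)
    ((i2.add i3).locallyIntegrable.locallyIntegrableOn _) fun η hη => ?_
  have hηζ : IsTestFunction U fun z => ζ z * η z := by
    simpa only [mul_comm] using hζ.mul_left hη.smooth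
  have h1 := h.integral_eq' hηζ
  have hb : ∀ {ψ F : SpaceTime N → ℝ}, IsTestFunction univ ψ → Integrable F →
      Integrable fun z => F z * ψ z := fun hψ hF =>
    hψ.integrable_mul (hF.locallyIntegrable.locallyIntegrableOn _)
  have j1 := hb (hη.fderiv_apply e) i1
  have j2 := hb hη i2
  have j3 := hb hη i3
  have e1 : ∫ z, f z * fderiv ℝ (fun y => ζ y * η y) z e
      = (∫ z, ζ z * f z * fderiv ℝ η z e) + ∫ z, fderiv ℝ ζ z e * f z * η z := by
    rw [← integral_add j1 j3]
    refine integral_congr_ae (Eventually.of_forall fun z => ?_)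
    simp only [fderiv_mul_apply hζ.differentiable hη.differentiable]
    ring
  have e2 : ∫ z, (ζ z * g z + fderiv ℝ ζ z e * f z) * η z
      = (∫ z, g z * (ζ z * η z)) + ∫ z, fderiv ℝ ζ z e * f z * η z := by
    have j4 : Integrable fun z => g z * (ζ z * η z) := j2.congr
      (Eventually.of_forall fun z => by ring)
    rw [← integral_add j4 j3]
    exact integral_congr_ae (Eventually.of_forall fun z => by ring)
  rw [e2]
  linarith

end HasWeakDeriv

end AnisoObstacle

namespace AnisoObstacle

/-! ### Duality for averages; difference quotients and weak derivatives. -/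

section AveragePairing

variable {E : Type*} [NormedAddCommGroup E] [NormedSpace ℝ E] [FiniteDimensional ℝ E]
  [MeasurableSpace E] [BorelSpace E] {μ : Measure E} [μ.IsAddHaarMeasure]
  {ν : Measure ℝ} [IsProbabilityMeasure ν]

/-- Fubini and translation invariance: the adjoint of averaging at scale `s` is averaging at scale
`-s`. -/
theorem integral_avg_mul {g ψ : E → ℝ} (hg : Integrable g μ) (hψ : Continuous ψ) {C : ℝ}
    (hC : ∀ z, |ψ z| ≤ C) (a : E) (s : ℝ) :
    ∫ z, avg ν a s g z * ψ z ∂μ = ∫ θ, ∫ z, g z * ψ (z + (-s * θ) • a) ∂μ ∂ν := by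
  have hi : Integrable (fun q : E × ℝ => g (q.1 + (s * q.2) • a) * ψ q.1) (μ.prod ν) :=
    (integrable_shear_ae (ν := ν) hg a s).mul_bdd (c := C)
      (hψ.comp continuous_fst).aestronglyMeasurable (Eventually.of_forall fun q => hC q.1)
  calc ∫ z, avg ν a s g z * ψ z ∂μ = ∫ z, ∫ θ, g (z + (s * θ) • a) * ψ z ∂ν ∂μ := by
        simp only [avg, integral_mul_const]
    _ = ∫ θ, ∫ z, g (z + (s * θ) • a) * ψ z ∂μ ∂ν :=
        integral_integral_swap (f := fun z θ => g (z + (s * θ) • a) * ψ z) hi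
    _ = _ := by
        refine integral_congr_ae (Eventually.of_forall fun θ => ?_)
        have := integral_add_right_eq_self (μ := μ)
          (fun z => g z * ψ (z + (-s * θ) • a)) ((s * θ) • a)
        simp only at this ⊢
        rw [← this]
        refine integral_congr_ae (Eventually.of_forall fun z => ?_)
        simp only [neg_mul, neg_smul, add_neg_cancel_right]

theorem integral_mul_avg {g ψ : E → ℝ} (hg : Integrable g μ) (hψ : Continuous ψ) {C : ℝ}
    (hC : ∀ z, |ψ z| ≤ C) (a : E) (s : ℝ) :
    ∫ z, g z * avg ν a s ψ z ∂μ = ∫ θ, ∫ z, g z * ψ (z + (s * θ) • a) ∂μ ∂ν := by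
  have hi : Integrable (fun q : E × ℝ => g q.1 * ψ (q.1 + (s * q.2) • a)) (μ.prod ν) :=
    (hg.comp_fst ν).mul_bdd (c := C)
      (hψ.comp (by fun_prop)).aestronglyMeasurable (Eventually.of_forall fun q => hC _)
  rw [← integral_integral_swap (f := fun z θ => g z * ψ (z + (s * θ) • a)) hi]
  simp only [avg, integral_const_mul]

/-- Hölder's inequality. The pair `p = 1`, `q = ∞` serves for test functions, conjugate exponents
for the diffusion flux. -/
theorem tendsto_integral_mul_of_eLpNorm_sub {X ι : Type*} [MeasurableSpace X] {m : Measure X}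
    {l : Filter ι} {p q : ENNReal} [ENNReal.HolderTriple p q 1] {F : ι → X → ℝ} {F₀ a : X → ℝ}
    (hF : ∀ n, MemLp (F n) p m) (hF₀ : MemLp F₀ p m) (ha : MemLp a q m)
    (h : Tendsto (fun n => eLpNorm (fun z => F n z - F₀ z) p m) l (𝓝 0)) :
    Tendsto (fun n => ∫ z, F n z * a z ∂m) l (𝓝 (∫ z, F₀ z * a z ∂m)) := by
  have hm : ∀ {f : X → ℝ}, MemLp f p m → Integrable (fun z => f z * a z) m := fun hf =>
    memLp_one_iff_integrable.1 (ha.mul hf)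
  refine tendsto_integral_of_L1' _ (hm hF₀).1 (Eventually.of_forall fun n => hm (hF n)) ?_
  have hle : ∀ n, eLpNorm ((fun z => F n z * a z) - fun z => F₀ z * a z) 1 m
      ≤ eLpNorm (fun z => F n z - F₀ z) p m * eLpNorm a q m := by
    intro n
    have := eLpNorm_smul_le_mul_eLpNorm (p := p) (q := q) (r := 1) (μ := m) ha.1
      ((hF n).1.sub hF₀.1)
    refine (le_of_eq ?_).trans this
    congr 1
    ext z
    simp [sub_mul]
  have h0 : Tendsto (fun n => eLpNorm (fun z => F n z - F₀ z) p m * eLpNorm a q m) l (𝓝 0) := by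
    have := ENNReal.Tendsto.mul_const h (Or.inr ha.2.ne)
    simpa using this
  exact tendsto_of_tendsto_of_tendsto_of_le_of_le tendsto_const_nhds h0 (fun _ => zero_le) hle

end AveragePairing

variable {N : ℕ} {U V : Set (SpaceTime N)} {e : SpaceTime N} {f g f' g' η ζ : SpaceTime N → ℝ}

theorem hasWeakDeriv_univ_of_integral_eq (hf : Integrable f) (hg : Integrable g)
    (h : ∀ η : SpaceTime N → ℝ, IsTestFunction univ η →
      ∫ z, f z * fderiv ℝ η z e = -∫ z, g z * η z) : HasWeakDeriv univ e f g :=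
  .of_integral_eq (hf.locallyIntegrable.locallyIntegrableOn _)
    (hg.locallyIntegrable.locallyIntegrableOn _) h

theorem fderiv_translate_apply (η : SpaceTime N → ℝ) (a z e : SpaceTime N) :
    fderiv ℝ (fun y => η (y + a)) z e = fderiv ℝ η (z + a) e := by
  rw [fderiv_comp_add_right]

theorem integrable_avg {ν : Measure ℝ} [IsProbabilityMeasure ν] (hf : Integrable f)
    (a : SpaceTime N) (s : ℝ) : Integrable (avg ν a s f) :=
  memLp_one_iff_integrable.1 (memLp_avg le_rfl (by simp) (memLp_one_iff_integrable.2 hf) a s)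

/-- Averaging moves onto the test function as a translation, and translates of test functions are
again admissible because the domain is the whole space. This is why functions are extended by
cutoffs before being mollified. -/
theorem HasWeakDeriv.avg {ν : Measure ℝ} [IsProbabilityMeasure ν] (h : HasWeakDeriv univ e f g)
    (hf : Integrable f) (hg : Integrable g) (a : SpaceTime N) (s : ℝ) :
    HasWeakDeriv univ e (avg ν a s f) (avg ν a s g) := by
  refine hasWeakDeriv_univ_of_integral_eq (integrable_avg hf a s) (integrable_avg hg a s)
    fun η hη => ?_
  obtain ⟨C, -, hC⟩ := hη.bounded
  obtain ⟨C', -, hC'⟩ := (hη.fderiv_apply e).bounded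
  rw [integral_avg_mul hf (hη.fderiv_apply e).continuous hC',
    integral_avg_mul hg hη.continuous hC, ← integral_neg]
  refine integral_congr_ae (Eventually.of_forall fun θ => ?_)
  have := h.integral_eq' (hη.translate ((-s * θ) • a))
  simpa only [fderiv_translate_apply] using this

/-- The uniform law on `(0, 1]`. -/
noncomputable def unifLaw : Measure ℝ := volume.restrict (Ioc (0 : ℝ) 1)

instance : IsProbabilityMeasure unifLaw := ⟨by simp [unifLaw]⟩

/-- The fundamental theorem of calculus on the segment from `z` to `z + s e`, the uniform law
playing the role of `dθ`. -/
theorem testFunction_translate_sub (hη : IsTestFunction U η) (e z : SpaceTime N) (s : ℝ) :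
    η (z + s • e) - η z = s * avg unifLaw e s (fun y => fderiv ℝ η y e) z := by
  have hd : ∀ θ : ℝ, HasDerivAt (fun θ : ℝ => η (z + (s * θ) • e))
      (s * fderiv ℝ η (z + (s * θ) • e) e) θ := by
    intro θ
    have h1 : HasDerivAt (fun θ : ℝ => z + (s * θ) • e) (s • e) θ := by
      have := (((hasDerivAt_id θ).const_mul s).smul_const e).const_add z
      simpa using this
    have h2 := ((hη.differentiable (z + (s * θ) • e)).hasFDerivAt).comp_hasDerivAt θ h1
    simpa [Function.comp_def] using h2
  have hc : Continuous fun θ : ℝ => s * fderiv ℝ η (z + (s * θ) • e) e :=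
    continuous_const.mul ((hη.fderiv_apply e).continuous.comp (by fun_prop))
  have := intervalIntegral.integral_eq_sub_of_hasDerivAt (a := 0) (b := 1) (fun θ _ => hd θ)
    (hc.intervalIntegrable _ _)
  rw [intervalIntegral.integral_of_le zero_le_one, integral_const_mul] at this
  simpa [avg, unifLaw] using this.symm

theorem integral_translate_sub_mul {F : SpaceTime N → ℝ} (hF : Integrable F)
    (hη : IsTestFunction univ η) (e : SpaceTime N) (s : ℝ) :
    ∫ z, (F (z + s • e) - F z) * η z
      = -s * ∫ θ, (∫ z, F z * fderiv ℝ η (z + (-s * θ) • e) e) ∂unifLaw := by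
  obtain ⟨C', -, hC'⟩ := (hη.fderiv_apply e).bounded
  obtain ⟨C, -, hC⟩ := hη.bounded
  have hb : ∀ {G ψ : SpaceTime N → ℝ}, Integrable G → IsTestFunction univ ψ →
      Integrable fun z => G z * ψ z := fun hG hψ =>
    hψ.integrable_mul (hG.locallyIntegrable.locallyIntegrableOn _)
  rw [← integral_mul_avg hF (hη.fderiv_apply e).continuous hC' e (-s), ← integral_const_mul]
  have e1 : ∫ z, F (z + s • e) * η z = ∫ z, F z * η (z + (-s) • e) := by
    rw [← integral_add_right_eq_self (fun z => F z * η (z + (-s) • e)) (s • e)]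
    refine integral_congr_ae (Eventually.of_forall fun z => ?_)
    simp
  have e2 : ∫ z, (F (z + s • e) - F z) * η z = (∫ z, F (z + s • e) * η z) - ∫ z, F z * η z := by
    rw [← integral_sub (hb (hF.comp_add_right (s • e)) hη) (hb hF hη)]
    exact integral_congr_ae (Eventually.of_forall fun z => by ring)
  rw [e2, e1, ← integral_sub (hb hF (hη.translate _)) (hb hF hη)]
  refine integral_congr_ae (Eventually.of_forall fun z => ?_)
  have := testFunction_translate_sub hη e z (-s)
  simp only
  rw [← mul_sub, this]
  ring

/-- The same fundamental theorem for weak derivatives, by duality: both sides have equal integrals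
against every test function. -/
theorem HasWeakDeriv.translate_sub_ae_eq (h : HasWeakDeriv univ e f g) (hf : Integrable f)
    (hg : Integrable g) (s : ℝ) :
    (fun z => f (z + s • e) - f z) =ᵐ[volume] fun z => s * AnisoObstacle.avg unifLaw e s g z := by
  have hA := integrable_avg (ν := unifLaw) hg e s
  refine ae_eq_of_integral_contDiff_smul_eq
    ((hf.comp_add_right (s • e)).sub hf).locallyIntegrable (hA.const_mul s).locallyIntegrable
    fun η h1 h2 => ?_
  have hη : IsTestFunction univ η := ⟨h1, h2, subset_univ _⟩
  obtain ⟨C, -, hC⟩ := hη.bounded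
  have e1 := integral_translate_sub_mul hf hη e s
  have e2 := integral_avg_mul (ν := unifLaw) hg hη.continuous hC e s
  have e3 : ∀ θ : ℝ, ∫ z, f z * fderiv ℝ η (z + (-s * θ) • e) e
      = -∫ z, g z * η (z + (-s * θ) • e) := by
    intro θ
    have := h.integral_eq' (hη.translate ((-s * θ) • e))
    simpa only [fderiv_translate_apply] using this
  simp only [e3, integral_neg] at e1
  calc ∫ z, η z • (f (z + s • e) - f z) = ∫ z, (f (z + s • e) - f z) * η z :=
        integral_congr_ae (Eventually.of_forall fun z => by simp [mul_comm])
    _ = s * ∫ z, AnisoObstacle.avg unifLaw e s g z * η z := by rw [e1, e2]; ring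
    _ = ∫ z, η z • (s * AnisoObstacle.avg unifLaw e s g z) := by
        rw [← integral_const_mul]
        exact integral_congr_ae (Eventually.of_forall fun z => by simp only [smul_eq_mul]; ring)

/-- Difference quotients converge to the weak derivative. -/
theorem HasWeakDeriv.tendsto_diffQuot (h : HasWeakDeriv univ e f g) (hf : Integrable f)
    (hg : Integrable g) {p : ENNReal} (hp1 : 1 ≤ p) (hp : p ≠ ⊤) (hgp : MemLp g p)
    {s : ℕ → ℝ} (hs : Tendsto s atTop (𝓝 0)) (hs0 : ∀ n, s n ≠ 0) :
    Tendsto (fun n => eLpNorm (fun z => (s n)⁻¹ * (f (z + s n • e) - f z) - g z) p volume)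
      atTop (𝓝 0) := by
  refine ((tendsto_eLpNorm_avg_sub (ν := unifLaw) hp1 hp hgp hg e).comp hs).congr fun n => ?_
  refine eLpNorm_congr_ae ?_
  filter_upwards [h.translate_sub_ae_eq hf hg (s n)] with z hz
  rw [hz, inv_mul_cancel_left₀ (hs0 n)]

/-- Converse of `HasWeakDeriv.tendsto_diffQuot`. Tested against `η`, the quotient is minus the
average of `f` tested against `∂_e η`, and both sides converge. The rules for `max` and for squares
are proved by checking this `L¹` convergence. -/
theorem hasWeakDeriv_of_tendsto_diffQuot (hf : Integrable f) (hg : Integrable g)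
    {s : ℕ → ℝ} (hs : Tendsto s atTop (𝓝 0)) (hs0 : ∀ n, s n ≠ 0)
    (h : Tendsto (fun n => eLpNorm (fun z => (s n)⁻¹ * (f (z + s n • e) - f z) - g z) 1 volume)
      atTop (𝓝 0)) : HasWeakDeriv univ e f g := by
  refine hasWeakDeriv_univ_of_integral_eq hf hg fun η hη => ?_
  obtain ⟨C', -, hC'⟩ := (hη.fderiv_apply e).bounded
  have l1 : Tendsto (fun n => ∫ z, (s n)⁻¹ * (f (z + s n • e) - f z) * η z) atTop
      (𝓝 (∫ z, g z * η z)) :=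
    tendsto_integral_mul_of_eLpNorm_sub (p := 1) (q := ⊤)
      (fun n => memLp_one_iff_integrable.2 (((hf.comp_add_right _).sub hf).const_mul _))
      (memLp_one_iff_integrable.2 hg) (hη.memLp _ _) h
  have l2 : Tendsto (fun n => ∫ z, avg unifLaw e (s n) f z * fderiv ℝ η z e) atTop
      (𝓝 (∫ z, f z * fderiv ℝ η z e)) :=
    tendsto_integral_mul_of_eLpNorm_sub (p := 1) (q := ⊤)
      (fun n => memLp_one_iff_integrable.2 (integrable_avg hf _ _))
      (memLp_one_iff_integrable.2 hf) ((hη.fderiv_apply e).memLp _ _)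
      ((tendsto_eLpNorm_avg_sub le_rfl (by simp) (memLp_one_iff_integrable.2 hf) hf e).comp hs)
  have l3 : ∀ n, ∫ z, avg unifLaw e (s n) f z * fderiv ℝ η z e
      = -∫ z, (s n)⁻¹ * (f (z + s n • e) - f z) * η z := by
    intro n
    rw [integral_avg_mul hf (hη.fderiv_apply e).continuous hC' e (s n)]
    simp only [mul_assoc]
    rw [integral_const_mul, integral_translate_sub_mul hf hη e (s n)]
    field_simp [hs0 n]
  simp only [l3] at l2
  exact tendsto_nhds_unique l2 l1.neg

end AnisoObstacle

namespace AnisoObstacle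

variable {N : ℕ} {U V : Set (SpaceTime N)} {e : SpaceTime N} {f g f' g' η ζ : SpaceTime N → ℝ}

/-! ### Weak derivatives of truncations and squares. -/

section ChainRule

/-- The one-sided directional derivative of `max · k` at `a`, with value `c` at the kink. -/
noncomputable def maxSlope (k a q c : ℝ) : ℝ := if k < a then q else if a = k then c else 0

theorem abs_maxSlope_le {k a q c : ℝ} (hc : |c| ≤ |q|) : |maxSlope k a q c| ≤ |q| := by
  unfold maxSlope
  split_ifs <;> simp [hc]

/-- Off the kink the quotient is eventually constant, equal to `q` or to `0`. At `a = k` it is `s⁻¹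
max (s q) 0`, which depends only on the sign of `s`; `hc` fixes that common value. -/
theorem tendsto_maxQuot {k a q c : ℝ} {s : ℕ → ℝ} (hs : Tendsto s atTop (𝓝 0))
    (hs0 : ∀ n, s n ≠ 0) (hc : ∀ n, (s n)⁻¹ * max (s n * q) 0 = c) :
    Tendsto (fun n => (s n)⁻¹ * (max (a + s n * q) k - max a k)) atTop
      (𝓝 (maxSlope k a q c)) := by
  have ha : Tendsto (fun n => a + s n * q) atTop (𝓝 a) := by
    simpa using (hs.mul_const q).const_add a
  unfold maxSlope
  split_ifs with h1 h2
  · refine tendsto_const_nhds.congr' ?_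
    filter_upwards [ha.eventually (lt_mem_nhds h1)] with n hn
    rw [max_eq_left hn.le, max_eq_left h1.le, add_sub_cancel_left, inv_mul_cancel_left₀ (hs0 n)]
  · refine tendsto_const_nhds.congr fun n => ?_
    rw [← hc n, h2, max_self]
    congr 1
    rcases le_total (s n * q) 0 with h | h
    · rw [max_eq_right h, max_eq_right (by linarith), sub_self]
    · rw [max_eq_left h, max_eq_left (by linarith), add_sub_cancel_left]
  · refine tendsto_const_nhds.congr' ?_
    have h3 : a < k := lt_of_le_of_ne (not_lt.1 h1) h2
    filter_upwards [ha.eventually (gt_mem_nhds h3)] with n hn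
    rw [max_eq_right hn.le, max_eq_right h3.le, sub_self, mul_zero]

theorem abs_maxQuot_sub_le {k a q q' s : ℝ} (hs : s ≠ 0) :
    |s⁻¹ * (max (a + s * q) k - max a k) - s⁻¹ * (max (a + s * q') k - max a k)| ≤ |q - q'| := by
  rw [← mul_sub, abs_mul, sub_sub_sub_cancel_right]
  have h1 : |max (a + s * q) k - max (a + s * q') k| ≤ |s * (q - q')| := by
    have := abs_max_sub_max_le_abs (a + s * q) (a + s * q') k
    rwa [add_sub_add_left_eq_sub, ← mul_sub] at this
  calc |s⁻¹| * |max (a + s * q) k - max (a + s * q') k| ≤ |s⁻¹| * |s * (q - q')| := by gcongr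
    _ = |q - q'| := by rw [← abs_mul, inv_mul_cancel_left₀ hs]

theorem aestronglyMeasurable_maxSlope {m : Measure (SpaceTime N)} {κ : ℝ → ℝ} (hκ : Measurable κ)
    (k : ℝ) (hf : AEStronglyMeasurable f m) (hg : AEStronglyMeasurable g m) :
    AEStronglyMeasurable (fun z => maxSlope k (f z) (g z) (κ (g z))) m := by
  have hm : Measurable fun q : ℝ × ℝ => maxSlope k q.1 q.2 (κ q.2) := by
    unfold maxSlope
    refine Measurable.ite (measurableSet_lt measurable_const measurable_fst) measurable_snd ?_
    exact Measurable.ite (measurableSet_eq_fun measurable_fst measurable_const)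
      (hκ.comp measurable_snd) measurable_const
  exact (hm.comp_aemeasurable (hf.aemeasurable.prodMk hg.aemeasurable)).aestronglyMeasurable

theorem abs_max_sub_max_zero_le (y k : ℝ) : |max y k - max 0 k| ≤ |y| := by
  simpa using abs_max_sub_max_le_abs y 0 k

theorem integrable_max_sub_max_zero {X : Type*} [MeasurableSpace X] {m : Measure X} {f : X → ℝ}
    (hf : Integrable f m) (k : ℝ) : Integrable (fun z => max (f z) k - max 0 k) m := by
  refine hf.mono ?_ (Eventually.of_forall fun z => abs_max_sub_max_zero_le _ _)
  exact (((measurable_id.max measurable_const).comp_aemeasurable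
    hf.1.aemeasurable).sub_const _).aestronglyMeasurable

/-- The difference quotient of `max f k` is a 1-Lipschitz function of the difference quotient of
`f`. Replacing the latter by `g` costs its `L¹` distance to `g` (`l1`); afterwards the limit is
pointwise and dominated by `2|g|` (`l2`). Subtracting `max 0 k` keeps the function integrable on the
whole space. -/
theorem HasWeakDeriv.max_of_integrable (h : HasWeakDeriv univ e f g) (hf : Integrable f)
    (hg : Integrable g) (k : ℝ) {κ : ℝ → ℝ} (hκ : Measurable κ) (hκ1 : ∀ q, |κ q| ≤ |q|)
    {s : ℕ → ℝ} (hs : Tendsto s atTop (𝓝 0)) (hs0 : ∀ n, s n ≠ 0)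
    (hκs : ∀ q n, (s n)⁻¹ * max (s n * q) 0 = κ q) :
    HasWeakDeriv univ e (fun z => max (f z) k - max 0 k)
      fun z => maxSlope k (f z) (g z) (κ (g z)) := by
  have hLm := aestronglyMeasurable_maxSlope hκ k hf.1 hg.1
  have hL : Integrable fun z => maxSlope k (f z) (g z) (κ (g z)) :=
    hg.mono hLm (Eventually.of_forall fun z => abs_maxSlope_le (hκ1 _))
  refine hasWeakDeriv_of_tendsto_diffQuot (integrable_max_sub_max_zero hf k) hL hs hs0 ?_
  set q : ℕ → SpaceTime N → ℝ := fun n z => (s n)⁻¹ * (f (z + s n • e) - f z) with hq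
  have hqint : ∀ n, Integrable (q n) := fun n => ((hf.comp_add_right _).sub hf).const_mul _
  have hqlim := h.tendsto_diffQuot hf hg le_rfl (by simp) (memLp_one_iff_integrable.2 hg) hs hs0
  have hHm : ∀ n {r : SpaceTime N → ℝ}, AEStronglyMeasurable r volume → AEStronglyMeasurable
      (fun z => (s n)⁻¹ * (max (f z + s n * r z) k - max (f z) k)) volume := by
    intro n r hr
    have : Measurable fun y : ℝ × ℝ => (s n)⁻¹ * (max (y.1 + s n * y.2) k - max y.1 k) := by
      fun_prop
    exact (this.comp_aemeasurable (hf.1.aemeasurable.prodMk hr.aemeasurable)).aestronglyMeasurable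
  have l1 : Tendsto (fun n => eLpNorm (fun z => (s n)⁻¹ * (max (f z + s n * q n z) k - max (f z) k)
      - (s n)⁻¹ * (max (f z + s n * g z) k - max (f z) k)) 1 volume) atTop (𝓝 0) :=
    tendsto_of_tendsto_of_tendsto_of_le_of_le tendsto_const_nhds hqlim (fun _ => zero_le)
      fun n => eLpNorm_mono fun z => abs_maxQuot_sub_le (hs0 n)
  have l2 : Tendsto (fun n => eLpNorm (fun z => (s n)⁻¹ * (max (f z + s n * g z) k - max (f z) k)
      - maxSlope k (f z) (g z) (κ (g z))) 1 volume) atTop (𝓝 0) := by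
    simp only [eLpNorm_one_eq_lintegral_enorm]
    have := tendsto_lintegral_of_dominated_convergence' (μ := (volume : Measure (SpaceTime N)))
      (F := fun n z => ‖(s n)⁻¹ * (max (f z + s n * g z) k - max (f z) k)
        - maxSlope k (f z) (g z) (κ (g z))‖ₑ) (f := fun _ => 0)
      (fun z => ‖g z‖ₑ + ‖g z‖ₑ) (fun n => ((hHm n hg.1).sub hLm).enorm) ?_ ?_ ?_
    · simpa using this
    · refine fun n => Eventually.of_forall fun z => (enorm_sub_le).trans (add_le_add ?_ ?_)
      · have := abs_maxQuot_sub_le (k := k) (a := f z) (q := g z) (q' := 0) (hs0 n)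
        rw [mul_zero, add_zero, sub_self, mul_zero, sub_zero, sub_zero] at this
        exact enorm_le_iff_norm_le.2 this
      · exact enorm_le_iff_norm_le.2 (abs_maxSlope_le (hκ1 _))
    · rw [lintegral_add_left' hg.1.enorm]
      exact ENNReal.add_ne_top.2 ⟨hg.2.ne, hg.2.ne⟩
    · refine Eventually.of_forall fun z => ?_
      have h1 := tendsto_maxQuot (k := k) (a := f z) (q := g z) hs hs0 (hκs (g z))
      have h2 := (h1.sub_const (maxSlope k (f z) (g z) (κ (g z)))).enorm
      simpa using h2
  have l3 := l1.add l2
  rw [add_zero] at l3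
  refine tendsto_of_tendsto_of_tendsto_of_le_of_le tendsto_const_nhds l3 (fun _ => zero_le)
    fun n => ?_
  refine (le_of_eq ?_).trans (eLpNorm_add_le (((hHm n (hqint n).1)).sub (hHm n hg.1))
    ((hHm n hg.1).sub hLm) le_rfl)
  congr 1
  ext z
  have e1 : f z + s n * q n z = f (z + s n • e) := by
    simp only [hq]
    rw [mul_inv_cancel_left₀ (hs0 n)]
    ring
  simp only [Pi.add_apply, e1]
  ring

/-- A local property of weak derivatives: it suffices to treat the product with cutoff functions. -/
theorem hasWeakDeriv_of_local (hU : IsOpen U) {F G : SpaceTime N → ℝ}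
    (hF : LocallyIntegrableOn F U) (hG : LocallyIntegrableOn G U)
    (h : ∀ ζ, IsTestFunction U ζ → ∃ F' G', HasWeakDeriv univ e F' G' ∧
      ∀ z, ζ z = 1 → fderiv ℝ ζ z e = 0 → F' z = F z ∧ G' z = G z) :
    HasWeakDeriv U e F G := by
  refine .of_integral_eq hF hG fun η hη => ?_
  obtain ⟨ζ, hζ, hζ1, -⟩ := exists_testFunction_one_nhds hη.compact_support hU hη.support_subset
  obtain ⟨F', G', hFG, heq⟩ := h ζ hζ
  have hloc : ∀ z ∈ tsupport η, F' z = F z ∧ G' z = G z := by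
    intro z hz
    have h1 : ζ =ᶠ[𝓝 z] fun _ => 1 := (eventually_nhdsSet_iff_forall.1 hζ1) z hz
    refine heq z h1.self_of_nhds ?_
    rw [h1.fderiv_eq]
    simp
  have := hFG.integral_eq' (hη.mono (subset_univ U))
  have e1 : ∀ z, F z * fderiv ℝ η z e = F' z * fderiv ℝ η z e := by
    intro z
    by_cases hz : z ∈ tsupport η
    · rw [(hloc z hz).1]
    · have : fderiv ℝ η z e = 0 :=
        image_eq_zero_of_notMem_tsupport (f := fun z => fderiv ℝ η z e)
          fun h => hz (tsupport_fderiv_apply_subset ℝ e h)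
      simp [this]
  have e2 : ∀ z, G z * η z = G' z * η z := by
    intro z
    by_cases hz : z ∈ tsupport η
    · rw [(hloc z hz).2]
    · simp [image_eq_zero_of_notMem_tsupport hz]
  simp only [e1, e2, this]

theorem locallyIntegrableOn_of_abs_le {X : Type*} [TopologicalSpace X] [MeasurableSpace X]
    {S : Set X} {F G : X → ℝ} {m : Measure X} (hF : LocallyIntegrableOn F S m)
    (hG : AEStronglyMeasurable G (m.restrict S)) (h : ∀ z, |G z| ≤ |F z|) :
    LocallyIntegrableOn G S m := by
  intro x hx
  obtain ⟨t, ht, hFt⟩ := hF x hx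
  refine ⟨t ∩ S, inter_mem ht self_mem_nhdsWithin, ?_⟩
  exact Integrable.mono (hFt.mono_set inter_subset_left) (hG.mono_set inter_subset_right)
    (Eventually.of_forall h)

theorem HasWeakDeriv.maxSlope (hU : IsOpen U) (h : HasWeakDeriv U e f g) (k : ℝ) {κ : ℝ → ℝ}
    (hκ : Measurable κ) (hκ1 : ∀ q, |κ q| ≤ |q|)
    {s : ℕ → ℝ} (hs : Tendsto s atTop (𝓝 0)) (hs0 : ∀ n, s n ≠ 0)
    (hκs : ∀ q n, (s n)⁻¹ * max (s n * q) 0 = κ q) :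
    HasWeakDeriv U e (fun z => max (f z) k)
      fun z => AnisoObstacle.maxSlope k (f z) (g z) (κ (g z)) := by
  have hfm := h.locallyIntegrable.aestronglyMeasurable
  have hgm := h.locallyIntegrable_deriv.aestronglyMeasurable
  have key : HasWeakDeriv U e (fun z => max (f z) k - max 0 k)
      fun z => AnisoObstacle.maxSlope k (f z) (g z) (κ (g z)) := by
    refine hasWeakDeriv_of_local hU ?_ ?_ fun ζ hζ => ?_
    · refine locallyIntegrableOn_of_abs_le h.locallyIntegrable ?_ fun z => abs_max_sub_max_zero_le _ _
      exact (((measurable_id.max measurable_const).comp_aemeasurable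
        hfm.aemeasurable).sub_const _).aestronglyMeasurable
    · exact locallyIntegrableOn_of_abs_le h.locallyIntegrable_deriv (aestronglyMeasurable_maxSlope hκ k hfm hgm)
        fun z => abs_maxSlope_le (hκ1 _)
    · have i1 : Integrable fun z => ζ z * f z := by
        simpa only [mul_comm] using hζ.integrable_mul h.locallyIntegrable
      have i2 : Integrable fun z => ζ z * g z := by
        simpa only [mul_comm] using hζ.integrable_mul h.locallyIntegrable_deriv
      have i3 : Integrable fun z => fderiv ℝ ζ z e * f z := by
        simpa only [mul_comm] using (hζ.fderiv_apply e).integrable_mul h.locallyIntegrable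
      refine ⟨_, _, (h.mul_testFunction hζ).max_of_integrable i1 (i2.add i3) k hκ hκ1 hs hs0 hκs,
        fun z h1 h2 => ?_⟩
      simp [h1, h2]
  simpa using key.add (hasWeakDeriv_const (max 0 k))

theorem tendsto_one_div_add_one : Tendsto (fun n : ℕ => 1 / ((n : ℝ) + 1)) atTop (𝓝 0) :=
  tendsto_one_div_add_atTop_nhds_zero_nat

/-- Positive steps select the positive part of `g` as slope at the kink; negative steps, in
`HasWeakDeriv.max_neg_slope`, select minus the negative part. -/
theorem HasWeakDeriv.max_pos_slope (hU : IsOpen U) (h : HasWeakDeriv U e f g) (k : ℝ) :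
    HasWeakDeriv U e (fun z => max (f z) k)
      fun z => AnisoObstacle.maxSlope k (f z) (g z) (max (g z) 0) := by
  refine h.maxSlope hU k (κ := fun q => max q 0) (by fun_prop)
    (fun q => by simpa using abs_max_sub_max_le_abs q 0 0)
    (s := fun n : ℕ => 1 / ((n : ℝ) + 1)) tendsto_one_div_add_one (fun n => by positivity)
    fun q n => ?_
  have hp : (0 : ℝ) < 1 / ((n : ℝ) + 1) := by positivity
  rw [show (0 : ℝ) = 1 / ((n : ℝ) + 1) * 0 by simp, ← mul_max_of_nonneg _ _ hp.le, mul_zero,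
    inv_mul_cancel_left₀ hp.ne']

theorem HasWeakDeriv.max_neg_slope (hU : IsOpen U) (h : HasWeakDeriv U e f g) (k : ℝ) :
    HasWeakDeriv U e (fun z => max (f z) k)
      fun z => AnisoObstacle.maxSlope k (f z) (g z) (-max (-g z) 0) := by
  refine h.maxSlope hU k (κ := fun q => -max (-q) 0) (by fun_prop)
    (fun q => by simpa using abs_max_sub_max_le_abs (-q) 0 0)
    (s := fun n : ℕ => -(1 / ((n : ℝ) + 1))) (by simpa using tendsto_one_div_add_one.neg)
    (fun n => by simp; positivity) fun q n => ?_
  have hp : (0 : ℝ) < 1 / ((n : ℝ) + 1) := by positivity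
  have : -(1 / ((n : ℝ) + 1)) * q = 1 / ((n : ℝ) + 1) * (-q) := by ring
  rw [this, show (0 : ℝ) = 1 / ((n : ℝ) + 1) * 0 by simp, ← mul_max_of_nonneg _ _ hp.le, mul_zero,
    inv_neg, neg_mul, inv_mul_cancel_left₀ hp.ne']

/-- The weak derivative vanishes almost everywhere on level sets. -/
theorem HasWeakDeriv.ae_eq_zero_of_eq (hU : IsOpen U) (h : HasWeakDeriv U e f g) (k : ℝ) :
    ∀ᵐ z ∂(volume.restrict U), f z = k → g z = 0 := by
  -- Both one-sided formulas are weak derivatives of the same function, hence agree a.e. On `{f =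
  -- k}` this reads `max g 0 = -max (-g) 0`, a nonnegative number equal to a nonpositive one.
  filter_upwards [(h.max_pos_slope hU k).ae_eq hU (h.max_neg_slope hU k)] with z hz hk
  simp only [AnisoObstacle.maxSlope, hk, lt_irrefl, if_false, if_true] at hz
  have h1 := le_max_right (g z) 0
  have h2 := le_max_right (-g z) 0
  have h3 := le_max_left (g z) 0
  have h4 := le_max_left (-g z) 0
  linarith

theorem HasWeakDeriv.max_const (hU : IsOpen U) (h : HasWeakDeriv U e f g) (k : ℝ) :
    HasWeakDeriv U e (fun z => max (f z) k) fun z => if k < f z then g z else 0 := by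
  refine (h.max_pos_slope hU k).congr_ae (ae_eq_refl _) ?_
  filter_upwards [h.ae_eq_zero_of_eq hU k] with z hz
  unfold AnisoObstacle.maxSlope
  split_ifs with h1 h2
  · rfl
  · simp [hz h2]
  · rfl

theorem HasWeakDeriv.min_const (hU : IsOpen U) (h : HasWeakDeriv U e f g) (k : ℝ) :
    HasWeakDeriv U e (fun z => min (f z) k) fun z => if f z < k then g z else 0 := by
  refine ((h.neg.max_const hU (-k)).neg).congr_ae (Eventually.of_forall fun z => ?_)
    (Eventually.of_forall fun z => ?_)
  · simp [max_neg_neg]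
  · by_cases hz : f z < k <;> simp [hz]

end ChainRule

theorem HasWeakDeriv.const_mul (h : HasWeakDeriv U e f g) (c : ℝ) :
    HasWeakDeriv U e (fun z => c * f z) fun z => c * g z := by
  refine .of_integral_eq (h.locallyIntegrable.smul c) (h.locallyIntegrable_deriv.smul c)
    fun η hη => ?_
  simp only [mul_assoc, integral_const_mul, h.integral_eq' hη, mul_neg]

/-- The quotient of `f²` is the quotient of `f` times `f(· + s e) + f`; both factors converge in
`L²`, so the product converges in `L¹`. -/
theorem HasWeakDeriv.sq (h : HasWeakDeriv univ e f g) (hf : Integrable f) (hg : Integrable g)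
    (hf2 : MemLp f 2) (hg2 : MemLp g 2) :
    HasWeakDeriv univ e (fun z => f z ^ 2) fun z => 2 * f z * g z := by
  have hfg : Integrable fun z => f z * g z := hf2.integrable_mul hg2
  have i1 : Integrable fun z => 2 * f z * g z := by
    simpa only [mul_assoc] using hfg.const_mul 2
  set s : ℕ → ℝ := fun n => 1 / ((n : ℝ) + 1) with hsdef
  have hs : Tendsto s atTop (𝓝 0) := tendsto_one_div_add_one
  have hs0 : ∀ n, s n ≠ 0 := fun n => by simp only [hsdef]; positivity
  refine hasWeakDeriv_of_tendsto_diffQuot hf2.integrable_sq i1 hs hs0 ?_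
  have hτ : ∀ a : SpaceTime N, MemLp (fun z => f (z + a)) 2 := fun a =>
    hf2.comp_measurePreserving (measurePreserving_add_right volume a)
  set D : ℕ → SpaceTime N → ℝ := fun n z => (s n)⁻¹ * (f (z + s n • e) - f z) with hD
  have hDm : ∀ n, MemLp (D n) 2 := fun n => ((hτ _).sub hf2).const_mul _
  have l1 := h.tendsto_diffQuot hf hg (p := 2) (by norm_num) (by simp) hg2 hs hs0
  have l2 : Tendsto (fun n => eLpNorm (fun z => f (z + s n • e) - f z) 2 volume) atTop (𝓝 0) := by
    refine (tendsto_eLpNorm_translate (by norm_num) (by simp) hf2).comp ?_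
    simpa using hs.smul_const e
  have l3 := (ENNReal.Tendsto.mul_const (b := eLpNorm f 2 volume + eLpNorm f 2 volume) l1
    (Or.inr (ENNReal.add_ne_top.2 ⟨hf2.2.ne, hf2.2.ne⟩))).add
    (ENNReal.Tendsto.mul_const (b := eLpNorm g 2 volume) l2 (Or.inr hg2.2.ne))
  rw [zero_mul, zero_mul, add_zero] at l3
  refine tendsto_of_tendsto_of_tendsto_of_le_of_le tendsto_const_nhds l3 (fun _ => zero_le)
    fun n => ?_
  have hprod : ∀ {a b : SpaceTime N → ℝ}, MemLp a 2 → MemLp b 2 →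
      eLpNorm (a * b) 1 volume ≤ eLpNorm a 2 volume * eLpNorm b 2 volume := fun ha hb => by
    simpa using eLpNorm_smul_le_mul_eLpNorm (p := 2) (q := 2) (r := 1) hb.1 ha.1
  have e1 : (fun z => (s n)⁻¹ * (f (z + s n • e) ^ 2 - f z ^ 2) - 2 * f z * g z)
      = (fun z => D n z - g z) * (fun z => f (z + s n • e) + f z)
        + (fun z => f (z + s n • e) - f z) * g := by
    ext z
    simp only [hD, Pi.add_apply, Pi.mul_apply]
    ring
  have m1 : MemLp (fun z => D n z - g z) 2 := (hDm n).sub hg2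
  have m2 : MemLp (fun z => f (z + s n • e) + f z) 2 := (hτ _).add hf2
  have m3 : MemLp (fun z => f (z + s n • e) - f z) 2 := (hτ _).sub hf2
  rw [e1]
  refine (eLpNorm_add_le (m1.1.mul m2.1) (m3.1.mul hg2.1) le_rfl).trans
    (add_le_add ((hprod m1 m2).trans ?_) (hprod m3 hg2))
  gcongr
  refine (eLpNorm_add_le (hτ _).1 hf2.1 (by norm_num)).trans ?_
  rw [eLpNorm_translate hf2.1]

/-- Allows a constant shift, which is not integrable on the whole space and so cannot be part of
`f`. -/
theorem HasWeakDeriv.add_const_sq (h : HasWeakDeriv univ e f g) (hf : Integrable f)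
    (hg : Integrable g) (hf2 : MemLp f 2) (hg2 : MemLp g 2) (c : ℝ) :
    HasWeakDeriv univ e (fun z => (f z + c) ^ 2) fun z => 2 * (f z + c) * g z := by
  have := ((h.sq hf hg hf2 hg2).add (h.const_mul (2 * c))).add (hasWeakDeriv_const (c ^ 2))
  refine this.congr_ae (Eventually.of_forall fun z => ?_) (Eventually.of_forall fun z => ?_)
  · ring
  · ring

end AnisoObstacle

namespace AnisoObstacle

variable {N : ℕ} {U V : Set (SpaceTime N)} {e : SpaceTime N} {f g f' g' η ζ : SpaceTime N → ℝ}

/-! ### Exponential mollification in time. -/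

section Mollifier

/-- The standard exponential law on `(0, ∞)`. -/
noncomputable def expLaw : Measure ℝ :=
  (volume.restrict (Ioi (0 : ℝ))).withDensity fun σ => ENNReal.ofReal (Real.exp (-σ))

theorem integrableOn_exp_neg_Ioi : IntegrableOn (fun σ : ℝ => Real.exp (-σ)) (Ioi 0) := by
  simpa using exp_neg_integrableOn_Ioi 0 one_pos

theorem integral_expLaw (F : ℝ → ℝ) :
    ∫ σ, F σ ∂expLaw = ∫ σ in Ioi (0 : ℝ), Real.exp (-σ) * F σ := by
  rw [expLaw, integral_withDensity_eq_integral_toReal_smul (by fun_prop)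
    (Eventually.of_forall fun _ => ENNReal.ofReal_lt_top)]
  simp only [ENNReal.toReal_ofReal (Real.exp_pos _).le, smul_eq_mul]

instance : IsProbabilityMeasure expLaw := by
  refine ⟨?_⟩
  rw [expLaw, withDensity_apply _ MeasurableSet.univ, setLIntegral_univ,
    ← ofReal_integral_eq_lintegral_ofReal integrableOn_exp_neg_Ioi
      (Eventually.of_forall fun _ => (Real.exp_pos _).le), integral_exp_neg_Ioi_zero]
  simp

/-- The exponential mollification of `f` in the past time direction, at scale `h`. -/
noncomputable def mollify (h : ℝ) (f : SpaceTime N → ℝ) : SpaceTime N → ℝ :=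
  avg expLaw (dirT N) (-h) f

/-- Integration by parts in `σ`: the derivative along `e` is `h⁻¹ d/dσ`, the density `exp (-σ)` is
minus its own derivative, and the boundary term at `σ = 0` is `-η z`. -/
theorem avg_expLaw_fderiv (hη : IsTestFunction U η) {h : ℝ} (hh : h ≠ 0) (z : SpaceTime N) :
    avg expLaw e h (fun y => fderiv ℝ η y e) z = h⁻¹ * (avg expLaw e h η z - η z) := by
  obtain ⟨C, -, hC⟩ := hη.bounded
  obtain ⟨C', -, hC'⟩ := (hη.fderiv_apply e).bounded
  have hline : Continuous fun σ : ℝ => z + (h * σ) • e := by fun_prop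
  have hd : ∀ σ : ℝ, HasDerivAt (fun σ : ℝ => Real.exp (-σ) * η (z + (h * σ) • e))
      (h * (Real.exp (-σ) * fderiv ℝ η (z + (h * σ) • e) e)
        - Real.exp (-σ) * η (z + (h * σ) • e)) σ := by
    intro σ
    have h1 : HasDerivAt (fun σ : ℝ => z + (h * σ) • e) (h • e) σ := by
      have := (((hasDerivAt_id σ).const_mul h).smul_const e).const_add z
      simpa using this
    have h2 := ((hη.differentiable (z + (h * σ) • e)).hasFDerivAt).comp_hasDerivAt σ h1
    have h3 : HasDerivAt (fun σ : ℝ => Real.exp (-σ)) (-Real.exp (-σ)) σ := by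
      simpa using (hasDerivAt_neg σ).exp
    have h4 := h3.mul h2
    simp only [map_smul, smul_eq_mul] at h4
    convert! h4 using 1
    simp only [Function.comp]
    ring
  have i1 : IntegrableOn (fun σ : ℝ => Real.exp (-σ) * fderiv ℝ η (z + (h * σ) • e) e) (Ioi 0) :=
    integrableOn_exp_neg_Ioi.mul_bdd (c := C')
      ((hη.fderiv_apply e).continuous.comp hline).aestronglyMeasurable
      (Eventually.of_forall fun σ => hC' _)
  have i2 : IntegrableOn (fun σ : ℝ => Real.exp (-σ) * η (z + (h * σ) • e)) (Ioi 0) :=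
    integrableOn_exp_neg_Ioi.mul_bdd (c := C)
      (hη.continuous.comp hline).aestronglyMeasurable (Eventually.of_forall fun σ => hC _)
  have hlim : Tendsto (fun σ : ℝ => Real.exp (-σ) * η (z + (h * σ) • e)) atTop (𝓝 0) := by
    refine Tendsto.zero_mul_isBoundedUnder_le ?_ ?_
    · exact Real.tendsto_exp_atBot.comp tendsto_neg_atTop_atBot
    · exact isBoundedUnder_of ⟨C, fun σ => hC _⟩
  have := integral_Ioi_of_hasDerivAt_of_tendsto (hd 0).continuousAt.continuousWithinAt
    (fun σ _ => hd σ) ((i1.const_mul h).sub i2) hlim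
  rw [integral_sub (i1.const_mul h) i2, integral_const_mul] at this
  simp only [avg, integral_expLaw]
  simp only [neg_zero, Real.exp_zero, mul_zero, zero_smul, add_zero, one_mul, zero_sub] at this
  rw [eq_inv_mul_iff_mul_eq₀ hh]
  linarith

/-- Averaging into the past is adjoint to averaging into the future, so this is `avg_expLaw_fderiv`
read by duality. The derivative has the sign of `f - mollify h f`, which later makes the time term
controllable. -/
theorem hasWeakDeriv_mollify_dirT (hf : Integrable f) {h : ℝ} (hh : h ≠ 0) :
    HasWeakDeriv univ (dirT N) (mollify h f) fun z => h⁻¹ * (f z - mollify h f z) := by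
  have hM : Integrable (mollify h f) := integrable_avg hf _ _
  refine hasWeakDeriv_univ_of_integral_eq hM ((hf.sub hM).const_mul _) fun η hη => ?_
  obtain ⟨C, -, hC⟩ := hη.bounded
  obtain ⟨C', -, hC'⟩ := (hη.fderiv_apply (dirT N)).bounded
  have hb : ∀ {F : SpaceTime N → ℝ}, Integrable F → Integrable fun z => F z * η z := fun hF =>
    hη.integrable_mul (hF.locallyIntegrable.locallyIntegrableOn _)
  have hswap : ∀ {ψ : SpaceTime N → ℝ} {K : ℝ}, Continuous ψ → (∀ z, |ψ z| ≤ K) →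
      ∫ z, mollify h f z * ψ z = ∫ z, f z * avg expLaw (dirT N) h ψ z := fun hψ hK => by
    rw [mollify, integral_avg_mul hf hψ hK, integral_mul_avg hf hψ hK, neg_neg]
  rw [hswap (hη.fderiv_apply _).continuous hC']
  simp only [avg_expLaw_fderiv hη hh]
  have e1 : ∫ z, h⁻¹ * (f z - mollify h f z) * η z
      = h⁻¹ * ((∫ z, f z * η z) - ∫ z, mollify h f z * η z) := by
    rw [← integral_sub (hb hf) (hb hM), ← integral_const_mul]
    exact integral_congr_ae (Eventually.of_forall fun z => by ring)
  have hA : Integrable fun z => f z * avg expLaw (dirT N) h η z := by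
    refine hf.mul_bdd (c := C) (aestronglyMeasurable_avg hη.continuous.aestronglyMeasurable _ _)
      (Eventually.of_forall fun z => ?_)
    have := norm_integral_le_of_norm_le_const (μ := expLaw)
      (f := fun θ => η (z + (h * θ) • dirT N)) (Eventually.of_forall fun θ => hC _)
    simpa [avg] using this
  have e2 : ∫ z, f z * (h⁻¹ * (avg expLaw (dirT N) h η z - η z))
      = h⁻¹ * ((∫ z, f z * avg expLaw (dirT N) h η z) - ∫ z, f z * η z) := by
    rw [← integral_sub hA (hb hf), ← integral_const_mul]
    exact integral_congr_ae (Eventually.of_forall fun z => by ring)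
  rw [e1, e2, hswap hη.continuous hC]
  ring

/-- The kernel of the exponential mollification at scale `h`. -/
noncomputable def expKernel (h : ℝ) : ℝ → ℝ :=
  (Ioi (0 : ℝ)).indicator fun τ => h⁻¹ * Real.exp (-(h⁻¹ * τ))

theorem memLp_expKernel {h : ℝ} (hh : 0 < h) : MemLp (expKernel h) 2 := by
  have hm : Measurable (expKernel h) := Measurable.indicator (by fun_prop) measurableSet_Ioi
  rw [memLp_two_iff_integrable_sq hm.aestronglyMeasurable]
  have h1 : (fun τ => expKernel h τ ^ 2)
      = (Ioi (0 : ℝ)).indicator fun τ => h⁻¹ ^ 2 * Real.exp (-(2 * h⁻¹) * τ) := by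
    ext τ
    by_cases hτ : τ ∈ Ioi (0 : ℝ)
    · simp only [expKernel, indicator_of_mem hτ, mul_pow, ← Real.exp_nat_mul]
      congr 2
      push_cast
      ring
    · simp [expKernel, indicator_of_notMem hτ]
  rw [h1, integrable_indicator_iff measurableSet_Ioi]
  exact (exp_neg_integrableOn_Ioi 0 (by positivity)).const_mul _

/-- The substitution `τ = t - h σ` presents every time slice, not just almost every one, as an
integral against an `L²` kernel; `ContinuousInL2` speaks about every slice. -/
theorem mollify_eq_integral_kernel {h : ℝ} (hh : 0 < h) (f : SpaceTime N → ℝ)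
    (x : EuclideanSpace ℝ (Fin N)) (t : ℝ) :
    mollify h f (x, t) = ∫ τ, expKernel h (t - τ) * f (x, τ) := by
  have h1 : mollify h f (x, t)
      = ∫ σ, (Ioi (0 : ℝ)).indicator (fun σ => Real.exp (-σ) * f (x, t - h * σ)) σ := by
    rw [integral_indicator measurableSet_Ioi, mollify, avg, integral_expLaw]
    refine integral_congr_ae (Eventually.of_forall fun σ => ?_)
    simp [dirT, sub_eq_add_neg]
  have h2 : ∀ σ : ℝ, (Ioi (0 : ℝ)).indicator (fun σ => Real.exp (-σ) * f (x, t - h * σ)) σ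
      = h * (fun y => expKernel h y * f (x, t - y)) (h * σ) := by
    intro σ
    by_cases hσ : σ ∈ Ioi (0 : ℝ)
    · have : h * σ ∈ Ioi (0 : ℝ) := mul_pos hh hσ
      simp only [expKernel, indicator_of_mem hσ, indicator_of_mem this]
      field_simp
    · have : h * σ ∉ Ioi (0 : ℝ) := fun h' => hσ ((pos_iff_pos_of_mul_pos h').1 hh)
      simp [expKernel, indicator_of_notMem hσ, indicator_of_notMem this]
  rw [h1]
  simp only [h2]
  rw [integral_const_mul,
    Measure.integral_comp_mul_left (fun y => expKernel h y * f (x, t - y)) h, abs_of_pos (inv_pos.2 hh), smul_eq_mul,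
    mul_inv_cancel_left₀ hh.ne', ← integral_sub_left_eq_self _ volume t]
  simp

/-- Cauchy–Schwarz in `τ` for almost every `x`, then integration in `x`. -/
theorem eLpNorm_integral_kernel_le {b : ℝ → ℝ} (hb : AEStronglyMeasurable b volume)
    (hf : AEStronglyMeasurable f volume) :
    eLpNorm (fun x => ∫ τ, b τ * f (x, τ)) 2 volume ≤ eLpNorm b 2 volume * eLpNorm f 2 volume := by
  have hsq : ∀ {X : Type} [MeasurableSpace X] {m : Measure X} (F : X → ℝ),
      eLpNorm F 2 m ^ (2 : ℝ) = ∫⁻ z, ‖F z‖ₑ ^ (2 : ℝ) ∂m := by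
    intro X _ m F
    rw [eLpNorm_eq_lintegral_rpow_enorm_toReal (by simp) (by simp), ← ENNReal.rpow_mul]
    simp
  rw [← ENNReal.rpow_le_rpow_iff (z := 2) (by norm_num), ENNReal.mul_rpow_of_nonneg _ _ (by norm_num),
    hsq (fun x => ∫ τ, b τ * f (x, τ)), hsq f, Measure.volume_eq_prod,
    lintegral_prod _ (by
      have := hf.enorm.pow_const (2 : ℝ)
      rwa [Measure.volume_eq_prod] at this)]
  rw [← lintegral_const_mul'' _ (by
    have := (hf.enorm.pow_const (2 : ℝ))
    rw [Measure.volume_eq_prod] at this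
    exact this.lintegral_prod_right')]
  refine lintegral_mono_ae ?_
  have hf' : AEStronglyMeasurable f ((volume : Measure (EuclideanSpace ℝ (Fin N))).prod
    (volume : Measure ℝ)) := hf
  filter_upwards [hf'.prodMk_left] with x hx
  rw [← hsq fun τ => f (x, τ), ← ENNReal.mul_rpow_of_nonneg _ _ (by norm_num)]
  refine ENNReal.rpow_le_rpow ?_ (by norm_num)
  calc ‖∫ τ, b τ * f (x, τ)‖ₑ ≤ eLpNorm (fun τ => b τ * f (x, τ)) 1 volume := by
        rw [eLpNorm_one_eq_lintegral_enorm]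
        exact enorm_integral_le_lintegral_enorm _
    _ ≤ _ := by
        simpa [Pi.mul_def] using eLpNorm_smul_le_mul_eLpNorm (p := 2) (q := 2) (r := 1) hx hb

theorem aestronglyMeasurable_integral_kernel {b : ℝ → ℝ} (hb : AEStronglyMeasurable b volume)
    (hf : AEStronglyMeasurable f volume) :
    AEStronglyMeasurable (fun x => ∫ τ, b τ * f (x, τ)) volume := by
  have hf' : AEStronglyMeasurable f ((volume : Measure (EuclideanSpace ℝ (Fin N))).prod
    (volume : Measure ℝ)) := hf
  exact ((hb.comp_quasiMeasurePreserving Measure.quasiMeasurePreserving_snd).mul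
    hf').integral_prod_right'

/-- Changing the time translates the kernel. The kernel jumps at `0`, but translation is continuous
in `L²` all the same. -/
theorem continuousInL2_mollify {h : ℝ} (hh : 0 < h) (hf : MemLp f 2)
    (Ω : Set (EuclideanSpace ℝ (Fin N))) (T : ℝ) : ContinuousInL2 Ω T (mollify h f) := by
  have hK := memLp_expKernel hh
  have hKt : ∀ t, MemLp (fun τ => expKernel h (t - τ)) 2 := fun t =>
    hK.comp_measurePreserving (Measure.measurePreserving_sub_left volume t)
  refine ⟨fun t _ => ?_, fun t _ => ?_⟩
  · refine MemLp.restrict _ ?_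
    simp only [mollify_eq_integral_kernel hh]
    refine ⟨aestronglyMeasurable_integral_kernel (hKt t).1 hf.1, ?_⟩
    exact (eLpNorm_integral_kernel_le (hKt t).1 hf.1).trans_lt
      (ENNReal.mul_lt_top (hKt t).2 hf.2)
  · have hf' : MemLp f 2 ((volume : Measure (EuclideanSpace ℝ (Fin N))).prod
      (volume : Measure ℝ)) := hf
    have hslice : ∀ᵐ x : EuclideanSpace ℝ (Fin N), MemLp (fun τ => f (x, τ)) 2 := by
      have h1 := ((memLp_two_iff_integrable_sq hf'.1).1 hf').prod_right_ae
      filter_upwards [h1, hf'.1.prodMk_left] with x hx hx'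
      exact (memLp_two_iff_integrable_sq hx').2 hx
    have hle : ∀ τ, eLpNorm (fun x => mollify h f (x, τ) - mollify h f (x, t)) 2
        (volume.restrict Ω)
        ≤ eLpNorm (fun a => expKernel h (a + (τ - t)) - expKernel h a) 2 volume
          * eLpNorm f 2 volume := by
      intro τ
      refine (eLpNorm_mono_measure _ Measure.restrict_le_self).trans ?_
      have h2 := eLpNorm_integral_kernel_le ((hKt τ).1.sub (hKt t).1) hf.1
      have h3 : eLpNorm (fun x => mollify h f (x, τ) - mollify h f (x, t)) 2 volume
          = eLpNorm (fun x => ∫ σ, (expKernel h (τ - σ) - expKernel h (t - σ)) * f (x, σ)) 2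
            volume := by
        refine eLpNorm_congr_ae ?_
        filter_upwards [hslice] with x hx
        have j : ∀ t, Integrable fun σ => expKernel h (t - σ) * f (x, σ) := fun t =>
          (hKt t).integrable_mul hx
        rw [mollify_eq_integral_kernel hh, mollify_eq_integral_kernel hh,
          ← integral_sub (j τ) (j t)]
        simp only [sub_mul]
      rw [h3]
      refine h2.trans (le_of_eq ?_)
      congr 1
      have h4 := eLpNorm_comp_measurePreserving (p := 2) (μ := (volume : Measure ℝ)) (ν := volume)
        (g := fun a => expKernel h (a + (τ - t)) - expKernel h a)
        (f := fun σ : ℝ => t - σ)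
        ((hK.1.comp_measurePreserving (measurePreserving_add_right volume (τ - t))).sub hK.1)
        (Measure.measurePreserving_sub_left volume t)
      rw [← h4]
      congr 1
      ext σ
      simp only [Pi.sub_apply, Function.comp]
      congr 2
      ring
    have hlim : Tendsto (fun τ => eLpNorm (fun a => expKernel h (a + (τ - t)) - expKernel h a) 2
        volume * eLpNorm f 2 volume) (𝓝[Icc 0 T] t) (𝓝 0) := by
      have h1 : Tendsto (fun τ : ℝ => τ - t) (𝓝[Icc 0 T] t) (𝓝 0) := by
        have : Tendsto (fun τ : ℝ => τ - t) (𝓝 t) (𝓝 (t - t)) := by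
          exact (continuous_id.sub continuous_const).tendsto t
        rw [sub_self] at this
        exact this.mono_left nhdsWithin_le_nhds
      have h2 := (tendsto_eLpNorm_translate (by norm_num) (by simp) hK).comp h1
      have := ENNReal.Tendsto.mul_const (b := eLpNorm f 2 volume) h2 (Or.inr hf.2.ne)
      simpa using this
    exact tendsto_of_tendsto_of_tendsto_of_le_of_le tendsto_const_nhds hlim (fun _ => zero_le) hle

end Mollifier

/-! ### Stability of the class `C([0,T]; L²)`. -/

namespace ContinuousInL2

variable {Ω Ω' : Set (EuclideanSpace ℝ (Fin N))} {T : ℝ} {u v b : SpaceTime N → ℝ}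

theorem mono (hu : ContinuousInL2 Ω T u) (h : Ω' ⊆ Ω) : ContinuousInL2 Ω' T u := by
  refine ⟨fun t ht => (hu.1 t ht).mono_measure (Measure.restrict_mono h le_rfl), fun t ht => ?_⟩
  exact tendsto_of_tendsto_of_tendsto_of_le_of_le tendsto_const_nhds (hu.2 t ht)
    (fun _ => zero_le) fun τ => eLpNorm_mono_measure _ (Measure.restrict_mono h le_rfl)

theorem add (hu : ContinuousInL2 Ω T u) (hv : ContinuousInL2 Ω T v) :
    ContinuousInL2 Ω T fun z => u z + v z := by
  refine ⟨fun t ht => (hu.1 t ht).add (hv.1 t ht), fun t ht => ?_⟩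
  have h0 := (hu.2 t ht).add (hv.2 t ht)
  rw [add_zero] at h0
  refine tendsto_of_tendsto_of_tendsto_of_le_of_le' tendsto_const_nhds h0
    (Eventually.of_forall fun _ => zero_le) ?_
  filter_upwards [self_mem_nhdsWithin] with τ hτ
  have := eLpNorm_add_le ((hu.1 τ hτ).1.sub (hu.1 t ht).1) ((hv.1 τ hτ).1.sub (hv.1 t ht).1)
    (p := 2) (by norm_num)
  refine (le_of_eq ?_).trans this
  congr 1
  ext x
  simp only [Pi.add_apply, Pi.sub_apply]
  ring

theorem comp_lipschitz (hΩ : volume Ω ≠ ⊤) (hu : ContinuousInL2 Ω T u) {G : ℝ → ℝ}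
    (hG : ∀ a b, |G a - G b| ≤ |a - b|) : ContinuousInL2 Ω T fun z => G (u z) := by
  have : IsFiniteMeasure (volume.restrict Ω) := ⟨by simpa using hΩ.lt_top⟩
  have hGc : Continuous G := by
    have : LipschitzWith 1 G := LipschitzWith.of_dist_le_mul fun a b => by
      simpa [Real.dist_eq] using hG a b
    exact this.continuous
  refine ⟨fun t ht => ?_, fun t ht => ?_⟩
  · have h1 : MemLp (fun x => |u (x, t)| + |G 0|) 2 (volume.restrict Ω) :=
      (hu.1 t ht).abs.add (memLp_const _)
    refine h1.mono (hGc.comp_aestronglyMeasurable (hu.1 t ht).1) (Eventually.of_forall fun x => ?_)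
    have h2 := hG (u (x, t)) 0
    rw [sub_zero] at h2
    have h3 := abs_sub_abs_le_abs_sub (G (u (x, t))) (G 0)
    rw [Real.norm_eq_abs, Real.norm_of_nonneg (by positivity)]
    linarith
  · exact tendsto_of_tendsto_of_tendsto_of_le_of_le tendsto_const_nhds (hu.2 t ht)
      (fun _ => zero_le) fun τ => eLpNorm_mono fun x => hG _ _

theorem neg (hu : ContinuousInL2 Ω T u) : ContinuousInL2 Ω T fun z => -u z := by
  refine ⟨fun t ht => (hu.1 t ht).neg, fun t ht => ?_⟩
  refine (hu.2 t ht).congr fun τ => ?_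
  rw [← eLpNorm_neg]
  congr 1
  ext x
  simp only [Pi.neg_apply]
  ring

theorem sub (hu : ContinuousInL2 Ω T u) (hv : ContinuousInL2 Ω T v) :
    ContinuousInL2 Ω T fun z => u z - v z := by
  simpa only [sub_eq_add_neg] using hu.add hv.neg

/-- The increment splits into `b(τ) (u(τ) - u(t))` and `(b(τ) - b(t)) u(t)`. Compactness of `closure
Ω` bounds `b` in the first term and makes its increment uniformly small in the second. -/
theorem continuous_mul (hΩ : Bornology.IsBounded Ω) (hΩm : MeasurableSet Ω) (hb : Continuous b)
    (hu : ContinuousInL2 Ω T u) : ContinuousInL2 Ω T fun z => b z * u z := by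
  have hcomp : IsCompact (closure Ω) := hΩ.isCompact_closure
  obtain ⟨M, hM⟩ : ∃ M, ∀ z ∈ closure Ω ×ˢ Icc 0 T, ‖b z‖ ≤ M :=
    (hcomp.prod isCompact_Icc).exists_bound_of_continuousOn hb.continuousOn
  have hslice : ∀ t, Continuous fun x : EuclideanSpace ℝ (Fin N) => b (x, t) := fun t =>
    hb.comp (by fun_prop)
  have hmul : ∀ {G : EuclideanSpace ℝ (Fin N) → ℝ} {F : EuclideanSpace ℝ (Fin N) → ℝ} {K : ℝ},
      (∀ x ∈ Ω, |F x| ≤ K) → eLpNorm (fun x => F x * G x) 2 (volume.restrict Ω)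
        ≤ ENNReal.ofReal K * eLpNorm G 2 (volume.restrict Ω) := by
    intro G F K hF
    refine eLpNorm_le_mul_eLpNorm_of_ae_le_mul ?_ 2
    filter_upwards [ae_restrict_mem hΩm] with x hx
    rw [norm_mul]
    exact mul_le_mul_of_nonneg_right (hF x hx) (norm_nonneg _)
  refine ⟨fun t ht => ?_, fun t ht => ?_⟩
  · refine ⟨(hslice t).aestronglyMeasurable.mul (hu.1 t ht).1, ?_⟩
    exact (hmul fun x hx => hM (x, t) ⟨subset_closure hx, ht⟩).trans_lt
      (ENNReal.mul_lt_top ENNReal.ofReal_lt_top (hu.1 t ht).2)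
  · have l1 : Tendsto (fun τ => ENNReal.ofReal M
        * eLpNorm (fun x => u (x, τ) - u (x, t)) 2 (volume.restrict Ω)) (𝓝[Icc 0 T] t) (𝓝 0) := by
      have := ENNReal.Tendsto.const_mul (a := ENNReal.ofReal M) (hu.2 t ht)
        (Or.inr ENNReal.ofReal_ne_top)
      simpa using this
    have l2 : Tendsto (fun τ => eLpNorm (fun x => (b (x, τ) - b (x, t)) * u (x, t)) 2
        (volume.restrict Ω)) (𝓝[Icc 0 T] t) (𝓝 0) := by
      rw [ENNReal.tendsto_nhds_zero]
      intro ε hε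
      have h1 : Tendsto (fun r : ℝ => ENNReal.ofReal r
          * eLpNorm (fun x => u (x, t)) 2 (volume.restrict Ω)) (𝓝[>] 0) (𝓝 0) := by
        have h2 : Tendsto (fun r : ℝ => ENNReal.ofReal r) (𝓝[>] 0) (𝓝 0) := by
          have := (ENNReal.continuous_ofReal.tendsto 0)
          rw [ENNReal.ofReal_zero] at this
          exact this.mono_left nhdsWithin_le_nhds
        have := ENNReal.Tendsto.mul_const
          (b := eLpNorm (fun x => u (x, t)) 2 (volume.restrict Ω)) h2 (Or.inr (hu.1 t ht).2.ne)
        simpa using this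
      obtain ⟨r, hr1, hr0⟩ := ((ENNReal.tendsto_nhds_zero.1 h1 ε hε).and
        (self_mem_nhdsWithin : Ioi (0 : ℝ) ∈ 𝓝[>] 0)).exists
      have h3 : ∀ᶠ τ in 𝓝 t, ∀ x ∈ closure Ω, |b (x, τ) - b (x, t)| ≤ r := by
        refine hcomp.eventually_forall_of_forall_eventually
          (P := fun τ x => |b (x, τ) - b (x, t)| ≤ r) fun x _ => ?_
        have hc : Continuous fun q : ℝ × EuclideanSpace ℝ (Fin N) =>
            |b (q.2, q.1) - b (q.2, t)| := by
          exact ((hb.comp (by fun_prop)).sub (hb.comp (by fun_prop))).abs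
        have h4 := hc.tendsto (t, x)
        simp only [sub_self, abs_zero] at h4
        exact (h4.eventually (gt_mem_nhds hr0)).mono fun q hq => hq.le
      filter_upwards [mem_nhdsWithin_of_mem_nhds h3] with τ hτ
      exact (hmul fun x hx => hτ x (subset_closure hx)).trans hr1
    have l3 := l1.add l2
    rw [add_zero] at l3
    refine tendsto_of_tendsto_of_tendsto_of_le_of_le' tendsto_const_nhds l3
      (Eventually.of_forall fun _ => zero_le) ?_
    filter_upwards [self_mem_nhdsWithin] with τ hτ
    have m1 : AEStronglyMeasurable (fun x => b (x, τ) * (u (x, τ) - u (x, t)))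
        (volume.restrict Ω) :=
      (hslice τ).aestronglyMeasurable.mul ((hu.1 τ hτ).1.sub (hu.1 t ht).1)
    have m2 : AEStronglyMeasurable (fun x => (b (x, τ) - b (x, t)) * u (x, t))
        (volume.restrict Ω) :=
      ((hslice τ).sub (hslice t)).aestronglyMeasurable.mul (hu.1 t ht).1
    have h5 := eLpNorm_add_le m1 m2 (p := 2) (by norm_num)
    refine (le_of_eq ?_).trans (h5.trans (add_le_add_left
      (hmul fun x hx => hM (x, τ) ⟨subset_closure hx, hτ⟩) _))
    congr 1
    ext x
    simp only [Pi.add_apply]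
    ring

theorem continuousOn_integral_sq (hu : ContinuousInL2 Ω T u) :
    ContinuousOn (fun t => ∫ x in Ω, u (x, t) ^ 2) (Icc 0 T) := by
  have hn : ∀ t ∈ Icc 0 T, ∫ x in Ω, u (x, t) ^ 2
      = (eLpNorm (fun x => u (x, t)) 2 (volume.restrict Ω)).toReal ^ 2 := by
    intro t ht
    have h1 := (hu.1 t ht).eLpNorm_eq_integral_rpow_norm (by simp) (by simp)
    rw [h1, ENNReal.toReal_ofReal (by positivity), ← Real.rpow_natCast, ← Real.rpow_mul
      (integral_nonneg fun x => by positivity)]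
    simp
  refine ContinuousOn.congr (f := fun t =>
    (eLpNorm (fun x => u (x, t)) 2 (volume.restrict Ω)).toReal ^ 2) ?_ fun t ht => hn t ht
  refine ContinuousOn.pow (fun t ht => ?_) 2
  have hd := (ENNReal.tendsto_toReal ENNReal.zero_ne_top).comp (hu.2 t ht)
  rw [ContinuousWithinAt, tendsto_iff_norm_sub_tendsto_zero]
  refine squeeze_zero' (Eventually.of_forall fun _ => norm_nonneg _) ?_ hd
  filter_upwards [self_mem_nhdsWithin] with τ hτ
  have hs : MemLp (fun x => u (x, τ) - u (x, t)) 2 (volume.restrict Ω) :=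
    (hu.1 τ hτ).sub (hu.1 t ht)
  have i1 : eLpNorm (fun x => u (x, τ)) 2 (volume.restrict Ω)
      ≤ eLpNorm (fun x => u (x, τ) - u (x, t)) 2 (volume.restrict Ω)
        + eLpNorm (fun x => u (x, t)) 2 (volume.restrict Ω) := by
    refine (le_of_eq ?_).trans (eLpNorm_add_le hs.1 (hu.1 t ht).1 (by norm_num))
    congr 1
    ext x
    simp
  have i2 : eLpNorm (fun x => u (x, t)) 2 (volume.restrict Ω)
      ≤ eLpNorm (fun x => u (x, τ) - u (x, t)) 2 (volume.restrict Ω)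
        + eLpNorm (fun x => u (x, τ)) 2 (volume.restrict Ω) := by
    rw [← eLpNorm_neg (f := fun x => u (x, τ) - u (x, t))]
    refine (le_of_eq ?_).trans (eLpNorm_add_le hs.neg.1 (hu.1 τ hτ).1 (by norm_num))
    congr 1
    ext x
    simp
  have j1 := ENNReal.toReal_mono (ENNReal.add_ne_top.2 ⟨hs.2.ne, (hu.1 t ht).2.ne⟩) i1
  have j2 := ENNReal.toReal_mono (ENNReal.add_ne_top.2 ⟨hs.2.ne, (hu.1 τ hτ).2.ne⟩) i2
  rw [ENNReal.toReal_add hs.2.ne (hu.1 t ht).2.ne] at j1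
  rw [ENNReal.toReal_add hs.2.ne (hu.1 τ hτ).2.ne] at j2
  simp only [Function.comp, Real.norm_eq_abs]
  exact abs_le.2 ⟨by linarith, by linarith⟩

end ContinuousInL2

end AnisoObstacle

namespace AnisoObstacle

variable {N : ℕ} {U V : Set (SpaceTime N)} {e : SpaceTime N} {f g f' g' η ζ : SpaceTime N → ℝ}

/-! ### Localization, order and uniform approximation under mollification. -/

section Utilities

theorem memLp_bdd_mul {X : Type*} [MeasurableSpace X] {m : Measure X} {b F : X → ℝ}
    {q : ENNReal} {C : ℝ} (hF : MemLp F q m) (hb : AEStronglyMeasurable b m)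
    (hC : ∀ x, |b x| ≤ C) : MemLp (fun x => b x * F x) q m := by
  refine hF.of_le_mul (c := C) (hb.mul hF.1) (Eventually.of_forall fun x => ?_)
  rw [norm_mul]
  exact mul_le_mul_of_nonneg_right (hC x) (norm_nonneg _)

theorem memLp_lipschitz_comp {X : Type*} [MeasurableSpace X] {m : Measure X} [IsFiniteMeasure m]
    {F : X → ℝ} {q : ENNReal} (hF : MemLp F q m) {G : ℝ → ℝ}
    (hG : ∀ a b, |G a - G b| ≤ |a - b|) : MemLp (fun x => G (F x)) q m := by
  have hGc : Continuous G := by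
    have : LipschitzWith 1 G := LipschitzWith.of_dist_le_mul fun a b => by
      simpa [Real.dist_eq] using hG a b
    exact this.continuous
  have h1 : MemLp (fun x => |F x| + |G 0|) q m := hF.abs.add (memLp_const _)
  refine h1.mono (hGc.comp_aestronglyMeasurable hF.1) (Eventually.of_forall fun x => ?_)
  have h2 := hG (F x) 0
  rw [sub_zero] at h2
  have h3 := abs_sub_abs_le_abs_sub (G (F x)) (G 0)
  rw [Real.norm_eq_abs, Real.norm_of_nonneg (by positivity)]
  linarith

theorem IsTestFunction.memLp_mul (hζ : IsTestFunction U ζ) (hU : IsOpen U) {q : ENNReal}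
    (hf : MemLp f q (volume.restrict U)) : MemLp (fun z => ζ z * f z) q := by
  obtain ⟨C, -, hC⟩ := hζ.bounded
  have h1 := memLp_bdd_mul hf hζ.continuous.aestronglyMeasurable hC
  rw [← memLp_indicator_iff_restrict hU.measurableSet] at h1
  convert! h1 using 1
  ext z
  by_cases hz : z ∈ U
  · rw [indicator_of_mem hz]
  · rw [indicator_of_notMem hz, hζ.eq_zero_of_notMem hz, zero_mul]

theorem IsTestFunction.integrable_of_memLp (hζ : IsTestFunction U ζ) (hU : IsOpen U)
    [IsFiniteMeasure (volume.restrict U)] {q : ENNReal} (hq : 1 ≤ q)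
    (hf : MemLp f q (volume.restrict U)) : Integrable fun z => ζ z * f z :=
  memLp_one_iff_integrable.1 (hζ.memLp_mul hU (hf.mono_exponent hq))

theorem IsTestFunction.continuous_mul (hζ : IsTestFunction U ζ) (hU : IsOpen U)
    (hf : ContinuousOn f U) : Continuous fun z => ζ z * f z := by
  rw [continuous_iff_continuousAt]
  intro z
  by_cases hz : z ∈ tsupport ζ
  · exact hζ.continuous.continuousAt.mul (hf.continuousAt (hU.mem_nhds (hζ.support_subset hz)))
  · have : (fun z => ζ z * f z) =ᶠ[𝓝 z] fun _ => 0 := by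
      filter_upwards [(isClosed_tsupport ζ).isOpen_compl.mem_nhds hz] with y hy
      rw [image_eq_zero_of_notMem_tsupport hy, zero_mul]
    exact continuousAt_const.congr this.symm

theorem isOpen_openCyl {Ω : Set (EuclideanSpace ℝ (Fin N))} (hΩ : IsOpen Ω) (T : ℝ) :
    IsOpen (openCyl Ω T) := hΩ.prod isOpen_Ioo

theorem openCyl_subset_cyl (Ω : Set (EuclideanSpace ℝ (Fin N))) (T : ℝ) :
    openCyl Ω T ⊆ cyl Ω T := prod_mono le_rfl Ioo_subset_Ioc_self

theorem isFiniteMeasure_restrict_openCyl {Ω : Set (EuclideanSpace ℝ (Fin N))}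
    (hΩ : Bornology.IsBounded Ω) (T : ℝ) : IsFiniteMeasure (volume.restrict (openCyl Ω T)) := by
  have hb : Bornology.IsBounded (openCyl Ω T) := hΩ.prod (Metric.isBounded_Ioo 0 T)
  exact ⟨by simpa using hb.measure_lt_top⟩

theorem mollify_mono_ae (hf : Integrable f) (hg : Integrable g) (hfg : f ≤ᵐ[volume] g) (h : ℝ) :
    mollify h f ≤ᵐ[volume] mollify h g := by
  have h1 : ∀ᵐ q : SpaceTime N × ℝ ∂(volume.prod expLaw),
      f (q.1 + (-h * q.2) • dirT N) ≤ g (q.1 + (-h * q.2) • dirT N) :=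
    (quasiMeasurePreserving_shear (μ := (volume : Measure (SpaceTime N))) expLaw
      (dirT N) (-h)).ae hfg
  filter_upwards [Measure.ae_ae_of_ae_prod h1,
    (integrable_shear_ae (ν := expLaw) hf (dirT N) (-h)).prod_right_ae,
    (integrable_shear_ae (ν := expLaw) hg (dirT N) (-h)).prod_right_ae] with z h2 h3 h4
  exact integral_mono_ae h3 h4 h2

theorem integrable_id_expLaw : Integrable (fun σ : ℝ => σ) expLaw := by
  rw [expLaw, integrable_withDensity_iff_integrable_smul' (by fun_prop)
    (Eventually.of_forall fun _ => ENNReal.ofReal_lt_top)]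
  have := Real.GammaIntegral_convergent (s := 2) (by norm_num)
  refine this.congr_fun_ae ?_
  filter_upwards with σ
  simp only [ENNReal.toReal_ofReal (Real.exp_pos _).le, smul_eq_mul]
  norm_num

theorem ae_expLaw_pos : ∀ᵐ σ ∂expLaw, 0 < σ :=
  (withDensity_absolutelyContinuous _ _).ae_le (ae_restrict_mem measurableSet_Ioi)

/-- Exponential mollification converges uniformly on uniformly continuous bounded functions. -/
theorem exists_abs_mollify_sub_le (hf : Continuous f) (hfs : HasCompactSupport f) {ε : ℝ}
    (hε : 0 < ε) : ∃ L : ℝ, 0 ≤ L ∧ ∀ h, 0 < h → ∀ z, |mollify h f z - f z| ≤ ε + L * h := by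
  obtain ⟨M, hM⟩ := hf.bounded_above_of_compact_support hfs
  have hM0 : 0 ≤ M := (norm_nonneg _).trans (hM 0)
  obtain ⟨δ, hδ, hδf⟩ := Metric.uniformContinuous_iff.1
    (hfs.uniformContinuous_of_continuous hf) ε hε
  have hdir : ‖dirT N‖ = 1 := by simp [dirT, Prod.norm_def]
  -- Uniform continuity covers `r < δ`; beyond `δ` the crude bound `2M` is at most `(2M/δ) r`. The
  -- exponential law has unbounded support, so a bound valid for all `r` is needed, and a linear one
  -- is integrable.
  have hmod : ∀ (z : SpaceTime N) (r : ℝ), 0 ≤ r →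
      |f (z + (-r) • dirT N) - f z| ≤ ε + 2 * M / δ * r := by
    intro z r hr
    rcases lt_or_ge r δ with h | h
    · have := hδf (a := z + (-r) • dirT N) (b := z) (by
        rw [dist_eq_norm, add_sub_cancel_left, norm_smul, hdir, mul_one, norm_neg,
          Real.norm_of_nonneg hr]
        exact h)
      rw [Real.dist_eq] at this
      have h2 : 0 ≤ 2 * M / δ * r := by positivity
      linarith
    · have h1 : |f (z + (-r) • dirT N) - f z| ≤ M + M :=
        (abs_sub _ _).trans (add_le_add (hM _) (hM _))
      have h2 : M + M ≤ 2 * M / δ * r := by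
        rw [div_mul_eq_mul_div, le_div_iff₀ hδ]
        nlinarith
      linarith
  set A := ∫ σ, σ ∂expLaw with hA
  have hA0 : 0 ≤ A := integral_nonneg_of_ae (ae_expLaw_pos.mono fun σ h => h.le)
  refine ⟨2 * M / δ * A, by positivity, fun h hh z => ?_⟩
  have hc : Continuous fun σ : ℝ => f (z + (-h * σ) • dirT N) := hf.comp (by fun_prop)
  have hi : Integrable (fun σ : ℝ => f (z + (-h * σ) • dirT N)) expLaw :=
    Integrable.of_bound hc.aestronglyMeasurable M (Eventually.of_forall fun σ => hM _)
  have e1 : mollify h f z - f z = ∫ σ, (f (z + (-h * σ) • dirT N) - f z) ∂expLaw := by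
    rw [integral_sub hi (integrable_const _)]
    simp [mollify, avg]
  have hi2 : Integrable (fun σ : ℝ => ε + 2 * M / δ * h * σ) expLaw :=
    (integrable_const _).add (integrable_id_expLaw.const_mul _)
  rw [e1, ← Real.norm_eq_abs]
  refine (norm_integral_le_of_norm_le hi2 ?_).trans (le_of_eq ?_)
  · filter_upwards [ae_expLaw_pos] with σ hσ
    have := hmod z (h * σ) (by positivity)
    rw [← neg_mul] at this
    rw [Real.norm_eq_abs]
    linarith
  · rw [integral_add (integrable_const _) (integrable_id_expLaw.const_mul _), integral_const_mul]
    simp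
    ring

end Utilities

/-- `f` is approximated by its mollifications from above an obstacle, up to small constants. -/
theorem exists_mollifying_sequence (hf : Integrable f) (hg : Continuous g)
    (hgs : HasCompactSupport g) (hgf : g ≤ᵐ[volume] f) :
    ∃ h ε : ℕ → ℝ, (∀ n, 0 < h n) ∧ Tendsto h atTop (𝓝 0) ∧ (∀ n, 0 ≤ ε n) ∧
      Tendsto ε atTop (𝓝 0) ∧ (∀ n, ∀ᵐ z, g z ≤ mollify (h n) f z + ε n) ∧
      ∀ᵐ z, Tendsto (fun n => mollify (h n) f z) atTop (𝓝 (f z)) := by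
  -- The scale is taken so small that the linear error `L h` is at most `1/(n+1)`, like the other
  -- one. The total `2/(n+1)` is the constant by which the mollification must be lifted.
  have hstep : ∀ n : ℕ, ∃ h : ℝ, 0 < h ∧ h ≤ 1 / ((n : ℝ) + 1) ∧
      ∀ z, |mollify h g z - g z| ≤ 2 * (1 / ((n : ℝ) + 1)) := by
    intro n
    have hp : (0 : ℝ) < 1 / ((n : ℝ) + 1) := by positivity
    obtain ⟨L, hL, hLh⟩ := exists_abs_mollify_sub_le hg hgs hp
    refine ⟨1 / ((n : ℝ) + 1) / (L + 1), by positivity, ?_, fun z => ?_⟩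
    · exact div_le_self hp.le (by linarith)
    · refine (hLh _ (by positivity) z).trans ?_
      have : L * (1 / ((n : ℝ) + 1) / (L + 1)) ≤ 1 / ((n : ℝ) + 1) := by
        rw [mul_div_assoc', div_le_iff₀ (by linarith)]
        nlinarith
      linarith
  choose h hh0 hh1 hh2 using hstep
  have hlim : Tendsto h atTop (𝓝 0) :=
    tendsto_of_tendsto_of_tendsto_of_le_of_le tendsto_const_nhds tendsto_one_div_add_one
      (fun n => (hh0 n).le) hh1
  have hgi : Integrable g := hg.integrable_of_hasCompactSupport hgs
  -- Mollification preserves order, and the continuous function `g` is uniformly close to its own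
  -- mollification.
  have hge : ∀ n, ∀ᵐ z, g z ≤ mollify (h n) f z + 2 * (1 / ((n : ℝ) + 1)) := by
    intro n
    filter_upwards [mollify_mono_ae hgi hf hgf (h n)] with z hz
    have := (abs_le.1 (hh2 n z)).1
    linarith
  have hL1 : Tendsto (fun n => eLpNorm (mollify (h n) f - f) 1 volume) atTop (𝓝 0) := by
    have h1 : Tendsto (fun n => -h n) atTop (𝓝 0) := by simpa using hlim.neg
    exact (tendsto_eLpNorm_avg_sub (ν := expLaw) le_rfl (by simp)
      (memLp_one_iff_integrable.2 hf) hf (dirT N)).comp h1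
  -- Pointwise convergence, obtained along a subsequence, is needed for the discontinuous indicator
  -- in the derivative of a truncation.
  obtain ⟨ns, hns, hae⟩ := (tendstoInMeasure_of_tendsto_eLpNorm one_ne_zero
    (fun n => (integrable_avg hf (dirT N) (-h n)).1) hf.1 hL1).exists_seq_tendsto_ae
  refine ⟨h ∘ ns, fun n => 2 * (1 / ((ns n : ℝ) + 1)), fun n => hh0 _,
    hlim.comp hns.tendsto_atTop, fun n => by positivity, ?_, fun n => hge _, hae⟩
  have := (tendsto_one_div_add_one.const_mul 2).comp hns.tendsto_atTop
  simpa [Function.comp_def] using this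

/-- The truncations `max · k` (with `S = (k, ∞)`) and `min · k` (with `S = (-∞, k)`). -/
structure IsTruncation (N : ℕ) (k : ℝ) (G : ℝ → ℝ) (S : Set ℝ) : Prop where
  lipschitz : ∀ a b, |G a - G b| ≤ |a - b|
  isOpen : IsOpen S
  eq_self : ∀ y ∈ S, G y = y
  compl_mem_nhds : ∀ y ∉ S, y ≠ k → Sᶜ ∈ 𝓝 y
  hasWeakDeriv : ∀ {U : Set (SpaceTime N)} {e : SpaceTime N} {f g : SpaceTime N → ℝ},
    IsOpen U → HasWeakDeriv U e f g → HasWeakDeriv U e (fun z => G (f z))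
      fun z => S.indicator (fun _ => (1 : ℝ)) (f z) * g z

theorem isTruncation_max (N : ℕ) (k : ℝ) : IsTruncation N k (fun y => max y k) (Ioi k) where
  lipschitz a b := abs_max_sub_max_le_abs a b k
  isOpen := isOpen_Ioi
  eq_self y hy := max_eq_left (le_of_lt hy)
  compl_mem_nhds y hy hk := by
    filter_upwards [Iio_mem_nhds (lt_of_le_of_ne (not_lt.1 hy) hk)] with x hx
    exact not_lt.2 (le_of_lt (mem_Iio.1 hx))
  hasWeakDeriv hU h := (h.max_const hU k).congr_ae (ae_eq_refl _)
    (Eventually.of_forall fun z => by simp [indicator_apply])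

theorem isTruncation_min (N : ℕ) (k : ℝ) : IsTruncation N k (fun y => min y k) (Iio k) where
  lipschitz a b := by
    have := abs_max_sub_max_le_abs (-a) (-b) (-k)
    rw [max_neg_neg, max_neg_neg] at this
    rwa [neg_sub_neg, neg_sub_neg, abs_sub_comm, abs_sub_comm b] at this
  isOpen := isOpen_Iio
  eq_self y hy := min_eq_left (le_of_lt hy)
  compl_mem_nhds y hy hk := by
    filter_upwards [Ioi_mem_nhds (lt_of_le_of_ne (not_lt.1 hy) hk.symm)] with x hx
    exact not_lt.2 (le_of_lt (mem_Ioi.1 hx))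
  hasWeakDeriv hU h := (h.min_const hU k).congr_ae (ae_eq_refl _)
    (Eventually.of_forall fun z => by simp [indicator_apply])

end AnisoObstacle

namespace AnisoObstacle

variable {N : ℕ} {U V : Set (SpaceTime N)} {e : SpaceTime N} {f g f' g' η ζ : SpaceTime N → ℝ}

/-! ### Limits of products, and the time term for mollified truncations. -/

section Limits

variable {X : Type*} [MeasurableSpace X] {m : Measure X}

/-- The factors `χ n` need not converge where the limit sits at the kink; only `χ n * M₀` has to,
and `M₀` will be a gradient that vanishes there. The part with `M n - M₀` is small in `L^p` since
`|χ n| ≤ 1`, and the part with `M₀` is dominated. -/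
theorem tendsto_integral_mul_indicator {p q : ENNReal} [ENNReal.HolderTriple p q 1]
    {M : ℕ → X → ℝ} {M₀ a : X → ℝ} (hM : ∀ n, MemLp (M n) p m) (hM₀ : MemLp M₀ p m)
    (ha : MemLp a q m) (h : Tendsto (fun n => eLpNorm (fun x => M n x - M₀ x) p m) atTop (𝓝 0))
    {χ : ℕ → X → ℝ} {χ₀ : X → ℝ} (hχ : ∀ n, AEStronglyMeasurable (χ n) m)
    (hχ1 : ∀ n x, |χ n x| ≤ 1)
    (hlim : ∀ᵐ x ∂m, Tendsto (fun n => χ n x * M₀ x) atTop (𝓝 (χ₀ x * M₀ x))) :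
    Tendsto (fun n => ∫ x, χ n x * M n x * a x ∂m) atTop (𝓝 (∫ x, χ₀ x * M₀ x * a x ∂m)) := by
  have hd : ∀ n, MemLp (fun x => χ n x * (M n x - M₀ x)) p m := fun n =>
    memLp_bdd_mul ((hM n).sub hM₀) (hχ n) (hχ1 n)
  have h0 : ∀ n, MemLp (fun x => χ n x * M₀ x) p m := fun n => memLp_bdd_mul hM₀ (hχ n) (hχ1 n)
  have hm : ∀ {F : X → ℝ}, MemLp F p m → Integrable (fun x => F x * a x) m := fun hF =>
    memLp_one_iff_integrable.1 (ha.mul hF)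
  have l1 : Tendsto (fun n => ∫ x, χ n x * (M n x - M₀ x) * a x ∂m) atTop (𝓝 0) := by
    have := tendsto_integral_mul_of_eLpNorm_sub (l := atTop) (F₀ := fun _ => (0 : ℝ)) hd MemLp.zero ha ?_
    · simpa using this
    · refine tendsto_of_tendsto_of_tendsto_of_le_of_le tendsto_const_nhds h (fun _ => zero_le)
        fun n => eLpNorm_mono fun x => ?_
      rw [sub_zero, norm_mul]
      exact mul_le_of_le_one_left (norm_nonneg _) (hχ1 n x)
  have l2 : Tendsto (fun n => ∫ x, χ n x * M₀ x * a x ∂m) atTop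
      (𝓝 (∫ x, χ₀ x * M₀ x * a x ∂m)) := by
    refine tendsto_integral_of_dominated_convergence (fun x => ‖M₀ x * a x‖)
      (fun n => (hm (h0 n)).1) (hm hM₀).norm (fun n => Eventually.of_forall fun x => ?_) ?_
    · rw [mul_assoc, norm_mul]
      exact mul_le_of_le_one_left (norm_nonneg _) (hχ1 n x)
    · filter_upwards [hlim] with x hx using hx.mul_const _
  have l3 := l1.add l2
  rw [zero_add] at l3
  refine l3.congr fun n => ?_
  rw [← integral_add (hm (hd n)) (hm (h0 n))]
  exact integral_congr_ae (Eventually.of_forall fun x => by ring)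

/-- Factor `a² - a₀² = (a - a₀)((a - a₀) + 2a₀)` and apply Cauchy–Schwarz. -/
theorem tendsto_integral_sq_mul {a : ℕ → X → ℝ} {a₀ b : X → ℝ} (ha : ∀ n, MemLp (a n) 2 m)
    (ha₀ : MemLp a₀ 2 m) (hb : MemLp b ⊤ m)
    (h : Tendsto (fun n => eLpNorm (fun x => a n x - a₀ x) 2 m) atTop (𝓝 0)) :
    Tendsto (fun n => ∫ x, a n x ^ 2 * b x ∂m) atTop (𝓝 (∫ x, a₀ x ^ 2 * b x ∂m)) := by
  refine tendsto_integral_mul_of_eLpNorm_sub (p := 1) (q := ⊤)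
    (fun n => memLp_one_iff_integrable.2 (ha n).integrable_sq)
    (memLp_one_iff_integrable.2 ha₀.integrable_sq) hb ?_
  have hK : 2 * eLpNorm a₀ 2 m ≠ ⊤ := ENNReal.mul_ne_top (by simp) ha₀.2.ne
  have l1 : Tendsto (fun n => eLpNorm (fun x => a n x - a₀ x) 2 m
      * (eLpNorm (fun x => a n x - a₀ x) 2 m + 2 * eLpNorm a₀ 2 m)) atTop (𝓝 0) := by
    have := ENNReal.Tendsto.mul h (Or.inr (by simpa using hK)) (h.add_const (2 * eLpNorm a₀ 2 m))
      (Or.inr (by simp))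
    simpa using this
  refine tendsto_of_tendsto_of_tendsto_of_le_of_le tendsto_const_nhds l1 (fun _ => zero_le)
    fun n => ?_
  have m1 : MemLp (fun x => a n x - a₀ x) 2 m := (ha n).sub ha₀
  have m2 : MemLp (fun x => (a n x - a₀ x) + 2 * a₀ x) 2 m := m1.add (ha₀.const_mul 2)
  have h1 := eLpNorm_smul_le_mul_eLpNorm (p := 2) (q := 2) (r := 1) m2.1 m1.1
  have h2 := eLpNorm_add_le m1.1 (ha₀.const_mul 2).1 (p := 2) (by norm_num)
  have h3 : eLpNorm (fun x => 2 * a₀ x) 2 m = 2 * eLpNorm a₀ 2 m := by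
    have := eLpNorm_const_smul (2 : ℝ) a₀ 2 m
    simpa [Pi.smul_def, enorm_eq_nnnorm] using this
  rw [h3] at h2
  calc eLpNorm (fun x => a n x ^ 2 - a₀ x ^ 2) 1 m
      = eLpNorm ((fun x => a n x - a₀ x) • fun x => (a n x - a₀ x) + 2 * a₀ x) 1 m := by
        congr 1
        ext x
        simp only [Pi.smul_apply', smul_eq_mul]
        ring
    _ ≤ _ := h1
    _ ≤ _ := by
        gcongr
        exact h2

theorem memLp_flux {F : X → ℝ} {p : ℝ} (hp : 2 ≤ p) (hF : MemLp F (ENNReal.ofReal p) m) :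
    MemLp (fun x => |F x| ^ (p - 2) * F x) (ENNReal.ofReal (p / (p - 1))) m := by
  have h1 := hF.norm_rpow_div (ENNReal.ofReal (p - 1))
  rw [← ENNReal.ofReal_div_of_pos (by linarith), ENNReal.toReal_ofReal (by linarith)] at h1
  refine h1.mono ?_ (Eventually.of_forall fun x => ?_)
  · exact ((hF.1.aemeasurable.abs.pow_const _).mul hF.1.aemeasurable).aestronglyMeasurable
  · simp only [norm_mul, Real.norm_eq_abs, Real.abs_rpow_of_nonneg (abs_nonneg (F x)), abs_abs]
    rcases eq_or_ne (F x) 0 with h | h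
    · rw [h, abs_zero, mul_zero]
      positivity
    · rw [← Real.rpow_add_one (abs_pos.2 h).ne']
      apply le_of_eq
      congr 1
      ring

theorem holderTriple_ofReal {p : ℝ} (hp : 2 ≤ p) :
    ENNReal.HolderTriple (ENNReal.ofReal p) (ENNReal.ofReal (p / (p - 1))) 1 :=
  ((Real.holderConjugate_iff_eq_conjExponent (by linarith)).2 rfl).ennrealOfReal

end Limits

theorem IsTruncation.abs_le {k : ℝ} {G : ℝ → ℝ} {S : Set ℝ} (_ : IsTruncation N k G S) (y : ℝ) :
    |S.indicator (fun _ => (1 : ℝ)) y| ≤ 1 := by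
  by_cases h : y ∈ S <;> simp [h]

theorem IsTruncation.continuous {k : ℝ} {G : ℝ → ℝ} {S : Set ℝ} (hT : IsTruncation N k G S) :
    Continuous G := by
  have : LipschitzWith 1 G := LipschitzWith.of_dist_le_mul fun a b => by
    simpa [Real.dist_eq] using hT.lipschitz a b
  exact this.continuous

theorem IsTruncation.aestronglyMeasurable_indicator {k : ℝ} {G : ℝ → ℝ} {S : Set ℝ}
    (hT : IsTruncation N k G S) {X : Type*} [MeasurableSpace X] {m : Measure X} {F : X → ℝ}
    (hF : AEStronglyMeasurable F m) :
    AEStronglyMeasurable (fun x => S.indicator (fun _ => (1 : ℝ)) (F x)) m :=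
  ((measurable_const.indicator hT.isOpen.measurableSet).comp_aemeasurable
    hF.aemeasurable).aestronglyMeasurable

theorem IsTruncation.tendsto_indicator {k : ℝ} {G : ℝ → ℝ} {S : Set ℝ}
    (hT : IsTruncation N k G S) {y : ℝ} (hy : y ≠ k) {x : ℕ → ℝ} (hx : Tendsto x atTop (𝓝 y)) :
    Tendsto (fun n => S.indicator (fun _ => (1 : ℝ)) (x n)) atTop
      (𝓝 (S.indicator (fun _ => (1 : ℝ)) y)) := by
  refine tendsto_const_nhds.congr' ?_
  by_cases h : y ∈ S
  · filter_upwards [hx (hT.isOpen.mem_nhds h)] with n hn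
    rw [indicator_of_mem h, indicator_of_mem (show x n ∈ S from hn)]
  · filter_upwards [hx (hT.compl_mem_nhds y h hy)] with n hn
    rw [indicator_of_notMem h, indicator_of_notMem (show x n ∉ S from hn)]

/-- The time term for truncations of the mollification is almost an exact derivative. -/
theorem integral_time_mollify_le {k : ℝ} {G : ℝ → ℝ} {S : Set ℝ} (hT : IsTruncation N k G S)
    (hf : Integrable f) (hf2 : MemLp f 2) {h : ℝ} (hh : 0 < h) (c : ℝ)
    (hη : IsTestFunction univ η) (hη0 : ∀ z, 0 ≤ η z) :
    ∫ z, (fderiv ℝ η z (dirT N) * (1 / 2 * f z ^ 2 - f z * G (mollify h f z + c))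
        - η z * f z * (S.indicator (fun _ => (1 : ℝ)) (mollify h f z + c)
          * (h⁻¹ * (f z - mollify h f z))))
      ≤ 1 / 2 * (∫ z, (G (mollify h f z + c) - f z) ^ 2 * fderiv ℝ η z (dirT N))
        - c * ∫ z, G (mollify h f z + c) * fderiv ℝ η z (dirT N) := by
  have hMi : Integrable (mollify h f) := integrable_avg hf _ _
  have hM2 : MemLp (mollify h f) 2 := memLp_avg (by norm_num) (by simp) hf2 _ _
  set M := mollify h f with hM
  set ψ : SpaceTime N → ℝ := fun z => fderiv ℝ η z (dirT N) with hψdef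
  have hψ : IsTestFunction univ ψ := hη.fderiv_apply _
  set W : SpaceTime N → ℝ := fun z => G (M z + c) with hW
  set W' : SpaceTime N → ℝ := fun z => S.indicator (fun _ => (1 : ℝ)) (M z + c)
    * (h⁻¹ * (f z - M z)) with hW'
  have hWd : HasWeakDeriv univ (dirT N) W W' := by
    have h1 := (hasWeakDeriv_mollify_dirT hf hh.ne').add (hasWeakDeriv_const c)
    have h2 := hT.hasWeakDeriv isOpen_univ h1
    simpa only [add_zero] using h2
  have hWm : AEStronglyMeasurable W volume :=
    hT.continuous.comp_aestronglyMeasurable (hMi.1.add_const c)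
  -- `W` tends to `G c`, not to zero, where the mollification is small; the square rule is therefore
  -- applied to `W - G c`.
  have hYle : ∀ z, ‖W z - G c‖ ≤ ‖M z‖ := fun z => by
    simpa using hT.lipschitz (M z + c) c
  have hYi : Integrable fun z => W z - G c :=
    hMi.mono (hWm.sub aestronglyMeasurable_const) (Eventually.of_forall hYle)
  have hY2 : MemLp (fun z => W z - G c) 2 :=
    hM2.mono (hWm.sub aestronglyMeasurable_const) (Eventually.of_forall hYle)
  have hχm := hT.aestronglyMeasurable_indicator (hMi.1.add_const c)
  have hW'2 : MemLp W' 2 :=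
    memLp_bdd_mul ((hf2.sub hM2).const_mul h⁻¹) hχm fun z => hT.abs_le _
  have hW'i : Integrable W' := memLp_one_iff_integrable.1
    (memLp_bdd_mul (memLp_one_iff_integrable.2 ((hf.sub hMi).const_mul h⁻¹)) hχm
      fun z => hT.abs_le _)
  have hYd : HasWeakDeriv univ (dirT N) (fun z => W z - G c) W' := by
    simpa using hWd.sub (hasWeakDeriv_const (G c))
  have hsq : HasWeakDeriv univ (dirT N) (fun z => W z ^ 2) fun z => 2 * W z * W' z := by
    simpa using hYd.add_const_sq hYi hW'i hY2 hW'2 (G c)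
  have e1 := hsq.integral_eq' hη
  have e2 := hWd.integral_eq' hη
  have i1 : Integrable fun z => W z ^ 2 * ψ z := hψ.integrable_mul hsq.locallyIntegrable
  have i2 : Integrable fun z => 2 * W z * W' z * η z :=
    hη.integrable_mul hsq.locallyIntegrable_deriv
  have i3 : Integrable fun z => W z * ψ z := hψ.integrable_mul hWd.locallyIntegrable
  have i4 : Integrable fun z => W' z * η z := hη.integrable_mul hWd.locallyIntegrable_deriv
  have i5 : Integrable fun z => f z ^ 2 * ψ z :=
    hψ.integrable_mul (hf2.integrable_sq.locallyIntegrable.locallyIntegrableOn _)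
  have i6 : Integrable fun z => f z * W z * ψ z := by
    have h1 : Integrable fun z => f z * (W z - G c) * ψ z :=
      hψ.integrable_mul ((hf2.integrable_mul hY2).locallyIntegrable.locallyIntegrableOn _)
    have h2 : Integrable fun z => f z * ψ z :=
      hψ.integrable_mul (hf.locallyIntegrable.locallyIntegrableOn _)
    refine (h1.add (h2.const_mul (G c))).congr (Eventually.of_forall fun z => ?_)
    simp only [Pi.add_apply]
    ring
  have i7 : Integrable fun z => f z * W' z * η z :=
    hη.integrable_mul ((hf2.integrable_mul hW'2).locallyIntegrable.locallyIntegrableOn _)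
  have i8 : Integrable fun z => (W z - f z) ^ 2 * ψ z := by
    refine ((i1.sub (i6.const_mul 2)).add i5).congr (Eventually.of_forall fun z => ?_)
    simp only [Pi.add_apply, Pi.sub_apply]
    ring
  have key : ∀ z, ψ z * (1 / 2 * f z ^ 2 - f z * W z) - η z * f z * W' z
      ≤ 1 / 2 * ((W z - f z) ^ 2 * ψ z) - 1 / 2 * (W z ^ 2 * ψ z)
        - 1 / 2 * (2 * W z * W' z * η z) + c * (W' z * η z) := by
    intro z
    -- The decisive sign: `W'` is a nonnegative multiple of `f - M`, so replacing `f` by `M` drops a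
    -- multiple of `(f - M)²`.
    have h1 : M z * W' z ≤ f z * W' z := by
      by_cases hS : M z + c ∈ S
      · simp only [hW', indicator_of_mem hS, one_mul]
        have : 0 ≤ h⁻¹ * (f z - M z) ^ 2 := by positivity
        nlinarith
      · simp [hW', indicator_of_notMem hS]
    -- Where `W'` can be nonzero the truncation is inactive and `M = W - c`. Only `W W'` and `W'`
    -- are left, both exact derivatives in time.
    have h2 : M z * W' z = W z * W' z - c * W' z := by
      by_cases hS : M z + c ∈ S
      · have : W z = M z + c := hT.eq_self _ hS
        rw [this]
        ring
      · simp [hW', indicator_of_notMem hS]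
    have h3 := mul_le_mul_of_nonneg_left h1 (hη0 z)
    rw [h2] at h3
    nlinarith
  have iR : Integrable fun z => 1 / 2 * ((W z - f z) ^ 2 * ψ z) - 1 / 2 * (W z ^ 2 * ψ z)
        - 1 / 2 * (2 * W z * W' z * η z) + c * (W' z * η z) :=
    (((i8.const_mul _).sub (i1.const_mul _)).sub (i2.const_mul _)).add (i4.const_mul c)
  have iL : Integrable fun z => ψ z * (1 / 2 * f z ^ 2 - f z * W z) - η z * f z * W' z := by
    refine (((i5.const_mul (1 / 2)).sub i6).sub i7).congr (Eventually.of_forall fun z => ?_)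
    simp only [Pi.sub_apply]
    ring
  refine (integral_mono iL iR key).trans (le_of_eq ?_)
  have j1 : Integrable fun z => 1 / 2 * ((W z - f z) ^ 2 * ψ z) - 1 / 2 * (W z ^ 2 * ψ z) :=
    (i8.const_mul _).sub (i1.const_mul _)
  have j2 : Integrable fun z => 1 / 2 * ((W z - f z) ^ 2 * ψ z) - 1 / 2 * (W z ^ 2 * ψ z)
      - 1 / 2 * (2 * W z * W' z * η z) := j1.sub (i2.const_mul _)
  rw [integral_add j2 (i4.const_mul c), integral_sub j1 (i2.const_mul _),
    integral_sub (i8.const_mul _) (i1.const_mul _)]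
  simp only [integral_const_mul]
  rw [e1, e2]
  ring

theorem HasWeakDeriv.comparison {k : ℝ} {G : ℝ → ℝ} {S : Set ℝ} (hT : IsTruncation N k G S)
    (hU : IsOpen U) {m m' v v' : SpaceTime N → ℝ} (hm : HasWeakDeriv U e m m')
    (hv : HasWeakDeriv U e v v') (hζ : ContDiff ℝ ∞ ζ) :
    HasWeakDeriv U e (fun z => v z + ζ z * (G (m z) - v z)) fun z =>
      v' z + (ζ z * (S.indicator (fun _ => (1 : ℝ)) (m z) * m' z - v' z)
        + fderiv ℝ ζ z e * (G (m z) - v z)) :=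
  hv.add (((hT.hasWeakDeriv hU hm).sub hv).mul_smooth hU hζ)

theorem IsTruncation.memLp_comparison {k : ℝ} {G : ℝ → ℝ} {S : Set ℝ}
    (hT : IsTruncation N k G S) {μ : Measure (SpaceTime N)} [IsFiniteMeasure μ] {q : ENNReal}
    {m v : SpaceTime N → ℝ} (hζ : IsTestFunction V ζ)
    (hm : MemLp m q μ) (hv : MemLp v q μ) :
    MemLp (fun z => v z + ζ z * (G (m z) - v z)) q μ := by
  obtain ⟨C, -, hC⟩ := hζ.bounded
  exact hv.add (memLp_bdd_mul ((memLp_lipschitz_comp hm hT.lipschitz).sub hv)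
    hζ.continuous.aestronglyMeasurable hC)

theorem IsTruncation.memLp_comparison_deriv {k : ℝ} {G : ℝ → ℝ} {S : Set ℝ}
    (hT : IsTruncation N k G S) {μ : Measure (SpaceTime N)} [IsFiniteMeasure μ] {q : ENNReal}
    {m m' v v' : SpaceTime N → ℝ} (hζ : IsTestFunction V ζ)
    (hm : MemLp m q μ) (hm' : MemLp m' q μ) (hv : MemLp v q μ) (hv' : MemLp v' q μ)
    (e : SpaceTime N) :
    MemLp (fun z => v' z + (ζ z * (S.indicator (fun _ => (1 : ℝ)) (m z) * m' z - v' z)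
        + fderiv ℝ ζ z e * (G (m z) - v z))) q μ := by
  obtain ⟨C, -, hC⟩ := hζ.bounded
  obtain ⟨C', -, hC'⟩ := (hζ.fderiv_apply e).bounded
  have h1 := memLp_bdd_mul hm' (hT.aestronglyMeasurable_indicator hm.1) fun z => hT.abs_le (m z)
  exact hv'.add ((memLp_bdd_mul (h1.sub hv') hζ.continuous.aestronglyMeasurable hC).add
    (memLp_bdd_mul ((memLp_lipschitz_comp hm hT.lipschitz).sub hv)
      (hζ.fderiv_apply e).continuous.aestronglyMeasurable hC'))

end AnisoObstacle

/-! ### Testing the variational inequality with truncations. -/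

namespace AnisoObstacle

variable {N : ℕ} {U V : Set (SpaceTime N)} {e : SpaceTime N} {f g f' g' η ζ : SpaceTime N → ℝ}

theorem eq_one_and_fderiv_eq_zero {K : Set (SpaceTime N)} (h : ∀ᶠ z in 𝓝ˢ K, ζ z = 1)
    {z : SpaceTime N} (hz : z ∈ K) : ζ z = 1 ∧ ∀ e, fderiv ℝ ζ z e = 0 := by
  have h1 : ζ =ᶠ[𝓝 z] fun _ => 1 := (eventually_nhdsSet_iff_forall.1 h) z hz
  refine ⟨h1.self_of_nhds, fun e => ?_⟩
  rw [h1.fderiv_eq]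
  simp

theorem fderiv_eq_zero_of_notMem_tsupport {z : SpaceTime N} (hz : z ∉ tsupport η)
    (e : SpaceTime N) : fderiv ℝ η z e = 0 :=
  image_eq_zero_of_notMem_tsupport (f := fun z => fderiv ℝ η z e)
    fun h => hz (tsupport_fderiv_apply_subset ℝ e h)

theorem tendsto_eLpNorm_truncation_mollify {k : ℝ} {G : ℝ → ℝ} {S : Set ℝ}
    (hT : IsTruncation N k G S) {μ : Measure (SpaceTime N)} [IsFiniteMeasure μ]
    (hμ : μ ≤ volume) {q : ENNReal} (hq1 : 1 ≤ q) (hq : q ≠ ⊤) (hf : Integrable f)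
    (hfq : MemLp f q) {h ε : ℕ → ℝ} (hh : Tendsto h atTop (𝓝 0)) (hε : Tendsto ε atTop (𝓝 0)) :
    Tendsto (fun n => eLpNorm (fun z => G (mollify (h n) f z + ε n) - G (f z)) q μ) atTop
      (𝓝 0) := by
  have h1 : Tendsto (fun n => -h n) atTop (𝓝 0) := by simpa using hh.neg
  have l1 := (tendsto_eLpNorm_avg_sub (ν := expLaw) hq1 hq hfq hf (dirT N)).comp h1
  have l2 : Tendsto (fun n => ENNReal.ofReal |ε n| * eLpNorm (fun _ : SpaceTime N => (1 : ℝ)) q μ)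
      atTop (𝓝 0) := by
    have h2 : Tendsto (fun n => ENNReal.ofReal |ε n|) atTop (𝓝 0) := by
      have := ENNReal.tendsto_ofReal hε.abs
      simpa using this
    have := ENNReal.Tendsto.mul_const (b := eLpNorm (fun _ : SpaceTime N => (1 : ℝ)) q μ) h2
      (Or.inr (memLp_const 1).2.ne)
    simpa using this
  have l3 := l1.add l2
  rw [add_zero] at l3
  refine tendsto_of_tendsto_of_tendsto_of_le_of_le tendsto_const_nhds l3 (fun _ => zero_le)
    fun n => ?_
  have hM : AEStronglyMeasurable (fun z => mollify (h n) f z - f z) μ :=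
    ((integrable_avg hf (dirT N) (-h n)).1.sub hf.1).mono_measure hμ
  calc eLpNorm (fun z => G (mollify (h n) f z + ε n) - G (f z)) q μ
      ≤ eLpNorm ((fun z => mollify (h n) f z - f z) + fun _ => ε n) q μ := by
        refine eLpNorm_mono fun z => (hT.lipschitz _ _).trans (le_of_eq ?_)
        rw [Pi.add_apply, Real.norm_eq_abs]
        congr 1
        ring
    _ ≤ eLpNorm (fun z => mollify (h n) f z - f z) q μ + eLpNorm (fun _ => ε n) q μ :=
        eLpNorm_add_le hM aestronglyMeasurable_const hq1
    _ ≤ _ := by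
        refine add_le_add (eLpNorm_mono_measure _ hμ) ?_
        refine eLpNorm_le_mul_eLpNorm_of_ae_le_mul (Eventually.of_forall fun z => ?_) q
        simp

/-- The admissible comparison function obtained by gluing a truncated mollification into a given
admissible function. -/
theorem memK'_comparison {Ω : Set (EuclideanSpace ℝ (Fin N))} {T : ℝ} {p : Fin N → ℝ}
    {φ v : SpaceTime N → ℝ} (hN : 0 < N) (hp : ∀ i, 2 ≤ p i) (hΩ : IsOpen Ω)
    (hΩb : Bornology.IsBounded Ω) (hv : MemK' Ω T p φ v) {k : ℝ} {G : ℝ → ℝ} {S : Set ℝ}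
    (hT : IsTruncation N k G S) (hf : Integrable f)
    (hfp : ∀ i, MemLp f (ENNReal.ofReal (p i))) {γ : Fin N → SpaceTime N → ℝ}
    (hγ : ∀ i, HasWeakDeriv univ (dirX i) f (γ i)) (hγi : ∀ i, Integrable (γ i))
    (hγp : ∀ i, MemLp (γ i) (ENNReal.ofReal (p i))) (hf2 : MemLp f 2) {h c : ℝ} (hh : 0 < h)
    (hζ : IsTestFunction (openCyl Ω T) ζ) (hζ01 : ∀ z, ζ z ∈ Icc (0 : ℝ) 1)
    (hobs : ∀ᵐ z, ζ z ≠ 0 → φ z ≤ G (mollify h f z + c)) :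
    MemK' Ω T p φ fun z => v z + ζ z * (G (mollify h f z + c) - v z) := by
  have hU := isOpen_openCyl hΩ T
  have := isFiniteMeasure_restrict_openCyl hΩb T
  have hp1 : ∀ i, (1 : ENNReal) ≤ ENNReal.ofReal (p i) := fun i => by
    rw [ENNReal.one_le_ofReal]
    linarith [hp i]
  have hΩv : volume Ω ≠ ⊤ := hΩb.measure_lt_top.ne
  have hM : ∀ {q : ENNReal}, 1 ≤ q → q ≠ ⊤ → MemLp f q →
      MemLp (fun z => mollify h f z + c) q (volume.restrict (openCyl Ω T)) := fun hq1 hq hfq =>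
    ((memLp_avg hq1 hq hfq _ _).restrict _).add (memLp_const c)
  have hv2 : MemLp v 2 (volume.restrict (openCyl Ω T)) :=
    (hv.memK.memLp ⟨0, hN⟩).mono_exponent (by
      have := ENNReal.ofReal_le_ofReal (hp ⟨0, hN⟩)
      simpa using this)
  refine ⟨⟨?_, fun i => ?_, fun i => ?_, ?_⟩, ?_⟩
  · have h1 : ContinuousInL2 Ω T fun z => G (mollify h f z + c) :=
      (continuousInL2_mollify hh hf2 Ω T).comp_lipschitz hΩv (G := fun y => G (y + c))
        fun a b => by simpa using hT.lipschitz (a + c) (b + c)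
    exact hv.memK.continuous_L2.add
      ((h1.sub hv.memK.continuous_L2).continuous_mul hΩb hΩ.measurableSet hζ.continuous)
  · exact hT.memLp_comparison hζ (hM (hp1 i) ENNReal.ofReal_ne_top (hfp i)) (hv.memK.memLp i)
  · have hv' := hasWeakDeriv_weakDeriv (hv.memK.weakDeriv_memLp i).1
    have hm : HasWeakDeriv (openCyl Ω T) (dirX i) (fun z => mollify h f z + c)
        fun z => mollify h (γ i) z + 0 :=
      (((hγ i).avg hf (hγi i) (dirT N) (-h)).mono (subset_univ _)).add (hasWeakDeriv_const c)
    refine (hm.comparison hT hU hv' hζ.smooth).weakDerivMemLp hU ?_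
    refine hT.memLp_comparison_deriv hζ (hM (hp1 i) ENNReal.ofReal_ne_top (hfp i)) ?_
      (hv.memK.memLp i) (hv.memK.weakDeriv_memLp i).2 _
    simp only [add_zero]
    exact (memLp_avg (hp1 i) ENNReal.ofReal_ne_top (hγp i) (dirT N) (-h)).restrict _
  · filter_upwards [hv.memK.obstacle_le, ae_restrict_of_ae hobs] with z h1 h2
    obtain ⟨h3, h4⟩ := hζ01 z
    -- Where `ζ` is nonzero the value is a convex combination of two numbers above `φ z`; elsewhere
    -- it is `v z`.
    rcases eq_or_ne (ζ z) 0 with h0 | h0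
    · simpa [h0] using h1
    · have h5 := mul_nonneg h3 (sub_nonneg.2 (h2 h0))
      have h6 := mul_nonneg (sub_nonneg.2 h4) (sub_nonneg.2 h1)
      linarith
  · have hv' := hasWeakDeriv_weakDeriv hv.timeDeriv_memLp.1
    have hm : HasWeakDeriv (openCyl Ω T) (dirT N) (fun z => mollify h f z + c)
        fun z => h⁻¹ * (f z - mollify h f z) + 0 :=
      ((hasWeakDeriv_mollify_dirT hf hh.ne').mono (subset_univ _)).add (hasWeakDeriv_const c)
    refine (hm.comparison hT hU hv' hζ.smooth).weakDerivMemLp hU ?_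
    have e2 : ENNReal.ofReal 2 = 2 := by simp
    have hv2' := hv.timeDeriv_memLp.2
    rw [e2] at hv2' ⊢
    refine hT.memLp_comparison_deriv hζ (hM (by norm_num) (by simp) hf2) ?_ hv2 hv2' _
    simp only [add_zero]
    exact ((hf2.sub (memLp_avg (by norm_num) (by simp) hf2 (dirT N) (-h))).const_mul
      h⁻¹).restrict _

/-- Testing the variational inequality with truncations of `u` (in the limit of mollified
comparison functions). -/
theorem IsLocalWeakSolution.truncation_inequality {Ω : Set (EuclideanSpace ℝ (Fin N))} {T : ℝ}
    {p : Fin N → ℝ} {φ u : SpaceTime N → ℝ} (hN : 0 < N) (hp : ∀ i, 2 ≤ p i) (hΩ : IsOpen Ω)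
    (hΩb : Bornology.IsBounded Ω) (hφ : ContinuousOn φ (cyl Ω T)) (hK : ∃ v, MemK' Ω T p φ v)
    (hu : IsLocalWeakSolution Ω T p φ u) {D : Set (SpaceTime N)} (hD : IsOpen D)
    (hDU : D ⊆ openCyl Ω T) {k : ℝ} {G : ℝ → ℝ} {S : Set ℝ} (hT : IsTruncation N k G S)
    (hG : ∀ z ∈ D, ∀ y, φ z ≤ y → φ z ≤ G y) (hη : IsTestFunction D η) (hη0 : ∀ z, 0 ≤ η z) :
    0 ≤ 1 / 2 * (∫ z in openCyl Ω T, (G (u z) - u z) ^ 2 * fderiv ℝ η z (dirT N))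
      + ∑ i, ∫ z in openCyl Ω T,
        (η z * (S.indicator (fun _ => (1 : ℝ)) (u z) * weakDeriv (openCyl Ω T) (dirX i) u z
            - weakDeriv (openCyl Ω T) (dirX i) u z)
          + fderiv ℝ η z (dirX i) * (G (u z) - u z))
        * (|weakDeriv (openCyl Ω T) (dirX i) u z| ^ (p i - 2)
          * weakDeriv (openCyl Ω T) (dirX i) u z) := by
  obtain ⟨v₀, hv₀⟩ := hK
  have hU := isOpen_openCyl hΩ T
  have := isFiniteMeasure_restrict_openCyl hΩb T
  set U := openCyl Ω T with hUdef
  set g : Fin N → SpaceTime N → ℝ := fun i => weakDeriv U (dirX i) u with hgdef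
  have hg : ∀ i, HasWeakDeriv U (dirX i) u (g i) := fun i =>
    hasWeakDeriv_weakDeriv (hu.memK.weakDeriv_memLp i).1
  have hgp : ∀ i, MemLp (g i) (ENNReal.ofReal (p i)) (volume.restrict U) := fun i =>
    (hu.memK.weakDeriv_memLp i).2
  have hup := hu.memK.memLp
  have hp1 : ∀ i, (1 : ENNReal) ≤ ENNReal.ofReal (p i) := fun i => by
    rw [ENNReal.one_le_ofReal]
    linarith [hp i]
  have hu2 : MemLp u 2 (volume.restrict U) := (hup ⟨0, hN⟩).mono_exponent (by
      have := ENNReal.ofReal_le_ofReal (hp ⟨0, hN⟩)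
      simpa using this)
  -- Nested cutoffs: `ζ = 1` near the support of `η`, and `ζ' = 1` near the support of `ζ`. The
  -- outer one extends `u` to the whole space as `f`, the inner one glues into `v₀`; so `f = u`
  -- wherever gluing happens and `v n = W n` wherever `η` acts.
  obtain ⟨ζ, hζD, hζ1, hζ01⟩ :=
    exists_testFunction_one_nhds hη.compact_support hD hη.support_subset
  obtain ⟨ζ', hζ'D, hζ'1, hζ'01⟩ :=
    exists_testFunction_one_nhds hζD.compact_support hD hζD.support_subset
  have hζ := hζD.mono hDU
  have hζ' := hζ'D.mono hDU
  have hηU := hη.mono hDU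
  have hηu := hη.mono (subset_univ D)
  set f : SpaceTime N → ℝ := fun z => ζ' z * u z with hfdef
  set γ : Fin N → SpaceTime N → ℝ :=
    fun i z => ζ' z * g i z + fderiv ℝ ζ' z (dirX i) * u z with hγdef
  have hγ : ∀ i, HasWeakDeriv univ (dirX i) f (γ i) := fun i => (hg i).mul_testFunction hζ'
  have hfi : Integrable f := hζ'.integrable_of_memLp hU (by norm_num) hu2
  have hf2 : MemLp f 2 := hζ'.memLp_mul hU hu2
  have hfp : ∀ i, MemLp f (ENNReal.ofReal (p i)) := fun i => hζ'.memLp_mul hU (hup i)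
  have hγp : ∀ i, MemLp (γ i) (ENNReal.ofReal (p i)) := fun i =>
    (hζ'.memLp_mul hU (hgp i)).add ((hζ'.fderiv_apply _).memLp_mul hU (hup i))
  have hγi : ∀ i, Integrable (γ i) := fun i =>
    (hζ'.integrable_of_memLp hU (hp1 i) (hgp i)).add
      ((hζ'.fderiv_apply _).integrable_of_memLp hU (hp1 i) (hup i))
  -- localization
  have hsub : tsupport η ⊆ tsupport ζ := fun z hz => subset_tsupport _ (by
    rw [Function.mem_support, (eq_one_and_fderiv_eq_zero hζ1 hz).1]
    exact one_ne_zero)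
  have hfu : ∀ z ∈ tsupport ζ, f z = u z := fun z hz => by
    simp [hfdef, (eq_one_and_fderiv_eq_zero hζ'1 hz).1]
  have hγg : ∀ i, ∀ z ∈ tsupport ζ, γ i z = g i z := fun i z hz => by
    obtain ⟨h1, h2⟩ := eq_one_and_fderiv_eq_zero hζ'1 hz
    simp [hγdef, h1, h2]
  -- the mollifying sequence
  have hψc : Continuous fun z => ζ' z * φ z :=
    hζ'.continuous_mul hU (hφ.mono (openCyl_subset_cyl Ω T))
  have hψf : (fun z => ζ' z * φ z) ≤ᵐ[volume] f := by
    have h1 : ∀ᵐ z ∂(volume.restrict U), φ z ≤ u z :=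
      ae_restrict_of_ae_restrict_of_subset (openCyl_subset_cyl Ω T) hu.memK.obstacle_le
    rw [ae_restrict_iff' hU.measurableSet] at h1
    filter_upwards [h1] with z hz
    by_cases hzU : z ∈ U
    · exact mul_le_mul_of_nonneg_left (hz hzU) (hζ'01 z).1
    · simp [hfdef, hζ'.eq_zero_of_notMem hzU]
  obtain ⟨h, ε, hh0, hh, hε0, hε, hobs, hae⟩ := exists_mollifying_sequence hfi hψc
    (hζ'.compact_support.mul_right) hψf
  set W : ℕ → SpaceTime N → ℝ := fun n z => G (mollify (h n) f z + ε n) with hWdef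
  set v : ℕ → SpaceTime N → ℝ := fun n z => v₀ z + ζ z * (W n z - v₀ z) with hvdef
  have hvK : ∀ n, MemK' Ω T p φ (v n) := fun n => by
    refine memK'_comparison hN hp hΩ hΩb hv₀ hT hfi hfp hγ hγi hγp hf2 (hh0 n) hζ hζ01 ?_
    -- On the support of `ζ` the function `ζ' φ` is `φ`, so the lifted mollification lies above the
    -- obstacle, and `hG` carries this through the truncation.
    filter_upwards [hobs n] with z hz hζz
    have hzζ : z ∈ tsupport ζ := subset_tsupport _ hζz
    rw [(eq_one_and_fderiv_eq_zero hζ'1 hzζ).1, one_mul] at hz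
    exact hG z (hζD.support_subset hzζ) _ hz
  have hineq : ∀ n, 0 ≤ timePairing Ω T u (v n) η + ∑ i, diffusionTerm Ω T p u (v n) η i :=
    fun n => hu.variational_ineq (v n) (hvK n) η hηU hη0
  have hvW : ∀ n, ∀ z ∈ tsupport η, v n z = W n z := fun n z hz => by
    simp [hvdef, (eq_one_and_fderiv_eq_zero hζ1 hz).1]
  set ψ : SpaceTime N → ℝ := fun z => fderiv ℝ η z (dirT N) with hψdef
  have hψ : IsTestFunction U ψ := hηU.fderiv_apply _
  have hψ0 : ∀ z ∉ tsupport η, ∀ e, fderiv ℝ η z e = 0 := fun z hz e =>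
    fderiv_eq_zero_of_notMem_tsupport hz e
  have hη00 : ∀ z ∉ tsupport η, η z = 0 := fun z hz => image_eq_zero_of_notMem_tsupport hz
  -- the time term
  have htime : ∀ n, timePairing Ω T u (v n) η
      ≤ 1 / 2 * (∫ z in U, (W n z - f z) ^ 2 * ψ z) - ε n * ∫ z in U, W n z * ψ z := by
    intro n
    rw [hψ.setIntegral_eq, hψ.setIntegral_eq]
    refine le_trans (le_of_eq ?_) (integral_time_mollify_le hT hfi hf2 (hh0 n) (ε n) hηu hη0)
    have hv' := hasWeakDeriv_weakDeriv hv₀.timeDeriv_memLp.1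
    have hm : HasWeakDeriv U (dirT N) (fun z => mollify (h n) f z + ε n)
        fun z => (h n)⁻¹ * (f z - mollify (h n) f z) + 0 :=
      ((hasWeakDeriv_mollify_dirT hfi (hh0 n).ne').mono (subset_univ _)).add
        (hasWeakDeriv_const (ε n))
    have hwd := (hm.comparison hT hU hv' hζ.smooth).weakDeriv_ae_eq hU
    refine Eq.trans ?_ (setIntegral_eq_integral_of_forall_compl_eq_zero (s := U) ?_)
    · refine integral_congr_ae ?_
      filter_upwards [hwd] with z hz
      by_cases hzη : z ∈ tsupport η
      · obtain ⟨h1, h2⟩ := eq_one_and_fderiv_eq_zero hζ1 hzη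
        have h3 : weakDeriv U (dirT N) (v n) z
            = S.indicator (fun _ => (1 : ℝ)) (mollify (h n) f z + ε n)
              * ((h n)⁻¹ * (f z - mollify (h n) f z)) := by
          refine hz.trans ?_
          rw [h1, h2]
          ring
        rw [h3, hvW n z hzη, hfu z (hsub hzη)]
      · simp [hψ0 z hzη, hη00 z hzη]
    · intro z hz
      have hzη : z ∉ tsupport η := fun h' => hz (hηU.support_subset h')
      simp [hψ0 z hzη, hη00 z hzη]
  -- the diffusion terms
  set a : Fin N → SpaceTime N → ℝ := fun i z => |g i z| ^ (p i - 2) * g i z with hadef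
  set χ : ℕ → SpaceTime N → ℝ :=
    fun n z => S.indicator (fun _ => (1 : ℝ)) (mollify (h n) f z + ε n) with hχdef
  have hdiff : ∀ n i, diffusionTerm Ω T p u (v n) η i
      = ∫ z in U, (η z * (χ n z * mollify (h n) (γ i) z - g i z)
        + fderiv ℝ η z (dirX i) * (W n z - u z)) * a i z := by
    intro n i
    have hm : HasWeakDeriv U (dirX i) (fun z => mollify (h n) f z + ε n)
        fun z => mollify (h n) (γ i) z + 0 :=
      (((hγ i).avg hfi (hγi i) (dirT N) (-h n)).mono (subset_univ _)).add (hasWeakDeriv_const _)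
    have hd := ((hT.hasWeakDeriv hU hm).sub (hg i)).mul_smooth hU hη.smooth
    have hfun : (fun y => η y * (v n y - u y)) = fun y => η y * (W n y - u y) := by
      ext y
      by_cases hy : y ∈ tsupport η
      · rw [hvW n y hy]
      · simp [hη00 y hy]
    rw [diffusionTerm, hfun]
    refine integral_congr_ae ?_
    filter_upwards [hd.weakDeriv_ae_eq hU] with z hz
    refine (congrArg (fun y => |g i z| ^ (p i - 2) * g i z * y) hz).trans ?_
    simp only [add_zero]
    ring
  have hple : (volume.restrict U : Measure (SpaceTime N)) ≤ volume := Measure.restrict_le_self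
  -- passage to the limit
  have hWp : ∀ {q : ENNReal}, 1 ≤ q → q ≠ ⊤ → MemLp f q → ∀ n, MemLp (W n) q (volume.restrict U) :=
    fun hq1 hq hfq n => memLp_lipschitz_comp
      (((memLp_avg hq1 hq hfq _ _).restrict _).add (memLp_const (ε n))) hT.lipschitz
  have hGf : ∀ {q : ENNReal}, MemLp f q → MemLp (fun z => G (f z)) q (volume.restrict U) :=
    fun hfq => memLp_lipschitz_comp (hfq.restrict U) hT.lipschitz
  have hWlim2 := tendsto_eLpNorm_truncation_mollify hT hple (q := 2) (by norm_num) (by simp)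
    hfi hf2 hh hε
  have l1 : Tendsto (fun n => ∫ z in U, (W n z - f z) ^ 2 * ψ z) atTop
      (𝓝 (∫ z in U, (G (f z) - f z) ^ 2 * ψ z)) := by
    refine tendsto_integral_sq_mul
      (fun n => (hWp (by norm_num) (by simp) hf2 n).sub (hf2.restrict U))
      ((hGf hf2).sub (hf2.restrict U)) (hψ.memLp _ _) ?_
    simpa only [sub_sub_sub_cancel_right] using hWlim2
  have l2 : Tendsto (fun n => ∫ z in U, W n z * ψ z) atTop (𝓝 (∫ z in U, G (f z) * ψ z)) :=
    tendsto_integral_mul_of_eLpNorm_sub (p := 2) (q := 2)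
      (fun n => hWp (by norm_num) (by simp) hf2 n) (hGf hf2) (hψ.memLp _ _) hWlim2
  have l3 : ∀ i, Tendsto (fun n => ∫ z in U, (η z * (χ n z * mollify (h n) (γ i) z - g i z)
        + fderiv ℝ η z (dirX i) * (W n z - u z)) * a i z) atTop
      (𝓝 (∫ z in U, (η z * (S.indicator (fun _ => (1 : ℝ)) (f z) * γ i z - g i z)
        + fderiv ℝ η z (dirX i) * (G (f z) - u z)) * a i z)) := by
    intro i
    have hHolder := holderTriple_ofReal (hp i)
    have hptop : ENNReal.ofReal (p i) ≠ ⊤ := ENNReal.ofReal_ne_top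
    have ha : MemLp (a i) (ENNReal.ofReal (p i / (p i - 1))) (volume.restrict U) :=
      memLp_flux (hp i) (hgp i)
    obtain ⟨C, -, hC⟩ := hη.bounded
    obtain ⟨C', -, hC'⟩ := (hη.fderiv_apply (dirX i)).bounded
    have haη := memLp_bdd_mul ha hη.continuous.aestronglyMeasurable hC
    have haψ := memLp_bdd_mul ha (hη.fderiv_apply (dirX i)).continuous.aestronglyMeasurable hC'
    have hχm : ∀ n, AEStronglyMeasurable (χ n) (volume.restrict U) := fun n =>
      hT.aestronglyMeasurable_indicator ((integrable_avg hfi _ _).1.restrict.add_const (ε n))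
    have hMγ : ∀ n, MemLp (mollify (h n) (γ i)) (ENNReal.ofReal (p i)) (volume.restrict U) :=
      fun n => (memLp_avg (hp1 i) hptop (hγp i) _ _).restrict _
    have hMγlim : Tendsto (fun n => eLpNorm (fun z => mollify (h n) (γ i) z - γ i z)
        (ENNReal.ofReal (p i)) (volume.restrict U)) atTop (𝓝 0) := by
      have h1 : Tendsto (fun n => -h n) atTop (𝓝 0) := by simpa using hh.neg
      have h2 := (tendsto_eLpNorm_avg_sub (ν := expLaw) (hp1 i) hptop (hγp i) (hγi i)
        (dirT N)).comp h1
      exact tendsto_of_tendsto_of_tendsto_of_le_of_le tendsto_const_nhds h2 (fun _ => zero_le)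
        fun n => eLpNorm_mono_measure _ hple
    have hχlim : ∀ᵐ z ∂(volume.restrict U), Tendsto (fun n => χ n z * γ i z) atTop
        (𝓝 (S.indicator (fun _ => (1 : ℝ)) (f z) * γ i z)) := by
      -- On `{f = k}` the indicators may oscillate, but the weak derivative `γ i` vanishes there
      -- a.e.; off this set they are eventually constant.
      filter_upwards [ae_restrict_of_ae hae,
        ((hγ i).mono (subset_univ U)).ae_eq_zero_of_eq hU k] with z h1 h2
      by_cases hk : f z = k
      · simp [h2 hk]
      · refine (hT.tendsto_indicator hk ?_).mul_const _
        simpa using h1.add hε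
    have t1 := tendsto_integral_mul_indicator hMγ ((hγp i).restrict U) haη hMγlim hχm
      (fun n z => hT.abs_le _) hχlim
    have hWlim := tendsto_eLpNorm_truncation_mollify hT hple (hp1 i) hptop hfi (hfp i) hh hε
    have t3 := tendsto_integral_mul_of_eLpNorm_sub (l := atTop)
      (F := fun n z => W n z - u z) (F₀ := fun z => G (f z) - u z)
      (fun n => (hWp (hp1 i) hptop (hfp i) n).sub (hup i))
      ((hGf (hfp i)).sub (hup i)) haψ (by simpa only [sub_sub_sub_cancel_right] using hWlim)
    have hm : ∀ {F b : SpaceTime N → ℝ}, MemLp F (ENNReal.ofReal (p i)) (volume.restrict U) →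
        MemLp b (ENNReal.ofReal (p i / (p i - 1))) (volume.restrict U) →
        Integrable (fun z => F z * b z) (volume.restrict U) := fun hF hb =>
      memLp_one_iff_integrable.1 (hb.mul hF)
    have hsplit : ∀ {X Y : SpaceTime N → ℝ},
        MemLp X (ENNReal.ofReal (p i)) (volume.restrict U) →
        MemLp Y (ENNReal.ofReal (p i)) (volume.restrict U) →
        ∫ z in U, (η z * (X z - g i z) + fderiv ℝ η z (dirX i) * Y z) * a i z
          = (∫ z in U, X z * (η z * a i z)) - (∫ z in U, g i z * (η z * a i z))
            + ∫ z in U, Y z * (fderiv ℝ η z (dirX i) * a i z) := by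
      intro X Y hX hY
      have j : Integrable (fun z => X z * (η z * a i z) - g i z * (η z * a i z))
          (volume.restrict U) := (hm hX haη).sub (hm (hgp i) haη)
      rw [← integral_sub (hm hX haη) (hm (hgp i) haη), ← integral_add j (hm hY haψ)]
      exact integral_congr_ae (Eventually.of_forall fun z => by ring)
    have hχγ : ∀ n, MemLp (fun z => χ n z * mollify (h n) (γ i) z) (ENNReal.ofReal (p i))
        (volume.restrict U) := fun n => memLp_bdd_mul (hMγ n) (hχm n) fun z => hT.abs_le _
    have hχγ0 : MemLp (fun z => S.indicator (fun _ => (1 : ℝ)) (f z) * γ i z)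
        (ENNReal.ofReal (p i)) (volume.restrict U) :=
      memLp_bdd_mul ((hγp i).restrict U) (hT.aestronglyMeasurable_indicator hfi.1.restrict)
        fun z => hT.abs_le _
    rw [hsplit (Y := fun z => G (f z) - u z) hχγ0 ((hGf (hfp i)).sub (hup i))]
    refine ((t1.sub_const _).add t3).congr fun n => ?_
    exact (hsplit (X := fun z => χ n z * mollify (h n) (γ i) z) (Y := fun z => W n z - u z)
      (hχγ n) ((hWp (hp1 i) hptop (hfp i) n).sub (hup i))).symm
  -- The lifting constants `ε n` multiply a convergent integral, so their contribution disappears.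
  have l4 := ((l1.const_mul (1 / 2)).sub (hε.mul l2)).add
    (tendsto_finsetSum Finset.univ fun i _ => l3 i)
  have hlim := ge_of_tendsto' l4 fun n => by
    refine (hineq n).trans ?_
    simp only [hdiff]
    exact add_le_add (htime n) le_rfl
  rw [zero_mul, sub_zero] at hlim
  refine hlim.trans (le_of_eq ?_)
  congr 1
  · congr 1
    refine integral_congr_ae (Eventually.of_forall fun z => ?_)
    by_cases hz : z ∈ tsupport η
    · simp only [hfu z (hsub hz), hψdef]
    · simp [hψdef, hψ0 z hz]
  · refine Finset.sum_congr rfl fun i _ => integral_congr_ae (Eventually.of_forall fun z => ?_)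
    by_cases hz : z ∈ tsupport η
    · simp only [hfu z (hsub hz), hγg i z (hsub hz)]
      rfl
    · simp [hψ0 z hz, hη00 z hz]

end AnisoObstacle

/-! ### Truncations of a solution as energy subsolutions. -/

namespace AnisoObstacle

variable {N : ℕ} {U V : Set (SpaceTime N)} {e : SpaceTime N} {f g f' g' η ζ : SpaceTime N → ℝ}

theorem abs_flux {p : ℝ} (hp : 2 ≤ p) (y : ℝ) : |(|y| ^ (p - 2) * y)| = |y| ^ (p - 1) := by
  rw [abs_mul, abs_of_nonneg (Real.rpow_nonneg (abs_nonneg y) _)]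
  rcases eq_or_ne y 0 with h | h
  · rw [h, abs_zero, mul_zero, Real.zero_rpow (by linarith)]
  · rw [← Real.rpow_add_one (abs_pos.2 h).ne']
    congr 1
    ring

theorem flux_mul_self {p : ℝ} (hp : 2 ≤ p) (y : ℝ) : |y| ^ (p - 2) * y * y = |y| ^ p := by
  rcases eq_or_ne y 0 with h | h
  · rw [h, abs_zero, mul_zero, Real.zero_rpow (by linarith)]
  · rw [mul_assoc, ← abs_mul_abs_self y, ← mul_assoc, ← Real.rpow_add_one (abs_pos.2 h).ne',
      ← Real.rpow_add_one (abs_pos.2 h).ne']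
    congr 1
    ring

/-- A nonnegative function in the energy class on `Ω × (0,T)` which satisfies, on the open set `D`,
the inequality obtained by testing the anisotropic equation with the function itself. -/
structure IsEnergySubsolution (Ω : Set (EuclideanSpace ℝ (Fin N))) (T : ℝ) (p : Fin N → ℝ)
    (D : Set (SpaceTime N)) (w : SpaceTime N → ℝ) : Prop where
  nonneg : ∀ z, 0 ≤ w z
  continuous_L2 : ContinuousInL2 Ω T w
  memLp : ∀ i, MemLp w (ENNReal.ofReal (p i)) (volume.restrict (openCyl Ω T))
  weakDeriv_memLp : ∀ i, WeakDerivMemLp (openCyl Ω T) (dirX i) (p i) w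
  tested_ineq : ∀ η : SpaceTime N → ℝ, IsTestFunction D η → (∀ z, 0 ≤ η z) →
    0 ≤ 1 / 2 * (∫ z in D, w z ^ 2 * fderiv ℝ η z (dirT N))
      + ∑ i, ∫ z in D, (|weakDeriv (openCyl Ω T) (dirX i) w z| ^ (p i - 1)
          * (|fderiv ℝ η z (dirX i)| * w z)
        - η z * |weakDeriv (openCyl Ω T) (dirX i) w z| ^ (p i))

theorem integrable_rpow_sub_one_mul {X : Type*} [MeasurableSpace X] {m : Measure X} {p : ℝ}
    (hp : 2 ≤ p) {F b : X → ℝ} (hF : MemLp F (ENNReal.ofReal p) m)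
    (hb : MemLp b (ENNReal.ofReal p) m) : Integrable (fun x => |F x| ^ (p - 1) * b x) m := by
  have := holderTriple_ofReal hp
  have h1 : MemLp (fun x => |F x| ^ (p - 1)) (ENNReal.ofReal (p / (p - 1))) m := by
    refine (memLp_flux hp hF).norm.congr_norm ?_ ?_
    · exact (hF.1.aemeasurable.abs.pow_const _).aestronglyMeasurable
    · exact Eventually.of_forall fun x => by
        rw [norm_norm, Real.norm_eq_abs, Real.norm_eq_abs, abs_flux hp,
          abs_of_nonneg (Real.rpow_nonneg (abs_nonneg (F x)) _)]
  have h2 := memLp_one_iff_integrable.1 (h1.mul hb)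
  exact h2.congr (Eventually.of_forall fun x => mul_comm _ _)

theorem integrable_abs_rpow {X : Type*} [MeasurableSpace X] {m : Measure X} {p : ℝ}
    (hp : 2 ≤ p) {F : X → ℝ} (hF : MemLp F (ENNReal.ofReal p) m) :
    Integrable (fun x => |F x| ^ p) m := by
  have := hF.integrable_norm_rpow (by simpa using by linarith) ENNReal.ofReal_ne_top
  rwa [ENNReal.toReal_ofReal (by linarith)] at this

/-- The gradient of `w` vanishes where `u ∈ S` and has the size of that of `u` elsewhere, so the
tested inequality can be written in terms of `w` alone. The sign `c` treats both truncations at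
once; from here on the obstacle plays no role. -/
theorem IsLocalWeakSolution.isEnergySubsolution {Ω : Set (EuclideanSpace ℝ (Fin N))} {T : ℝ}
    {p : Fin N → ℝ} {φ u w : SpaceTime N → ℝ} (hN : 0 < N) (hp : ∀ i, 2 ≤ p i) (hΩ : IsOpen Ω)
    (hΩb : Bornology.IsBounded Ω) (hφ : ContinuousOn φ (cyl Ω T)) (hK : ∃ v, MemK' Ω T p φ v)
    (hu : IsLocalWeakSolution Ω T p φ u) {D : Set (SpaceTime N)} (hD : IsOpen D)
    (hDU : D ⊆ openCyl Ω T) {k : ℝ} {G : ℝ → ℝ} {S : Set ℝ} (hT : IsTruncation N k G S)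
    (hG : ∀ z ∈ D, ∀ y, φ z ≤ y → φ z ≤ G y) {c : ℝ} (hc : |c| = 1)
    (hw : ∀ z, w z = c * (G (u z) - u z)) (hw0 : ∀ z, 0 ≤ w z) :
    IsEnergySubsolution Ω T p D w := by
  have hU := isOpen_openCyl hΩ T
  have := isFiniteMeasure_restrict_openCyl hΩb T
  have hwe : w = fun z => c * (G (u z) - u z) := funext hw
  have hg : ∀ i, HasWeakDeriv (openCyl Ω T) (dirX i) u (weakDeriv (openCyl Ω T) (dirX i) u) :=
    fun i => hasWeakDeriv_weakDeriv (hu.memK.weakDeriv_memLp i).1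
  have hgp := fun i => (hu.memK.weakDeriv_memLp i).2
  have hwd : ∀ i, HasWeakDeriv (openCyl Ω T) (dirX i) w fun z =>
      c * (S.indicator (fun _ => (1 : ℝ)) (u z) * weakDeriv (openCyl Ω T) (dirX i) u z
        - weakDeriv (openCyl Ω T) (dirX i) u z) := fun i => by
    rw [hwe]
    exact ((hT.hasWeakDeriv hU (hg i)).sub (hg i)).const_mul c
  have hwp : ∀ i, MemLp w (ENNReal.ofReal (p i)) (volume.restrict (openCyl Ω T)) := fun i => by
    rw [hwe]
    exact ((memLp_lipschitz_comp (hu.memK.memLp i) hT.lipschitz).sub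
      (hu.memK.memLp i)).const_mul c
  have hwdp : ∀ i, WeakDerivMemLp (openCyl Ω T) (dirX i) (p i) w := fun i => by
    refine (hwd i).weakDerivMemLp hU ?_
    exact ((memLp_bdd_mul (hgp i) (hT.aestronglyMeasurable_indicator (hu.memK.memLp i).1)
      fun z => hT.abs_le _).sub (hgp i)).const_mul c
  refine ⟨hw0, ?_, hwp, hwdp, fun η hη hη0 => ?_⟩
  · have hΩv : volume Ω ≠ ⊤ := hΩb.measure_lt_top.ne
    have h1 := (hu.memK.continuous_L2.comp_lipschitz hΩv hT.lipschitz).sub hu.memK.continuous_L2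
    rw [hwe]
    exact h1.comp_lipschitz hΩv (G := fun y => c * y) fun a b => by
      rw [← mul_sub, abs_mul, hc, one_mul]
  · have key := hu.truncation_inequality hN hp hΩ hΩb hφ hK hD hDU hT hG hη hη0
    have hη00 : ∀ z ∉ D, η z = 0 := fun z hz => hη.eq_zero_of_notMem hz
    have hη1 : ∀ z ∉ D, ∀ e, fderiv ℝ η z e = 0 := fun z hz e =>
      fderiv_eq_zero_of_notMem_tsupport (fun h => hz (hη.support_subset h)) e
    have hw2 : ∀ z, (G (u z) - u z) ^ 2 = w z ^ 2 := fun z => by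
      rw [hw, mul_pow, ← sq_abs c, hc, one_pow, one_mul]
    have e1 : ∫ z in D, w z ^ 2 * fderiv ℝ η z (dirT N)
        = ∫ z in openCyl Ω T, w z ^ 2 * fderiv ℝ η z (dirT N) :=
      (setIntegral_eq_of_subset_of_forall_sdiff_eq_zero hU.measurableSet hDU fun z hz => by
        rw [hη1 z hz.2, mul_zero]).symm
    refine key.trans (add_le_add (le_of_eq ?_) (Finset.sum_le_sum fun i _ => ?_))
    · rw [e1]
      simp only [hw2]
    have e2 : ∫ z in D, (|weakDeriv (openCyl Ω T) (dirX i) w z| ^ (p i - 1)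
          * (|fderiv ℝ η z (dirX i)| * w z)
        - η z * |weakDeriv (openCyl Ω T) (dirX i) w z| ^ (p i))
        = ∫ z in openCyl Ω T, (|weakDeriv (openCyl Ω T) (dirX i) w z| ^ (p i - 1)
          * (|fderiv ℝ η z (dirX i)| * w z)
        - η z * |weakDeriv (openCyl Ω T) (dirX i) w z| ^ (p i)) :=
      (setIntegral_eq_of_subset_of_forall_sdiff_eq_zero hU.measurableSet hDU fun z hz => by
        rw [hη1 z hz.2, hη00 z hz.2, abs_zero, zero_mul, mul_zero, zero_mul, sub_zero]).symm
    rw [e2]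
    obtain ⟨C, -, hC⟩ := hη.bounded
    obtain ⟨C', -, hC'⟩ := (hη.fderiv_apply (dirX i)).bounded
    have hHolder := holderTriple_ofReal (hp i)
    have i1 : MemLp (fun z => η z * (S.indicator (fun _ => (1 : ℝ)) (u z)
          * weakDeriv (openCyl Ω T) (dirX i) u z - weakDeriv (openCyl Ω T) (dirX i) u z)
          + fderiv ℝ η z (dirX i) * (G (u z) - u z)) (ENNReal.ofReal (p i))
        (volume.restrict (openCyl Ω T)) :=
      (memLp_bdd_mul ((memLp_bdd_mul (hgp i)
        (hT.aestronglyMeasurable_indicator (hu.memK.memLp i).1) fun z => hT.abs_le _).sub (hgp i))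
        hη.continuous.aestronglyMeasurable hC).add
      (memLp_bdd_mul ((memLp_lipschitz_comp (hu.memK.memLp i) hT.lipschitz).sub (hu.memK.memLp i))
        (hη.fderiv_apply (dirX i)).continuous.aestronglyMeasurable hC')
    have i2 := memLp_one_iff_integrable.1 ((memLp_flux (hp i) (hgp i)).mul i1)
    have i3 := integrable_rpow_sub_one_mul (hp i) (hwdp i).2 (memLp_bdd_mul (hwp i)
      (hη.fderiv_apply (dirX i)).continuous.abs.aestronglyMeasurable
      fun z => (abs_abs _).le.trans (hC' z))
    have i4 := (integrable_abs_rpow (hp i) (hwdp i).2).bdd_mul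
      hη.continuous.aestronglyMeasurable (Eventually.of_forall hC)
    refine integral_mono_ae i2 (i3.sub i4) ?_
    filter_upwards [(hwd i).weakDeriv_ae_eq hU] with z hz
    rw [hz]
    -- On `S` both integrands are zero. Off `S` the term with `η` is exactly `-η |∂_i u|^{p_i}`, and
    -- only the one with `∂_i η` has to be estimated.
    by_cases hS : u z ∈ S
    · have hGz := hT.eq_self _ hS
      have hp1 : (0 : ℝ) ^ (p i - 1) = 0 := Real.zero_rpow (by linarith [hp i])
      have hp2 : (0 : ℝ) ^ (p i) = 0 := Real.zero_rpow (by linarith [hp i])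
      simp [hS, hGz, hp1, hp2]
    · rw [indicator_of_notMem hS, zero_mul, zero_sub, abs_mul c, hc, one_mul, abs_neg]
      set y := weakDeriv (openCyl Ω T) (dirX i) u z
      have habs : |G (u z) - u z| = w z := by
        rw [← abs_of_nonneg (hw0 z), hw, abs_mul, hc, one_mul]
      have h1 : fderiv ℝ η z (dirX i) * (G (u z) - u z) * (|y| ^ (p i - 2) * y)
          ≤ |y| ^ (p i - 1) * (|fderiv ℝ η z (dirX i)| * w z) := by
        refine (le_abs_self _).trans (le_of_eq ?_)
        rw [abs_mul, abs_mul, habs, abs_flux (hp i)]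
        ring
      have h2 := flux_mul_self (hp i) y
      calc _ = fderiv ℝ η z (dirX i) * (G (u z) - u z) * (|y| ^ (p i - 2) * y)
            - η z * (|y| ^ (p i - 2) * y * y) := by ring
        _ ≤ _ := by
            rw [h2]
            exact sub_le_sub_right h1 _

/-- Taking the maximum with `k` raises a function, so it keeps the obstacle constraint at any level.
-/
theorem isEnergySubsolution_truncNeg {Ω : Set (EuclideanSpace ℝ (Fin N))} {T : ℝ}
    {p : Fin N → ℝ} {φ u : SpaceTime N → ℝ} (hN : 0 < N) (hp : ∀ i, 2 ≤ p i) (hΩ : IsOpen Ω)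
    (hΩb : Bornology.IsBounded Ω) (hφ : ContinuousOn φ (cyl Ω T)) (hK : ∃ v, MemK' Ω T p φ v)
    (hu : IsLocalWeakSolution Ω T p φ u) {D : Set (SpaceTime N)} (hD : IsOpen D)
    (hDU : D ⊆ openCyl Ω T) (k : ℝ) : IsEnergySubsolution Ω T p D (truncNeg u k) := by
  refine hu.isEnergySubsolution hN hp hΩ hΩb hφ hK hD hDU (isTruncation_max N k)
    (fun z _ y hy => hy.trans (le_max_left y k)) (c := 1) abs_one (fun z => ?_)
    fun z => le_max_right _ _
  rw [truncNeg, one_mul, ← max_sub_sub_right, sub_self, max_comm]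

/-- Taking the minimum with `k` lowers a function; it stays above `φ` on `D` because `k` does. -/
theorem isEnergySubsolution_truncPos {Ω : Set (EuclideanSpace ℝ (Fin N))} {T : ℝ}
    {p : Fin N → ℝ} {φ u : SpaceTime N → ℝ} (hN : 0 < N) (hp : ∀ i, 2 ≤ p i) (hΩ : IsOpen Ω)
    (hΩb : Bornology.IsBounded Ω) (hφ : ContinuousOn φ (cyl Ω T)) (hK : ∃ v, MemK' Ω T p φ v)
    (hu : IsLocalWeakSolution Ω T p φ u) {D : Set (SpaceTime N)} (hD : IsOpen D)
    (hDU : D ⊆ openCyl Ω T) {k : ℝ} (hk : ∀ z ∈ D, φ z ≤ k) :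
    IsEnergySubsolution Ω T p D (truncPos u k) := by
  refine hu.isEnergySubsolution hN hp hΩ hΩb hφ hK hD hDU (isTruncation_min N k)
    (fun z hz y hy => le_min hy (hk z hz)) (c := -1) (by simp) (fun z => ?_)
    fun z => le_max_right _ _
  rw [truncPos, neg_one_mul, neg_sub]
  rcases le_total (u z) k with h | h
  · rw [max_eq_right (sub_nonpos.2 h), min_eq_left h, sub_self]
  · rw [max_eq_left (sub_nonneg.2 h), min_eq_right h]

end AnisoObstacle

namespace AnisoObstacle

variable {N : ℕ} {x₀ : EuclideanSpace ℝ (Fin N)} {t₀ s ρ : ℝ} {ξ : SpaceTime N → ℝ}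

/-! ### Test functions built from powers of the cutoff. -/

section CutPow

/-- A smooth approximation of `y ↦ y ^ α` which vanishes for `y ≤ δ`. -/
noncomputable def cutPow (α δ y : ℝ) : ℝ := Real.smoothTransition (y / δ - 1) * y ^ α

variable {α δ y : ℝ}

theorem cutPow_eq_zero (hδ : 0 < δ) (hy : y ≤ δ) : cutPow α δ y = 0 := by
  rw [cutPow, Real.smoothTransition.zero_of_nonpos, zero_mul]
  rw [sub_nonpos, div_le_one hδ]
  exact hy

theorem cutPow_nonneg (hδ : 0 < δ) : 0 ≤ cutPow α δ y := by
  rcases le_total y δ with h | h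
  · rw [cutPow_eq_zero hδ h]
  · exact mul_nonneg (Real.smoothTransition.nonneg _) (Real.rpow_nonneg (hδ.le.trans h) _)

theorem cutPow_le (hy : 0 ≤ y) : cutPow α δ y ≤ y ^ α :=
  mul_le_of_le_one_left (Real.rpow_nonneg hy _) (Real.smoothTransition.le_one _)

theorem contDiff_cutPow (hδ : 0 < δ) : ContDiff ℝ ∞ (cutPow α δ) := by
  rw [contDiff_iff_contDiffAt]
  intro y
  rcases lt_or_ge y δ with h | h
  · refine contDiffAt_const (c := (0 : ℝ)) |>.congr_of_eventuallyEq ?_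
    filter_upwards [Iio_mem_nhds h] with x hx
    exact cutPow_eq_zero hδ (le_of_lt hx)
  · refine ContDiffAt.mul ?_ (Real.contDiffAt_rpow_const_of_ne (hδ.trans_le h).ne')
    exact (Real.smoothTransition.contDiff.comp
      ((contDiff_id.div_const δ).sub contDiff_const)).contDiffAt

theorem exists_abs_deriv_smoothTransition_le :
    ∃ M, 0 ≤ M ∧ ∀ y, |deriv Real.smoothTransition y| ≤ M := by
  have hc : Continuous (deriv Real.smoothTransition) :=
    (Real.smoothTransition.contDiff (n := 1)).continuous_deriv le_rfl
  obtain ⟨M, hM⟩ := isCompact_Icc.exists_bound_of_continuousOn (s := Icc (0 : ℝ) 1) hc.continuousOn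
  refine ⟨M, (norm_nonneg _).trans (hM 0 (by simp)), fun y => ?_⟩
  have hM0 : 0 ≤ M := (norm_nonneg _).trans (hM 0 (by simp))
  rcases lt_or_ge y 0 with h | h
  · have : Real.smoothTransition =ᶠ[𝓝 y] fun _ => 0 := by
      filter_upwards [Iio_mem_nhds h] with x hx
      exact Real.smoothTransition.zero_of_nonpos (le_of_lt hx)
    simpa [this.deriv_eq] using hM0
  · rcases lt_or_ge 1 y with h1 | h1
    · have : Real.smoothTransition =ᶠ[𝓝 y] fun _ => 1 := by
        filter_upwards [Ioi_mem_nhds h1] with x hx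
        exact Real.smoothTransition.one_of_one_le (le_of_lt hx)
      simpa [this.deriv_eq] using hM0
    · exact hM y ⟨h, h1⟩

theorem deriv_smoothTransition_eq_zero (hy : 1 < y) : deriv Real.smoothTransition y = 0 := by
  have : Real.smoothTransition =ᶠ[𝓝 y] fun _ => 1 := by
    filter_upwards [Ioi_mem_nhds hy] with x hx
    exact Real.smoothTransition.one_of_one_le (le_of_lt hx)
  simp [this.deriv_eq]

/-- The factor `1/δ` from the transition is harmless: its derivative vanishes once `y > 2δ`, so
`y^α/δ` only enters where it is at most `2 y^{α-1}`. The bound is uniform in `δ`, which permits `δ →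
0`. -/
theorem exists_abs_deriv_cutPow_le (hα : 0 ≤ α) :
    ∃ c, 0 ≤ c ∧ ∀ δ y, 0 < δ → 0 ≤ y → |deriv (cutPow α δ) y| ≤ c * y ^ (α - 1) := by
  obtain ⟨M, hM0, hM⟩ := exists_abs_deriv_smoothTransition_le
  refine ⟨2 * M + α, by positivity, fun δ y hδ hy => ?_⟩
  have hr : 0 ≤ y ^ (α - 1) := Real.rpow_nonneg hy _
  rcases lt_or_ge y δ with h | h
  · have : cutPow α δ =ᶠ[𝓝 y] fun _ => 0 := by
      filter_upwards [Iio_mem_nhds h] with x hx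
      exact cutPow_eq_zero hδ (le_of_lt hx)
    rw [this.deriv_eq, deriv_const, abs_zero]
    positivity
  · have hy0 : 0 < y := hδ.trans_le h
    have h1 : HasDerivAt (fun y => Real.smoothTransition (y / δ - 1))
        (deriv Real.smoothTransition (y / δ - 1) * (1 / δ)) y := by
      refine HasDerivAt.comp (h₂ := Real.smoothTransition) y ?_ (((hasDerivAt_id y).div_const δ).sub_const 1)
      exact ((Real.smoothTransition.contDiff (n := 1)).differentiable one_ne_zero
        _).hasDerivAt
    have h2 := h1.mul (Real.hasDerivAt_rpow_const (p := α) (Or.inl hy0.ne'))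
    have h3 : deriv (cutPow α δ) y = deriv Real.smoothTransition (y / δ - 1) * (1 / δ) * y ^ α
        + Real.smoothTransition (y / δ - 1) * (α * y ^ (α - 1)) := h2.deriv
    have h4 : y ^ α = y * y ^ (α - 1) := by
      rw [mul_comm, ← Real.rpow_add_one hy0.ne', sub_add_cancel]
    have h5 : |deriv Real.smoothTransition (y / δ - 1) * (1 / δ) * y ^ α|
        ≤ 2 * M * y ^ (α - 1) := by
      rw [h4, ← mul_assoc, abs_mul, abs_of_nonneg hr]
      refine mul_le_mul_of_nonneg_right ?_ hr
      rw [mul_assoc, abs_mul, one_div_mul_eq_div, abs_of_nonneg (div_nonneg hy hδ.le), mul_comm]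
      rcases lt_or_ge 2 (y / δ) with h6 | h6
      · rw [deriv_smoothTransition_eq_zero (by linarith), abs_zero, mul_zero]
        positivity
      · exact mul_le_mul h6 (hM _) (abs_nonneg _) zero_le_two
    have h6 : |Real.smoothTransition (y / δ - 1) * (α * y ^ (α - 1))| ≤ α * y ^ (α - 1) := by
      rw [abs_of_nonneg (mul_nonneg (Real.smoothTransition.nonneg _) (mul_nonneg hα hr))]
      exact mul_le_of_le_one_left (mul_nonneg hα hr) (Real.smoothTransition.le_one _)
    rw [h3, add_mul]
    exact (abs_add_le _ _).trans (add_le_add h5 h6)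

theorem tendsto_cutPow (hα : 0 < α) (hy : 0 ≤ y) {ι : Type*} {l : Filter ι} {δ : ι → ℝ}
    (hδ0 : ∀ n, 0 < δ n) (hδ : Tendsto δ l (𝓝 0)) :
    Tendsto (fun n => cutPow α (δ n) y) l (𝓝 (y ^ α)) := by
  rcases hy.eq_or_lt with h | h
  · rw [← h, Real.zero_rpow hα.ne']
    simp only [cutPow, Real.zero_rpow hα.ne', mul_zero]
    exact tendsto_const_nhds
  · refine tendsto_const_nhds.congr' ?_
    filter_upwards [hδ.eventually (Iio_mem_nhds (half_pos h))] with n hn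
    rw [cutPow, Real.smoothTransition.one_of_one_le, one_mul]
    rw [le_sub_iff_add_le, le_div_iff₀ (hδ0 n)]

    linarith

end CutPow

theorem isOpen_Q : IsOpen (Q x₀ t₀ s ρ) := Metric.isOpen_ball.prod isOpen_Ioo

theorem exists_bound_on_Q {b : SpaceTime N → ℝ} (hb : Continuous b) :
    ∃ C, ∀ z ∈ Q x₀ t₀ s ρ, ‖b z‖ ≤ C := by
  obtain ⟨C, hC⟩ := ((isCompact_closedBall x₀ ρ).prod (isCompact_Icc (a := t₀ - s) (b := t₀))
    ).exists_bound_of_continuousOn hb.continuousOn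
  exact ⟨C, fun z hz => hC z ⟨Metric.ball_subset_closedBall hz.1, Ioo_subset_Icc_self hz.2⟩⟩

theorem integrable_continuous_mul_Q {b F : SpaceTime N → ℝ} (hb : Continuous b)
    (hF : Integrable F (volume.restrict (Q x₀ t₀ s ρ))) :
    Integrable (fun z => b z * F z) (volume.restrict (Q x₀ t₀ s ρ)) := by
  obtain ⟨C, hC⟩ := exists_bound_on_Q (x₀ := x₀) (t₀ := t₀) (s := s) (ρ := ρ) hb
  exact hF.bdd_mul hb.aestronglyMeasurable
    ((ae_restrict_mem isOpen_Q.measurableSet).mono hC)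

namespace IsCutoff

theorem continuous_rpow (hξ : IsCutoff x₀ t₀ s ρ ξ) {α : ℝ} (hα : 0 ≤ α) :
    Continuous fun z => ξ z ^ α :=
  hξ.smooth.continuous.rpow_const fun _ => Or.inr hα

theorem continuous_fderiv_apply (hξ : IsCutoff x₀ t₀ s ρ ξ) (e : SpaceTime N) :
    Continuous fun z => fderiv ℝ ξ z e :=
  (hξ.smooth.continuous_fderiv (by simp)).clm_apply continuous_const

/-- The test function built from a cutoff function `ξ` and a function `χ` of time. -/
noncomputable def testFunction (x₀ : EuclideanSpace ℝ (Fin N)) (t₀ s ρ α δ : ℝ)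
    (ξ : SpaceTime N → ℝ) (χ : ℝ → ℝ) : SpaceTime N → ℝ :=
  (Q x₀ t₀ s ρ).indicator fun z => cutPow α δ (ξ z) * χ z.2

variable {α δ : ℝ} {χ : ℝ → ℝ}

/-- `ξ^α` need be neither smooth nor compactly supported in `Q`. Cutting at height `δ` confines the
support to `{ξ ≥ δ}`, away from the lateral boundary where `ξ = 0`, and `χ` keeps it away from top
and bottom. -/
theorem isTestFunction (hξ : IsCutoff x₀ t₀ s ρ ξ) (hδ : 0 < δ) (hχ : ContDiff ℝ ∞ χ)
    (hχc : HasCompactSupport χ) (hχs : tsupport χ ⊆ Ioo (t₀ - s) t₀) :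
    IsTestFunction (Q x₀ t₀ s ρ) (testFunction x₀ t₀ s ρ α δ ξ χ) := by
  set K : Set (SpaceTime N) := (Metric.closedBall x₀ ρ ×ˢ tsupport χ) ∩ {z | δ ≤ ξ z} with hK
  have hKc : IsCompact K := ((isCompact_closedBall x₀ ρ).prod hχc).inter_right
    (isClosed_le continuous_const hξ.smooth.continuous)
  have hKQ : K ⊆ Q x₀ t₀ s ρ := by
    rintro ⟨x, t⟩ ⟨⟨hx, ht⟩, hz⟩
    refine ⟨?_, hχs ht⟩
    rcases (Metric.mem_closedBall.1 hx).eq_or_lt with h | h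
    · have := hξ.lateral x (Metric.mem_sphere.2 h) t (hχs ht)
      rw [mem_ofPred_eq, this] at hz
      exact absurd hz (not_le.2 hδ)
    · exact h
  have hK0 : ∀ z ∉ K, testFunction x₀ t₀ s ρ α δ ξ χ z = 0 := by
    intro z hz
    by_cases hzQ : z ∈ Q x₀ t₀ s ρ
    · rw [testFunction, indicator_of_mem hzQ]
      by_cases h1 : z.2 ∈ tsupport χ
      · rw [cutPow_eq_zero hδ, zero_mul]
        by_contra h2
        exact hz ⟨⟨Metric.ball_subset_closedBall hzQ.1, h1⟩, (not_le.1 h2).le⟩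
      · rw [image_eq_zero_of_notMem_tsupport h1, mul_zero]
    · exact indicator_of_notMem hzQ _
  have hsupp : tsupport (testFunction x₀ t₀ s ρ α δ ξ χ) ⊆ K :=
    closure_minimal (fun z hz => by
      by_contra h
      exact hz (hK0 z h)) hKc.isClosed
  refine ⟨?_, hKc.of_isClosed_subset (isClosed_tsupport _) hsupp, hsupp.trans hKQ⟩
  rw [contDiff_iff_contDiffAt]
  intro z
  by_cases hz : z ∈ K
  · have h1 : ContDiffAt ℝ ∞ (fun z => cutPow α δ (ξ z) * χ z.2) z :=
      (((contDiff_cutPow hδ).comp hξ.smooth).mul (hχ.comp contDiff_snd)).contDiffAt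
    refine h1.congr_of_eventuallyEq ?_
    filter_upwards [isOpen_Q.mem_nhds (hKQ hz)] with y hy
    exact indicator_of_mem hy _
  · refine (contDiffAt_const (c := (0 : ℝ))).congr_of_eventuallyEq ?_
    filter_upwards [hKc.isClosed.isOpen_compl.mem_nhds hz] with y hy
    exact hK0 y hy

theorem fderiv_testFunction (hξ : IsCutoff x₀ t₀ s ρ ξ) (hδ : 0 < δ) (hχ : ContDiff ℝ ∞ χ)
    {z : SpaceTime N} (hz : z ∈ Q x₀ t₀ s ρ) (e : SpaceTime N) :
    fderiv ℝ (testFunction x₀ t₀ s ρ α δ ξ χ) z e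
      = deriv (cutPow α δ) (ξ z) * fderiv ℝ ξ z e * χ z.2
        + cutPow α δ (ξ z) * (deriv χ z.2 * e.2) := by
  have h1 : testFunction x₀ t₀ s ρ α δ ξ χ =ᶠ[𝓝 z] fun z => cutPow α δ (ξ z) * χ z.2 := by
    filter_upwards [isOpen_Q.mem_nhds hz] with y hy
    exact indicator_of_mem hy _
  have hd : ∀ y, HasDerivAt (cutPow α δ) (deriv (cutPow α δ) y) y := fun y =>
    ((contDiff_cutPow hδ).differentiable (by simp) y).hasDerivAt
  have hd' : ∀ y, HasDerivAt χ (deriv χ y) y := fun y =>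
    (hχ.differentiable (by simp) y).hasDerivAt
  have h2 := (hd (ξ z)).comp_hasFDerivAt z ((hξ.smooth.differentiable (by simp) z).hasFDerivAt)
  have h3 := (hd' z.2).comp_hasFDerivAt z (hasFDerivAt_snd (𝕜 := ℝ) (p := z))
  have h4 := (h2.mul h3).fderiv
  rw [h1.fderiv_eq]
  refine (congrArg (fun L => L e) h4).trans ?_
  simp
  ring

end IsCutoff

/-- A form of Young's inequality with the powers of the cutoff absorbed. -/
theorem young_cutoff {p α c a b x : ℝ} (hp : 2 ≤ p) (hα : p ≤ α) (hc : 0 ≤ c) (ha : 0 ≤ a)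
    (hb : 0 ≤ b) (hx0 : 0 ≤ x) (hx1 : x ≤ 1) :
    a ^ (p - 1) * (c * x ^ (α - 1) * b)
      ≤ 1 / 2 * (x ^ α * a ^ p) + c * (2 * c) ^ (p - 1) * b ^ p := by
  have hR : 0 ≤ c * (2 * c) ^ (p - 1) * b ^ p := by positivity
  have hL : 0 ≤ 1 / 2 * (x ^ α * a ^ p) := by positivity
  rcases hx0.eq_or_lt with h | hx
  · rw [← h, Real.zero_rpow (by linarith)]
    simpa [← h] using add_nonneg hL hR
  have hxα : x ^ α = x * x ^ (α - 1) := by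
    rw [mul_comm, ← Real.rpow_add_one hx.ne', sub_add_cancel]
  have hpow : ∀ {y : ℝ}, 0 ≤ y → y ^ p = y * y ^ (p - 1) := fun {y} hy => by
    rcases hy.eq_or_lt with h | h
    · rw [← h, Real.zero_rpow (by linarith), zero_mul]
    · rw [mul_comm, ← Real.rpow_add_one h.ne', sub_add_cancel]
  -- Young's inequality by a dichotomy: if `c b` is at most half of `x a` the first term on the
  -- right suffices, otherwise `x a ≤ 2 c b` and the second one does.
  rcases le_total (c * b) (1 / 2 * (x * a)) with h | h
  · calc a ^ (p - 1) * (c * x ^ (α - 1) * b) = (c * b) * (a ^ (p - 1) * x ^ (α - 1)) := by ring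
      _ ≤ 1 / 2 * (x * a) * (a ^ (p - 1) * x ^ (α - 1)) :=
          mul_le_mul_of_nonneg_right h (by positivity)
      _ = 1 / 2 * (x ^ α * a ^ p) := by
          rw [hxα, hpow ha]
          ring
      _ ≤ _ := le_add_of_nonneg_right hR
  · have h1 : x * a ≤ 2 * c * b := by linarith
    -- Here `p ≤ α` enters: the surplus power `x^{α-p}` is at most `1`.
    have h2 : x ^ (α - 1) = x ^ (α - p) * x ^ (p - 1) := by
      rw [← Real.rpow_add hx]
      congr 1
      ring
    calc a ^ (p - 1) * (c * x ^ (α - 1) * b)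
        = c * b * (x ^ (α - p) * (x * a) ^ (p - 1)) := by
          rw [h2, Real.mul_rpow hx0 ha]
          ring
      _ ≤ c * b * (1 * (2 * c * b) ^ (p - 1)) := by
          refine mul_le_mul_of_nonneg_left (mul_le_mul ?_ ?_ (by positivity) zero_le_one)
            (by positivity)
          · exact Real.rpow_le_one hx0 hx1 (by linarith)
          · exact Real.rpow_le_rpow (by positivity) h1 (by linarith)
      _ = c * (2 * c) ^ (p - 1) * b ^ p := by
          rw [Real.mul_rpow (by positivity) hb, hpow hb]
          ring
      _ ≤ _ := le_add_of_nonneg_left hL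

end AnisoObstacle

/-! ### The energy inequality weighted in time. -/

namespace AnisoObstacle

variable {N : ℕ} {x₀ : EuclideanSpace ℝ (Fin N)} {t₀ s ρ : ℝ} {ξ : SpaceTime N → ℝ}

theorem IsCutoff.tendsto_integral_cutPow (hξ : IsCutoff x₀ t₀ s ρ ξ) {α : ℝ} (hα : 0 < α)
    {δ : ℕ → ℝ} (hδ0 : ∀ n, 0 < δ n) (hδ : Tendsto δ atTop (𝓝 0)) {F : SpaceTime N → ℝ}
    (hF : Integrable F (volume.restrict (Q x₀ t₀ s ρ))) :
    Tendsto (fun n => ∫ z in Q x₀ t₀ s ρ, cutPow α (δ n) (ξ z) * F z) atTop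
      (𝓝 (∫ z in Q x₀ t₀ s ρ, ξ z ^ α * F z)) := by
  refine tendsto_integral_of_dominated_convergence (fun z => ‖F z‖) (fun n => ?_) hF.norm
    (fun n => ?_) ?_
  · exact ((contDiff_cutPow (hδ0 n)).continuous.comp
      hξ.smooth.continuous).aestronglyMeasurable.mul hF.1
  · filter_upwards [ae_restrict_mem isOpen_Q.measurableSet] with z hz
    rw [norm_mul, Real.norm_eq_abs, abs_of_nonneg (cutPow_nonneg (hδ0 n))]
    refine mul_le_of_le_one_left (norm_nonneg _) ((cutPow_le (hξ.nonneg z hz)).trans ?_)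
    exact Real.rpow_le_one (hξ.nonneg z hz) (hξ.le_one z hz) hα.le
  · filter_upwards [ae_restrict_mem isOpen_Q.measurableSet] with z hz
    exact (tendsto_cutPow hα (hξ.nonneg z hz) hδ0 hδ).mul_const _

section

variable {Ω : Set (EuclideanSpace ℝ (Fin N))} {T : ℝ} {p : Fin N → ℝ} {w : SpaceTime N → ℝ}
  {D : Set (SpaceTime N)}

theorem IsEnergySubsolution.integrable_sq (hw : IsEnergySubsolution Ω T p D w) (hN : 0 < N)
    (hp : ∀ i, 2 ≤ p i) (hΩb : Bornology.IsBounded Ω) :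
    Integrable (fun z => w z ^ 2) (volume.restrict (openCyl Ω T)) := by
  have := isFiniteMeasure_restrict_openCyl hΩb T
  have h2 : MemLp w 2 (volume.restrict (openCyl Ω T)) := (hw.memLp ⟨0, hN⟩).mono_exponent (by
    have := ENNReal.ofReal_le_ofReal (hp ⟨0, hN⟩)
    simpa using this)
  exact h2.integrable_sq

theorem IsEnergySubsolution.integrable_rpow (hw : IsEnergySubsolution Ω T p D w)
    (hp : ∀ i, 2 ≤ p i) (i : Fin N) :
    Integrable (fun z => w z ^ p i) (volume.restrict (openCyl Ω T)) := by
  have := integrable_abs_rpow (hp i) (hw.memLp i)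
  simpa only [abs_of_nonneg (hw.nonneg _)] using this

/-- `cutoffTerm` counts the time integral `N` times; once is enough below. -/
theorem time_integral_le_cutoffTerm (hN : 0 < N) :
    (∫ z in Q x₀ t₀ s ρ, |fderiv ℝ ξ z (dirT N)| * w z ^ 2)
      + ∑ i, ∫ z in Q x₀ t₀ s ρ, |fderiv ℝ ξ z (dirX i)| ^ (p i) * w z ^ (p i)
      ≤ cutoffTerm p x₀ t₀ s ρ ξ w := by
  have h0 : 0 ≤ ∫ z in Q x₀ t₀ s ρ, |fderiv ℝ ξ z (dirT N)| * w z ^ 2 :=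
    integral_nonneg fun z => mul_nonneg (abs_nonneg _) (sq_nonneg _)
  rw [cutoffTerm, Finset.sum_add_distrib, Finset.sum_const, Finset.card_univ, Fintype.card_fin,
    nsmul_eq_mul]
  refine add_le_add (le_mul_of_one_le_left h0 ?_) le_rfl
  exact_mod_cast hN

/-- A single constant for all exponents in `[2, α]`. -/
theorem exists_const_le_of_young {α : ℝ} (c : ℝ) (hc : 0 ≤ c) (hα : 0 ≤ α) :
    ∃ c' : ℝ, 0 < c' ∧ c ≤ c' ∧ ∀ q : ℝ, 2 ≤ q → q ≤ α → c * (2 * c) ^ (q - 1) ≤ c' := by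
  refine ⟨(1 + c) * (1 + 2 * c) ^ α, by positivity, ?_, fun q h hq => ?_⟩
  · have : 1 ≤ (1 + 2 * c) ^ α := Real.one_le_rpow (by linarith) hα
    nlinarith
  · refine mul_le_mul (by linarith) ?_ (by positivity) (by linarith)
    calc (2 * c) ^ (q - 1) ≤ (1 + 2 * c) ^ (q - 1) :=
          Real.rpow_le_rpow (by linarith) (by linarith) (by linarith)
      _ ≤ (1 + 2 * c) ^ α := Real.rpow_le_rpow_of_exponent_le (by linarith) (by linarith)

/-- The energy inequality with a smooth compactly supported weight in time. -/
theorem exists_const_weighted_energy {α : ℝ} (hα : 2 ≤ α) : ∃ c : ℝ, 0 < c ∧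
    ∀ {N : ℕ} {Ω : Set (EuclideanSpace ℝ (Fin N))} {T : ℝ} {p : Fin N → ℝ}
      {x₀ : EuclideanSpace ℝ (Fin N)} {t₀ s ρ : ℝ} {ξ w : SpaceTime N → ℝ} {χ : ℝ → ℝ},
      0 < N → (∀ i, 2 ≤ p i) → (∀ i, p i ≤ α) → Bornology.IsBounded Ω →
      Q x₀ t₀ s ρ ⊆ openCyl Ω T → IsCutoff x₀ t₀ s ρ ξ →
      IsEnergySubsolution Ω T p (Q x₀ t₀ s ρ) w → ContDiff ℝ ∞ χ → HasCompactSupport χ →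
      tsupport χ ⊆ Ioo (t₀ - s) t₀ → (∀ t, χ t ∈ Icc (0 : ℝ) 1) →
      1 / 2 * (∑ i, ∫ z in Q x₀ t₀ s ρ,
          ξ z ^ α * (χ z.2 * |weakDeriv (openCyl Ω T) (dirX i) w z| ^ (p i)))
        ≤ 1 / 2 * (∫ z in Q x₀ t₀ s ρ, ξ z ^ α * (deriv χ z.2 * w z ^ 2))
          + c * cutoffTerm p x₀ t₀ s ρ ξ w := by
  obtain ⟨c, hc0, hc⟩ := exists_abs_deriv_cutPow_le (α := α) (by linarith)
  obtain ⟨c', hc'0, hcc', hc'⟩ := exists_const_le_of_young (α := α) c hc0 (by linarith)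
  refine ⟨c', hc'0, ?_⟩
  intro N Ω T p x₀ t₀ s ρ ξ w χ hN hp hpα hΩb hQ hξ hw hχ hχc hχs hχ01
  have hm := Measure.restrict_mono_set (volume : Measure (SpaceTime N)) hQ
  set W : Fin N → SpaceTime N → ℝ := fun i => weakDeriv (openCyl Ω T) (dirX i) w with hW
  have hWp : ∀ i, MemLp (W i) (ENNReal.ofReal (p i)) (volume.restrict (Q x₀ t₀ s ρ)) :=
    fun i => (hw.weakDeriv_memLp i).2.mono_measure hm
  have hwp : ∀ i, MemLp w (ENNReal.ofReal (p i)) (volume.restrict (Q x₀ t₀ s ρ)) :=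
    fun i => (hw.memLp i).mono_measure hm
  have hw2 := (hw.integrable_sq hN hp hΩb).mono_measure hm
  have hwpi := fun i => (hw.integrable_rpow hp i).mono_measure hm
  have hWpi := fun i => integrable_abs_rpow (hp i) (hWp i)
  have hχ2 : Continuous fun z : SpaceTime N => χ z.2 := hχ.continuous.comp continuous_snd
  have hχ2' : Continuous fun z : SpaceTime N => deriv χ z.2 :=
    (hχ.continuous_deriv (by simp)).comp continuous_snd
  have iW := fun i => integrable_continuous_mul_Q hχ2 (hWpi i)
  have iw := integrable_continuous_mul_Q hχ2' hw2
  have it := integrable_continuous_mul_Q (hξ.continuous_fderiv_apply (dirT N)).abs hw2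
  have ix := fun i => integrable_continuous_mul_Q
    ((hξ.continuous_fderiv_apply (dirX i)).abs.rpow_const
      fun _ => Or.inr (by linarith [hp i] : 0 ≤ p i)) (hwpi i)
  have iξW := fun i => integrable_continuous_mul_Q
    (hξ.continuous_rpow (by linarith : 0 ≤ α)) (iW i)
  -- The gradient term left over by Young's inequality carries the full weight `ξ^α` rather than
  -- `cutPow α δ ξ`, so it can be absorbed on the left only after `δ → 0`.
  have step : ∀ δ : ℝ, 0 < δ →
      (∑ i, ∫ z in Q x₀ t₀ s ρ, cutPow α δ (ξ z) * (χ z.2 * |W i z| ^ (p i)))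
        ≤ 1 / 2 * (∫ z in Q x₀ t₀ s ρ, cutPow α δ (ξ z) * (deriv χ z.2 * w z ^ 2))
          + 1 / 2 * (∑ i, ∫ z in Q x₀ t₀ s ρ, ξ z ^ α * (χ z.2 * |W i z| ^ (p i)))
          + c' * cutoffTerm p x₀ t₀ s ρ ξ w := by
    intro δ hδ
    set η := IsCutoff.testFunction x₀ t₀ s ρ α δ ξ χ with hηdef
    have hη := hξ.isTestFunction (α := α) hδ hχ hχc hχs
    have hηQ : ∀ z ∈ Q x₀ t₀ s ρ, η z = cutPow α δ (ξ z) * χ z.2 := fun z hz =>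
      indicator_of_mem hz _
    have hη0 : ∀ z, 0 ≤ η z := fun z =>
      indicator_nonneg (fun z _ => mul_nonneg (cutPow_nonneg hδ) (hχ01 z.2).1) z
    have hcut : Continuous fun z => cutPow α δ (ξ z) :=
      (contDiff_cutPow hδ).continuous.comp hξ.smooth.continuous
    have key := hw.tested_ineq η hη hη0
    have b1 : (∫ z in Q x₀ t₀ s ρ, w z ^ 2 * fderiv ℝ η z (dirT N))
        ≤ (∫ z in Q x₀ t₀ s ρ, cutPow α δ (ξ z) * (deriv χ z.2 * w z ^ 2))
          + c * ∫ z in Q x₀ t₀ s ρ, |fderiv ℝ ξ z (dirT N)| * w z ^ 2 := by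
      rw [← integral_const_mul, ← integral_add (integrable_continuous_mul_Q hcut iw)
        (it.const_mul c)]
      have i0 := integrable_continuous_mul_Q (hη.fderiv_apply (dirT N)).continuous hw2
      refine setIntegral_mono_on (i0.congr (Eventually.of_forall fun z => mul_comm _ _))
        ((integrable_continuous_mul_Q hcut iw).add (it.const_mul c)) isOpen_Q.measurableSet
        fun z hz => ?_
      have hξ0 := hξ.nonneg z hz
      have h1 := hc δ (ξ z) hδ hξ0
      have h2 : ξ z ^ (α - 1) ≤ 1 := Real.rpow_le_one hξ0 (hξ.le_one z hz) (by linarith)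
      have h3 : |deriv (cutPow α δ) (ξ z)| ≤ c := h1.trans (mul_le_of_le_one_right hc0 h2)
      have h4 : deriv (cutPow α δ) (ξ z) * fderiv ℝ ξ z (dirT N) * χ z.2
          ≤ c * |fderiv ℝ ξ z (dirT N)| := by
        refine (le_abs_self _).trans ?_
        rw [abs_mul, abs_mul, abs_of_nonneg (hχ01 z.2).1]
        exact (mul_le_of_le_one_right (by positivity) (hχ01 z.2).2).trans
          (mul_le_mul_of_nonneg_right h3 (abs_nonneg _))
      rw [IsCutoff.fderiv_testFunction hξ hδ hχ hz]
      have h5 := mul_le_mul_of_nonneg_left h4 (sq_nonneg (w z))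
      simp only [dirT, mul_one] at h5 ⊢
      linarith
    have b2 : ∀ i, (∫ z in Q x₀ t₀ s ρ, (|W i z| ^ (p i - 1) * (|fderiv ℝ η z (dirX i)| * w z)
          - η z * |W i z| ^ (p i)))
        ≤ 1 / 2 * (∫ z in Q x₀ t₀ s ρ, ξ z ^ α * (χ z.2 * |W i z| ^ (p i)))
          + c' * (∫ z in Q x₀ t₀ s ρ, |fderiv ℝ ξ z (dirX i)| ^ (p i) * w z ^ (p i))
          - ∫ z in Q x₀ t₀ s ρ, cutPow α δ (ξ z) * (χ z.2 * |W i z| ^ (p i)) := by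
      intro i
      have j1 := (iξW i).const_mul (1 / 2)
      have j2 := (ix i).const_mul c'
      have j3 := integrable_continuous_mul_Q hcut (iW i)
      have j4 : Integrable (fun z => 1 / 2 * (ξ z ^ α * (χ z.2 * |W i z| ^ (p i)))
          + c' * (|fderiv ℝ ξ z (dirX i)| ^ (p i) * w z ^ (p i)))
          (volume.restrict (Q x₀ t₀ s ρ)) := j1.add j2
      rw [← integral_const_mul, ← integral_const_mul, ← integral_add j1 j2, ← integral_sub j4 j3]
      obtain ⟨C', -, hC'⟩ := (hη.fderiv_apply (dirX i)).bounded
      have i3 := integrable_rpow_sub_one_mul (hp i) (hWp i) (memLp_bdd_mul (hwp i)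
        (hη.fderiv_apply (dirX i)).continuous.abs.aestronglyMeasurable
        fun z => (abs_abs _).le.trans (hC' z))
      have i4 := integrable_continuous_mul_Q hη.continuous (hWpi i)
      refine setIntegral_mono_on (i3.sub i4) (j4.sub j3) isOpen_Q.measurableSet fun z hz => ?_
      have hξ0 := hξ.nonneg z hz
      have hχ0 := (hχ01 z.2).1
      have hW0 : 0 ≤ |W i z| ^ (p i - 1) := Real.rpow_nonneg (abs_nonneg _) _
      have e1 : |fderiv ℝ η z (dirX i)|
          ≤ c * ξ z ^ (α - 1) * |fderiv ℝ ξ z (dirX i)| * χ z.2 := by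
        rw [IsCutoff.fderiv_testFunction hξ hδ hχ hz]
        simp only [dirX, mul_zero, add_zero]
        rw [abs_mul, abs_mul, abs_of_nonneg hχ0]
        exact mul_le_mul_of_nonneg_right
          (mul_le_mul_of_nonneg_right (hc δ (ξ z) hδ hξ0) (abs_nonneg _)) hχ0
      have e2 := young_cutoff (hp i) (hpα i) hc0 (abs_nonneg (W i z))
        (mul_nonneg (abs_nonneg (fderiv ℝ ξ z (dirX i))) (hw.nonneg z)) hξ0 (hξ.le_one z hz)
      have e3 : c * (2 * c) ^ (p i - 1) ≤ c' := hc' (p i) (hp i) (hpα i)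
      rw [Real.mul_rpow (abs_nonneg _) (hw.nonneg z)] at e2
      have hR : 0 ≤ |fderiv ℝ ξ z (dirX i)| ^ (p i) * w z ^ (p i) :=
        mul_nonneg (Real.rpow_nonneg (abs_nonneg _) _) (Real.rpow_nonneg (hw.nonneg z) _)
      have e4 := mul_le_mul_of_nonneg_right e3 hR
      have e5 : |W i z| ^ (p i - 1) * (|fderiv ℝ η z (dirX i)| * w z)
          ≤ χ z.2 * (1 / 2 * (ξ z ^ α * |W i z| ^ p i)
            + c' * (|fderiv ℝ ξ z (dirX i)| ^ p i * w z ^ p i)) := by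
        calc |W i z| ^ (p i - 1) * (|fderiv ℝ η z (dirX i)| * w z)
            ≤ |W i z| ^ (p i - 1)
              * (c * ξ z ^ (α - 1) * |fderiv ℝ ξ z (dirX i)| * χ z.2 * w z) :=
              mul_le_mul_of_nonneg_left (mul_le_mul_of_nonneg_right e1 (hw.nonneg z)) hW0
          _ = χ z.2 * (|W i z| ^ (p i - 1)
              * (c * ξ z ^ (α - 1) * (|fderiv ℝ ξ z (dirX i)| * w z))) := by ring
          _ ≤ _ := mul_le_mul_of_nonneg_left (e2.trans (add_le_add le_rfl e4)) hχ0
      have e6 : χ z.2 * (c' * (|fderiv ℝ ξ z (dirX i)| ^ p i * w z ^ p i))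
          ≤ c' * (|fderiv ℝ ξ z (dirX i)| ^ p i * w z ^ p i) :=
        mul_le_of_le_one_left (mul_nonneg hc'0.le hR) (hχ01 z.2).2
      have e7 : η z * |W i z| ^ p i = cutPow α δ (ξ z) * (χ z.2 * |W i z| ^ p i) := by
        rw [hηQ z hz, mul_assoc]
      rw [e7]
      refine sub_le_sub_right ?_ _
      linarith
    have b3 := Finset.sum_le_sum fun i (_ : i ∈ Finset.univ) => b2 i
    rw [Finset.sum_sub_distrib, Finset.sum_add_distrib, ← Finset.mul_sum, ← Finset.mul_sum] at b3
    have b4 := mul_le_mul_of_nonneg_left (time_integral_le_cutoffTerm (x₀ := x₀) (t₀ := t₀) (s := s)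
      (ρ := ρ) (ξ := ξ) (p := p) (w := w) hN) hc'0.le
    have h0 : 0 ≤ ∫ z in Q x₀ t₀ s ρ, |fderiv ℝ ξ z (dirT N)| * w z ^ 2 :=
      integral_nonneg fun z => mul_nonneg (abs_nonneg _) (sq_nonneg _)
    have b5 := mul_le_mul_of_nonneg_right hcc' h0
    have b6 := mul_nonneg hc'0.le h0
    rw [mul_add] at b4
    linarith
  have hδ0 : ∀ n : ℕ, (0 : ℝ) < 1 / (n + 1) := fun n => Nat.one_div_pos_of_nat
  have hlim := le_of_tendsto_of_tendsto'
    (tendsto_finsetSum Finset.univ fun i _ => hξ.tendsto_integral_cutPow (by linarith : 0 < α) hδ0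
      tendsto_one_div_add_one (iW i))
    ((((hξ.tendsto_integral_cutPow (by linarith : 0 < α) hδ0 tendsto_one_div_add_one
      iw).const_mul (1 / 2)).add_const _).add_const _) fun n => step _ (hδ0 n)
  linarith

end

end AnisoObstacle

/-! ### Removing the time weight. -/

namespace AnisoObstacle

/-- The derivative of `h` is a nonnegative weight of mass one supported in `[τ - r, τ + r]`, so it
averages `E` near `τ`. -/
theorem abs_integral_deriv_mul_sub_le {h E : ℝ → ℝ} {a b τ r ε : ℝ} (hh : ContDiff ℝ ∞ h)
    (hmono : Monotone h) (hr : 0 < r) (h0 : ∀ t ≤ τ - r, h t = 0) (h1 : ∀ t, τ + r ≤ t → h t = 1)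
    (ha : a ≤ τ - r) (hb : τ + r ≤ b) (hE : ContinuousOn E (Icc a b))
    (hε : ∀ t ∈ Icc a b, |t - τ| ≤ r → |E t - E τ| ≤ ε) :
    |(∫ t in Ioo a b, deriv h t * E t) - E τ| ≤ ε := by
  have hab : a ≤ b := by linarith
  have hτ : τ ∈ Icc a b := ⟨by linarith, by linarith⟩
  have hε0 : 0 ≤ ε := (abs_nonneg _).trans (hε τ hτ (by simpa using hr.le))
  have hd : Continuous (deriv h) := hh.continuous_deriv (by simp)
  have hI : ∀ {F : ℝ → ℝ}, ContinuousOn F (Icc a b) → IntegrableOn F (Ioo a b) := fun hF =>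
    (hF.integrableOn_Icc).mono_set Ioo_subset_Icc_self
  have hint : ∫ t in Ioo a b, deriv h t = 1 := by
    rw [← integral_Ioc_eq_integral_Ioo, ← intervalIntegral.integral_of_le hab,
      intervalIntegral.integral_deriv_eq_sub (fun t _ => hh.differentiable (by simp) t)
        (hd.intervalIntegrable _ _), h1 b hb, h0 a ha, sub_zero]
  have hd0 : ∀ t, 0 ≤ deriv h t := fun t => hmono.deriv_nonneg
  have hdz : ∀ t, r < |t - τ| → deriv h t = 0 := by
    intro t ht
    rcases lt_abs.1 ht with h' | h'
    · have : h =ᶠ[𝓝 t] fun _ => 1 := by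
        filter_upwards [Ioi_mem_nhds (by linarith : τ + r < t)] with x hx
        exact h1 x (le_of_lt hx)
      rw [this.deriv_eq, deriv_const]
    · have : h =ᶠ[𝓝 t] fun _ => 0 := by
        filter_upwards [Iio_mem_nhds (by linarith : t < τ - r)] with x hx
        exact h0 x (le_of_lt hx)
      rw [this.deriv_eq, deriv_const]
  have e1 : (∫ t in Ioo a b, deriv h t * E t) - E τ
      = ∫ t in Ioo a b, deriv h t * (E t - E τ) := by
    have e2 : E τ = ∫ t in Ioo a b, deriv h t * E τ := by
      rw [integral_mul_const, hint, one_mul]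
    conv_lhs => rw [e2]
    have i1 : IntegrableOn (fun t => deriv h t * E t) (Ioo a b) := hI (hd.continuousOn.mul hE)
    have i2 : IntegrableOn (fun t => deriv h t * E τ) (Ioo a b) :=
      hI (hd.mul continuous_const).continuousOn
    rw [← integral_sub i1 i2]
    simp only [mul_sub]
  have hIε : IntegrableOn (fun t => deriv h t * ε) (Ioo a b) :=
    hI (hd.mul continuous_const).continuousOn
  rw [e1, ← Real.norm_eq_abs]
  calc ‖∫ t in Ioo a b, deriv h t * (E t - E τ)‖ ≤ ∫ t in Ioo a b, deriv h t * ε := by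
        refine norm_integral_le_of_norm_le hIε ?_
        filter_upwards [ae_restrict_mem measurableSet_Ioo] with t ht
        rw [norm_mul, Real.norm_eq_abs, Real.norm_eq_abs, abs_of_nonneg (hd0 t)]
        rcases le_or_gt |t - τ| r with h' | h'
        · exact mul_le_mul_of_nonneg_left (hε t (Ioo_subset_Icc_self ht) h') (hd0 t)
        · rw [hdz t h', zero_mul, zero_mul]
    _ = ε := by rw [integral_mul_const, hint, one_mul]

variable {N : ℕ} {x₀ : EuclideanSpace ℝ (Fin N)} {t₀ s ρ α : ℝ} {ξ w : SpaceTime N → ℝ}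
  {Ω : Set (EuclideanSpace ℝ (Fin N))} {T : ℝ} {p : Fin N → ℝ}

/-- `Q` is open at the top: any of its times lies below a later one that is still at most `T`. -/
theorem Q_subset_openCyl (h : Q x₀ t₀ s ρ ⊆ cyl Ω T) : Q x₀ t₀ s ρ ⊆ openCyl Ω T := by
  rintro ⟨x, t⟩ hz
  refine ⟨(h hz).1, (h hz).2.1, ?_⟩
  obtain ⟨t', h1, h2⟩ := exists_between hz.2.2
  have h3 : (x, t') ∈ Q x₀ t₀ s ρ := ⟨hz.1, hz.2.1.trans h1, h2⟩
  exact h1.trans_le (h h3).2.2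

theorem ball_subset_of_Q_subset (hs : 0 < s) (h : Q x₀ t₀ s ρ ⊆ openCyl Ω T) :
    Metric.ball x₀ ρ ⊆ Ω := fun x hx => by
  have h1 : (x, t₀ - s / 2) ∈ Q x₀ t₀ s ρ := ⟨hx, by constructor <;> dsimp only <;> linarith⟩
  exact (h h1).1

theorem Icc_subset_of_Q_subset (hs : 0 < s) (hρ : 0 < ρ) (h : Q x₀ t₀ s ρ ⊆ openCyl Ω T) :
    Icc (t₀ - s) t₀ ⊆ Icc 0 T := by
  have h1 : Ioo (t₀ - s) t₀ ⊆ Icc 0 T := fun t ht =>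
    Ioo_subset_Icc_self (h (show (x₀, t) ∈ Q x₀ t₀ s ρ from ⟨Metric.mem_ball_self hρ, ht⟩)).2
  rw [← closure_Ioo (by linarith : t₀ - s ≠ t₀)]
  exact closure_minimal h1 isClosed_Icc

/-- The sign of `ξ` is prescribed only in the open cylinder, but the slice at the initial time `t₀ -
s` is needed too; continuity supplies it. -/
theorem IsCutoff.nonneg_Icc (hξ : IsCutoff x₀ t₀ s ρ ξ) (hs : 0 < s)
    {x : EuclideanSpace ℝ (Fin N)} (hx : x ∈ Metric.ball x₀ ρ) {t : ℝ}
    (ht : t ∈ Icc (t₀ - s) t₀) : 0 ≤ ξ (x, t) := by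
  have hc : IsClosed {t : ℝ | 0 ≤ ξ (x, t)} :=
    isClosed_le continuous_const (hξ.smooth.continuous.comp (by fun_prop))
  rw [← closure_Ioo (by linarith : t₀ - s ≠ t₀)] at ht
  exact closure_minimal (fun τ hτ => hξ.nonneg (x, τ) ⟨hx, hτ⟩) hc ht

/-- The slice energy is the squared `L²` norm of `|ξ|^{α/2} w`, a continuous multiplier times a
member of `C([0,T]; L²)`. -/
theorem continuousOn_sliceEnergy (hξ : IsCutoff x₀ t₀ s ρ ξ) (hs : 0 < s) (hρ : 0 < ρ)
    (hα : 0 ≤ α) (hQ : Q x₀ t₀ s ρ ⊆ openCyl Ω T) (hw : ContinuousInL2 Ω T w) :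
    ContinuousOn (sliceEnergy x₀ ρ α ξ w) (Icc (t₀ - s) t₀) := by
  have hb : Continuous fun z => |ξ z| ^ (α / 2) :=
    hξ.smooth.continuous.abs.rpow_const fun _ => Or.inr (by positivity)
  have h1 := ((hw.mono (ball_subset_of_Q_subset hs hQ)).continuous_mul Metric.isBounded_ball
    Metric.isOpen_ball.measurableSet hb).continuousOn_integral_sq
  refine (h1.mono (Icc_subset_of_Q_subset hs hρ hQ)).congr fun t ht => ?_
  refine setIntegral_congr_fun Metric.isOpen_ball.measurableSet fun x hx => ?_
  have h0 := hξ.nonneg_Icc hs hx ht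
  simp only [mul_pow]
  rw [abs_of_nonneg h0, ← Real.rpow_mul_natCast h0]
  norm_num

theorem integral_Q_eq (hα : 0 ≤ α) (hξ : IsCutoff x₀ t₀ s ρ ξ) {χ : ℝ → ℝ} (hχ : Continuous χ)
    (hw : Integrable (fun z => w z ^ 2) (volume.restrict (Q x₀ t₀ s ρ))) :
    ∫ z in Q x₀ t₀ s ρ, ξ z ^ α * (χ z.2 * w z ^ 2)
      = ∫ t in Ioo (t₀ - s) t₀, χ t * sliceEnergy x₀ ρ α ξ w t := by
  have h1 : Integrable (fun z => ξ z ^ α * (χ z.2 * w z ^ 2)) (volume.restrict (Q x₀ t₀ s ρ)) :=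
    integrable_continuous_mul_Q (hξ.continuous_rpow hα)
      (integrable_continuous_mul_Q (hχ.comp continuous_snd) hw)
  have h2 : (volume.restrict (Q x₀ t₀ s ρ) : Measure (SpaceTime N))
      = (volume.restrict (Metric.ball x₀ ρ)).prod (volume.restrict (Ioo (t₀ - s) t₀)) :=
    (Measure.prod_restrict _ _).symm
  rw [h2] at h1 ⊢
  rw [integral_prod_symm _ h1]
  refine integral_congr_ae (Eventually.of_forall fun t => ?_)
  simp only [sliceEnergy]
  rw [← integral_const_mul]
  refine integral_congr_ae (Eventually.of_forall fun x => ?_)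
  simp only
  ring

theorem tendsto_gradEnergy {U : Set (SpaceTime N)} {c d : ℝ} {a b : ℕ → ℝ} (ha : Antitone a)
    (hb : Monotone b) (hac : ∀ n, c ≤ a n) (hbd : ∀ n, b n ≤ d)
    (ha' : Tendsto a atTop (𝓝 c)) (hb' : Tendsto b atTop (𝓝 d))
    (hI : ∀ i, IntegrableOn (fun z => ξ z ^ α * |weakDeriv U (dirX i) w z| ^ p i)
      (Metric.ball x₀ ρ ×ˢ Ioo c d)) :
    Tendsto (fun n => gradEnergy U p x₀ ρ α ξ w (a n) (b n)) atTop
      (𝓝 (gradEnergy U p x₀ ρ α ξ w c d)) := by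
  refine tendsto_finsetSum _ fun i _ => ?_
  have hU : ⋃ n, Metric.ball x₀ ρ ×ˢ Ioo (a n) (b n) = Metric.ball x₀ ρ ×ˢ Ioo c d := by
    rw [← prod_iUnion]
    congr 1
    refine Subset.antisymm (iUnion_subset fun n => Ioo_subset_Ioo (hac n) (hbd n)) fun t ht => ?_
    obtain ⟨n, h1, h2⟩ := ((ha'.eventually (Iio_mem_nhds ht.1)).and
      (hb'.eventually (Ioi_mem_nhds ht.2))).exists
    exact mem_iUnion.2 ⟨n, h1, h2⟩
  have := tendsto_setIntegral_of_monotone (μ := volume)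
    (s := fun n => Metric.ball x₀ ρ ×ˢ Ioo (a n) (b n))
    (f := fun z => ξ z ^ α * |weakDeriv U (dirX i) w z| ^ p i)
    (fun n => (Metric.isOpen_ball.prod isOpen_Ioo).measurableSet)
    (fun m n hmn => prod_mono le_rfl (Ioo_subset_Ioo (ha hmn) (hb hmn))) (by
      rw [hU]
      exact hI i)
  rwa [hU] at this

/-- A smooth function rising from `0` at `τ` to `1` at `τ + r`. -/
noncomputable def smoothStep (τ r t : ℝ) : ℝ := Real.smoothTransition ((t - τ) / r)

theorem contDiff_smoothStep (τ r : ℝ) : ContDiff ℝ ∞ (smoothStep τ r) :=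
  Real.smoothTransition.contDiff.comp ((contDiff_id.sub contDiff_const).div_const r)

variable {τ r t : ℝ}

theorem smoothStep_of_le (hr : 0 < r) (ht : t ≤ τ) : smoothStep τ r t = 0 :=
  Real.smoothTransition.zero_of_nonpos (div_nonpos_of_nonpos_of_nonneg (by linarith) hr.le)

theorem smoothStep_of_ge (hr : 0 < r) (ht : τ + r ≤ t) : smoothStep τ r t = 1 :=
  Real.smoothTransition.one_of_one_le ((one_le_div hr).2 (by linarith))

theorem monotone_smoothStep (hr : 0 < r) : Monotone (smoothStep τ r) := fun _ _ h =>
  Real.smoothTransition.monotone (div_le_div_of_nonneg_right (by linarith) hr.le)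

theorem smoothStep_antitone_left {τ' : ℝ} (hr : 0 < r) (h : τ ≤ τ') (t : ℝ) :
    smoothStep τ' r t ≤ smoothStep τ r t :=
  Real.smoothTransition.monotone (div_le_div_of_nonneg_right (by linarith) hr.le)

end AnisoObstacle

namespace AnisoObstacle

theorem exists_radius_of_continuousOn {E : ℝ → ℝ} {a b τ ε : ℝ} (hE : ContinuousOn E (Icc a b))
    (hτ : τ ∈ Icc a b) (hε : 0 < ε) :
    ∃ r > 0, ∀ t ∈ Icc a b, |t - τ| ≤ r → |E t - E τ| ≤ ε := by
  obtain ⟨d, hd, h⟩ := Metric.continuousOn_iff.1 hE τ hτ ε hε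
  refine ⟨d / 2, half_pos hd, fun t ht htr => ?_⟩
  exact (h t ht (by rw [Real.dist_eq]; linarith)).le

theorem exists_const_energy_between {α : ℝ} (hα : 2 ≤ α) : ∃ c : ℝ, 0 < c ∧
    ∀ {N : ℕ} {Ω : Set (EuclideanSpace ℝ (Fin N))} {T : ℝ} {p : Fin N → ℝ}
      {x₀ : EuclideanSpace ℝ (Fin N)} {t₀ s ρ : ℝ} {ξ w : SpaceTime N → ℝ},
      0 < N → (∀ i, 2 ≤ p i) → (∀ i, p i ≤ α) → Bornology.IsBounded Ω → 0 < s → 0 < ρ →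
      Q x₀ t₀ s ρ ⊆ openCyl Ω T → IsCutoff x₀ t₀ s ρ ξ →
      IsEnergySubsolution Ω T p (Q x₀ t₀ s ρ) w →
      ∀ t₁ t₂, t₀ - s < t₁ → t₁ < t₂ → t₂ < t₀ →
        sliceEnergy x₀ ρ α ξ w t₂ + gradEnergy (openCyl Ω T) p x₀ ρ α ξ w t₁ t₂
          ≤ sliceEnergy x₀ ρ α ξ w t₁ + c * cutoffTerm p x₀ t₀ s ρ ξ w := by
  obtain ⟨c, hc, key⟩ := exists_const_weighted_energy hα
  -- The weighted inequality carries `1/2` on both energies; clearing it doubles the constant.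
  refine ⟨2 * c, by positivity, ?_⟩
  intro N Ω T p x₀ t₀ s ρ ξ w hN hp hpα hΩb hs hρ hQ hξ hw t₁ t₂ h1 h12 h2
  have hα0 : 0 ≤ α := by linarith
  have hm := Measure.restrict_mono_set (volume : Measure (SpaceTime N)) hQ
  have hE := continuousOn_sliceEnergy hξ hs hρ hα0 hQ hw.continuous_L2
  set E := sliceEnergy x₀ ρ α ξ w
  refine le_of_forall_pos_le_add fun ε hε => ?_
  obtain ⟨r₁, hr₁, he₁⟩ := exists_radius_of_continuousOn hE
    (show t₁ ∈ Icc (t₀ - s) t₀ from ⟨by linarith, by linarith⟩) (half_pos hε)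
  obtain ⟨r₂, hr₂, he₂⟩ := exists_radius_of_continuousOn hE
    (show t₂ ∈ Icc (t₀ - s) t₀ from ⟨by linarith, by linarith⟩) (half_pos hε)
  obtain ⟨r, hr0, hr⟩ : ∃ r > 0, r ≤ r₁ ∧ r ≤ r₂ ∧ r < t₁ - (t₀ - s) ∧ r < t₀ - t₂ ∧
      r < t₂ - t₁ := by
    have hm0 : 0 < min (min r₁ r₂) (min (min (t₁ - (t₀ - s)) (t₀ - t₂)) (t₂ - t₁)) := by
      simp only [lt_min_iff]
      exact ⟨⟨hr₁, hr₂⟩, ⟨by linarith, by linarith⟩, by linarith⟩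
    obtain ⟨r, hr0, hr⟩ := exists_between hm0
    simp only [lt_min_iff] at hr
    exact ⟨r, hr0, hr.1.1.le, hr.1.2.le, hr.2.1.1, hr.2.1.2, hr.2.2⟩
  obtain ⟨hrr₁, hrr₂, hra, hrb, hrc⟩ := hr
  -- A smooth trapezoid: it rises on `[t₁ - r, t₁]`, equals `1` on `(t₁, t₂)` and falls on `[t₂, t₂
  -- + r]`. Its derivative approximates a point mass at `t₁` minus one at `t₂`, each with error `ε /
  -- 2`.
  set χ : ℝ → ℝ := fun t => smoothStep (t₁ - r) r t - smoothStep t₂ r t with hχdef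
  have hs1 := contDiff_smoothStep (t₁ - r) r
  have hs2 := contDiff_smoothStep t₂ r
  have hχ : ContDiff ℝ ∞ χ := hs1.sub hs2
  have hχ0 : ∀ t ∉ Icc (t₁ - r) (t₂ + r), χ t = 0 := fun t ht => by
    rw [mem_Icc, not_and_or, not_le, not_le] at ht
    rcases ht with ht | ht
    · rw [hχdef]
      simp only
      rw [smoothStep_of_le hr0 ht.le, smoothStep_of_le hr0 (by linarith), sub_zero]
    · rw [hχdef]
      simp only
      rw [smoothStep_of_ge hr0 (by linarith), smoothStep_of_ge hr0 ht.le, sub_self]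
  have hχs : tsupport χ ⊆ Icc (t₁ - r) (t₂ + r) := closure_minimal (fun t ht => by
    by_contra h
    exact ht (hχ0 t h)) isClosed_Icc
  have hχ01 : ∀ t, χ t ∈ Icc (0 : ℝ) 1 := fun t =>
    ⟨sub_nonneg.2 (smoothStep_antitone_left hr0 (by linarith) t),
      (sub_le_self _ (Real.smoothTransition.nonneg _)).trans (Real.smoothTransition.le_one _)⟩
  have hχ1 : ∀ t ∈ Ioo t₁ t₂, χ t = 1 := fun t ht => by
    rw [hχdef]
    simp only
    rw [smoothStep_of_ge hr0 (by linarith [ht.1]), smoothStep_of_le hr0 ht.2.le, sub_zero]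
  have main := key hN hp hpα hΩb hQ hξ hw hχ
    (isCompact_Icc.of_isClosed_subset (isClosed_tsupport _) hχs)
    (hχs.trans (Icc_subset_Ioo (by linarith) (by linarith))) hχ01
  rw [integral_Q_eq hα0 hξ (hχ.continuous_deriv (by simp))
    ((hw.integrable_sq hN hp hΩb).mono_measure hm)] at main
  have hsplit : ∫ t in Ioo (t₀ - s) t₀, deriv χ t * E t
      = (∫ t in Ioo (t₀ - s) t₀, deriv (smoothStep (t₁ - r) r) t * E t)
        - ∫ t in Ioo (t₀ - s) t₀, deriv (smoothStep t₂ r) t * E t := by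
    have hI : ∀ {h : ℝ → ℝ}, ContDiff ℝ ∞ h →
        IntegrableOn (fun t => deriv h t * E t) (Ioo (t₀ - s) t₀) := fun hh =>
      (((hh.continuous_deriv (by simp)).continuousOn.mul hE).integrableOn_Icc).mono_set
        Ioo_subset_Icc_self
    rw [← integral_sub (hI hs1) (hI hs2)]
    refine integral_congr_ae (Eventually.of_forall fun t => ?_)
    have hd : deriv χ t = deriv (smoothStep (t₁ - r) r) t - deriv (smoothStep t₂ r) t :=
      deriv_sub (hs1.differentiable (by simp) t) (hs2.differentiable (by simp) t)
    simp only [hd, sub_mul]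
  have a1 := abs_integral_deriv_mul_sub_le (τ := t₁) (ε := ε / 2) hs1 (monotone_smoothStep hr0) hr0
    (fun t ht => smoothStep_of_le hr0 ht) (fun t ht => smoothStep_of_ge hr0 (by linarith))
    (by linarith) (by linarith) hE fun t ht h => he₁ t ht (h.trans hrr₁)
  have a2 := abs_integral_deriv_mul_sub_le (τ := t₂) (ε := ε / 2) hs2 (monotone_smoothStep hr0) hr0
    (fun t ht => smoothStep_of_le hr0 (by linarith)) (fun t ht => smoothStep_of_ge hr0 ht)
    (by linarith) (by linarith) hE fun t ht h => he₂ t ht (h.trans hrr₂)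
  have a3 := (abs_le.1 a1).2
  have a4 := (abs_le.1 a2).1
  rw [hsplit] at main
  have hgrad : gradEnergy (openCyl Ω T) p x₀ ρ α ξ w t₁ t₂
      ≤ ∑ i, ∫ z in Q x₀ t₀ s ρ,
          ξ z ^ α * (χ z.2 * |weakDeriv (openCyl Ω T) (dirX i) w z| ^ (p i)) := by
    refine Finset.sum_le_sum fun i _ => ?_
    have e1 : ∫ z in Metric.ball x₀ ρ ×ˢ Ioo t₁ t₂,
          ξ z ^ α * |weakDeriv (openCyl Ω T) (dirX i) w z| ^ p i
        = ∫ z in Metric.ball x₀ ρ ×ˢ Ioo t₁ t₂,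
          ξ z ^ α * (χ z.2 * |weakDeriv (openCyl Ω T) (dirX i) w z| ^ p i) :=
      setIntegral_congr_fun (Metric.isOpen_ball.prod isOpen_Ioo).measurableSet fun z hz => by
        rw [hχ1 z.2 hz.2, one_mul]
    rw [e1]
    refine setIntegral_mono_set (integrable_continuous_mul_Q (hξ.continuous_rpow hα0)
      (integrable_continuous_mul_Q (hχ.continuous.comp continuous_snd)
        (integrable_abs_rpow (hp i) ((hw.weakDeriv_memLp i).2.mono_measure hm)))) ?_
      (Eventually.of_forall (prod_mono le_rfl (Ioo_subset_Ioo h1.le h2.le)))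
    filter_upwards [ae_restrict_mem isOpen_Q.measurableSet] with z hz
    exact mul_nonneg (Real.rpow_nonneg (hξ.nonneg z hz) _)
      (mul_nonneg (hχ01 z.2).1 (Real.rpow_nonneg (abs_nonneg _) _))
  linarith

theorem cutoffTerm_nonneg {N : ℕ} {p : Fin N → ℝ} {x₀ : EuclideanSpace ℝ (Fin N)} {t₀ s ρ : ℝ}
    {ξ w : SpaceTime N → ℝ} (hw : ∀ z, 0 ≤ w z) : 0 ≤ cutoffTerm p x₀ t₀ s ρ ξ w :=
  Finset.sum_nonneg fun _ _ => add_nonneg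
    (integral_nonneg fun _ => mul_nonneg (abs_nonneg _) (sq_nonneg _))
    (integral_nonneg fun z => mul_nonneg (Real.rpow_nonneg (abs_nonneg _) _)
      (Real.rpow_nonneg (hw z) _))

theorem gradEnergy_nonneg {N : ℕ} {p : Fin N → ℝ} {x₀ : EuclideanSpace ℝ (Fin N)}
    {t₀ s ρ α t₁ t₂ : ℝ} {ξ w : SpaceTime N → ℝ} {U : Set (SpaceTime N)}
    (hξ : IsCutoff x₀ t₀ s ρ ξ) (h1 : t₀ - s ≤ t₁) (h2 : t₂ ≤ t₀) :
    0 ≤ gradEnergy U p x₀ ρ α ξ w t₁ t₂ :=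
  Finset.sum_nonneg fun _ _ =>
    setIntegral_nonneg (Metric.isOpen_ball.prod isOpen_Ioo).measurableSet fun z hz =>
      mul_nonneg (Real.rpow_nonneg (hξ.nonneg z ⟨hz.1, Ioo_subset_Ioo h1 h2 hz.2⟩) _)
        (Real.rpow_nonneg (abs_nonneg _) _)

theorem sliceEnergy_nonneg {N : ℕ} {x₀ : EuclideanSpace ℝ (Fin N)}
    {t₀ s ρ α t : ℝ} {ξ w : SpaceTime N → ℝ}
    (hξ : IsCutoff x₀ t₀ s ρ ξ) (ht : t ∈ Ioo (t₀ - s) t₀) : 0 ≤ sliceEnergy x₀ ρ α ξ w t :=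
  setIntegral_nonneg Metric.isOpen_ball.measurableSet fun x hx =>
    mul_nonneg (Real.rpow_nonneg (hξ.nonneg (x, t) ⟨hx, ht⟩) _) (sq_nonneg _)

/-- The local energy estimates for energy subsolutions. -/
theorem exists_const_energy_estimate {α : ℝ} (hα : 2 ≤ α) : ∃ C : ℝ, 0 < C ∧
    ∀ {N : ℕ} {Ω : Set (EuclideanSpace ℝ (Fin N))} {T : ℝ} {p : Fin N → ℝ}
      {x₀ : EuclideanSpace ℝ (Fin N)} {t₀ s ρ : ℝ} {ξ w : SpaceTime N → ℝ},
      0 < N → (∀ i, 2 ≤ p i) → (∀ i, p i ≤ α) → Bornology.IsBounded Ω → 0 < s → 0 < ρ →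
      Q x₀ t₀ s ρ ⊆ openCyl Ω T → IsCutoff x₀ t₀ s ρ ξ →
      IsEnergySubsolution Ω T p (Q x₀ t₀ s ρ) w →
      (∀ t ∈ Ioo (t₀ - s) t₀,
        sliceEnergy x₀ ρ α ξ w t + C⁻¹ * gradEnergy (openCyl Ω T) p x₀ ρ α ξ w (t₀ - s) t
          ≤ sliceEnergy x₀ ρ α ξ w (t₀ - s) + C * cutoffTerm p x₀ t₀ s ρ ξ w) ∧
      BddAbove (sliceEnergy x₀ ρ α ξ w '' Ioo (t₀ - s) t₀) ∧
      sSup (sliceEnergy x₀ ρ α ξ w '' Ioo (t₀ - s) t₀)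
          + C⁻¹ * gradEnergy (openCyl Ω T) p x₀ ρ α ξ w (t₀ - s) t₀
        ≤ 2 * sliceEnergy x₀ ρ α ξ w (t₀ - s) + C * cutoffTerm p x₀ t₀ s ρ ξ w := by
  obtain ⟨c, hc, key⟩ := exists_const_energy_between hα
  -- `2 * c` because the bounds for the supremum and for the gradient energy are added; the extra
  -- `1` ensures `C⁻¹ ≤ 1`.
  refine ⟨2 * c + 1, by positivity, ?_⟩
  intro N Ω T p x₀ t₀ s ρ ξ w hN hp hpα hΩb hs hρ hQ hξ hw
  have hα0 : 0 ≤ α := by linarith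
  have hm := Measure.restrict_mono_set (volume : Measure (SpaceTime N)) hQ
  have hE := continuousOn_sliceEnergy hξ hs hρ hα0 hQ hw.continuous_L2
  have hI : ∀ i, IntegrableOn (fun z => ξ z ^ α * |weakDeriv (openCyl Ω T) (dirX i) w z| ^ p i)
      (Q x₀ t₀ s ρ) := fun i => integrable_continuous_mul_Q (hξ.continuous_rpow hα0)
    (integrable_abs_rpow (hp i) ((hw.weakDeriv_memLp i).2.mono_measure hm))
  have between := key hN hp hpα hΩb hs hρ hQ hξ hw
  set E := sliceEnergy x₀ ρ α ξ w
  set R := cutoffTerm p x₀ t₀ s ρ ξ w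
  set A := gradEnergy (openCyl Ω T) p x₀ ρ α ξ w
  have hR : 0 ≤ R := cutoffTerm_nonneg hw.nonneg
  have hanti : ∀ {d : ℝ}, 0 ≤ d → Antitone fun n : ℕ => d / ((n : ℝ) + 1) := fun hd m n hmn => by
    have : (m : ℝ) ≤ n := by exact_mod_cast hmn
    exact div_le_div_of_nonneg_left hd (by positivity) (by linarith)
  have hto : ∀ d : ℝ, Tendsto (fun n : ℕ => d / ((n : ℝ) + 1)) atTop (𝓝 0) := fun d => by
    simpa [div_eq_mul_inv] using tendsto_one_div_add_one.const_mul d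
  -- The lower time is sent to `t₀ - s`: the gradient energies converge along the growing intervals,
  -- the slice energies by continuity up to the closed interval. Starting at half the distance to
  -- `t` keeps the lower times below `t`.
  have first : ∀ t ∈ Ioo (t₀ - s) t₀, E t + A (t₀ - s) t ≤ E (t₀ - s) + c * R := by
    intro t ht
    set d := (t - (t₀ - s)) / 2 with hd
    have hd0 : 0 < d := by linarith [ht.1]
    set a : ℕ → ℝ := fun n => t₀ - s + d / ((n : ℝ) + 1) with ha
    have had : ∀ n : ℕ, d / ((n : ℝ) + 1) ≤ d := fun n => div_le_self hd0.le (by simp)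
    have hda : ∀ n : ℕ, 0 < d / ((n : ℝ) + 1) := fun n => by positivity
    have hlim : Tendsto a atTop (𝓝 (t₀ - s)) := by simpa using (hto d).const_add (t₀ - s)
    have hA : Tendsto (fun n => A (a n) t) atTop (𝓝 (A (t₀ - s) t)) :=
      tendsto_gradEnergy (b := fun _ => t) (fun m n hmn => add_le_add le_rfl (hanti hd0.le hmn))
        monotone_const (fun n => by linarith [hda n]) (fun _ => le_rfl) hlim tendsto_const_nhds
        fun i => (hI i).mono_set (prod_mono le_rfl (Ioo_subset_Ioo_right ht.2.le))
    have hEa : Tendsto (fun n => E (a n)) atTop (𝓝 (E (t₀ - s))) := by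
      refine (hE (t₀ - s) ⟨le_rfl, by linarith⟩).tendsto.comp
        (tendsto_nhdsWithin_iff.2 ⟨hlim, Eventually.of_forall fun n => ⟨?_, ?_⟩⟩)
      · linarith [hda n]
      · linarith [had n, ht.2]
    exact le_of_tendsto_of_tendsto' (hA.const_add (E t)) (hEa.add_const (c * R)) fun n =>
      between (a n) t (by linarith [hda n]) (by linarith [had n]) ht.2
  have hA0 : ∀ t ∈ Ioo (t₀ - s) t₀, 0 ≤ A (t₀ - s) t := fun t ht =>
    gradEnergy_nonneg hξ le_rfl ht.2.le
  have hA00 : 0 ≤ A (t₀ - s) t₀ := gradEnergy_nonneg hξ le_rfl le_rfl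
  have hub : ∀ y ∈ E '' Ioo (t₀ - s) t₀, y ≤ E (t₀ - s) + c * R := by
    rintro _ ⟨t, ht, rfl⟩
    linarith [first t ht, hA0 t ht]
  have hne : (E '' Ioo (t₀ - s) t₀).Nonempty := (nonempty_Ioo.2 (by linarith)).image _
  have hinv : (2 * c + 1)⁻¹ ≤ 1 := inv_le_one_of_one_le₀ (by linarith)
  -- The slice energy at the upper time is nonnegative and can be dropped before that time is sent
  -- to `t₀`.
  have hsup : A (t₀ - s) t₀ ≤ E (t₀ - s) + c * R := by
    set b : ℕ → ℝ := fun n => t₀ - s / 2 / ((n : ℝ) + 1) with hb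
    have hbs : ∀ n : ℕ, s / 2 / ((n : ℝ) + 1) ≤ s / 2 := fun n =>
      div_le_self (by positivity) (by simp)
    have hb0 : ∀ n : ℕ, 0 < s / 2 / ((n : ℝ) + 1) := fun n => by positivity
    have hA : Tendsto (fun n => A (t₀ - s) (b n)) atTop (𝓝 (A (t₀ - s) t₀)) :=
      tendsto_gradEnergy (a := fun _ => t₀ - s) antitone_const
        (fun m n hmn => sub_le_sub_left (hanti (by positivity) hmn) _) (fun _ => le_rfl)
        (fun n => by linarith [hb0 n]) tendsto_const_nhds
        (by simpa using (hto (s / 2)).const_sub t₀) hI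
    refine le_of_tendsto' hA fun n => ?_
    have hbn : b n ∈ Ioo (t₀ - s) t₀ := ⟨by linarith [hbs n], by linarith [hb0 n]⟩
    linarith [first (b n) hbn, show 0 ≤ E (b n) from sliceEnergy_nonneg hξ hbn]
  have hcR := mul_nonneg hc.le hR
  refine ⟨fun t ht => ?_, ⟨_, hub⟩, ?_⟩
  · have h1 := first t ht
    have h2 := mul_le_of_le_one_left (hA0 t ht) hinv
    linarith
  · have h1 := csSup_le hne hub
    have h2 := mul_le_of_le_one_left hA00 hinv
    linarith

end AnisoObstacle

/-! ### The estimates for both truncations. -/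

theorem lemma3p1 (N : ℕ) (hN : 2 ≤ N) (p : Fin N → ℝ) (hp : ∀ i, 2 ≤ p i)
    (α : ℝ) (hα : ∀ i, p i ≤ α) :
    ∃ C : ℝ, 0 < C ∧
      ∀ (Ω : Set (EuclideanSpace ℝ (Fin N))) (T : ℝ) (φ u : AnisoObstacle.SpaceTime N → ℝ),
        IsOpen Ω → IsConnected Ω → Bornology.IsBounded Ω → 0 < T →
        ContinuousOn φ (AnisoObstacle.cyl Ω T) →
        (∃ v, AnisoObstacle.MemK' Ω T p φ v) →
        AnisoObstacle.IsLocalWeakSolution Ω T p φ u →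
        ∀ (x₀ : EuclideanSpace ℝ (Fin N)) (t₀ s ρ : ℝ), 0 < s → 0 < ρ →
          AnisoObstacle.Q x₀ t₀ s ρ ⊆ AnisoObstacle.cyl Ω T →
        ∀ ξ : AnisoObstacle.SpaceTime N → ℝ, AnisoObstacle.IsCutoff x₀ t₀ s ρ ξ →
          -- the estimates for `(u - k)_-`, for every level `k > 0`
          (∀ k : ℝ, 0 < k →
            (∀ i, AnisoObstacle.WeakDerivMemLp (AnisoObstacle.openCyl Ω T)
              (AnisoObstacle.dirX i) (p i) (AnisoObstacle.truncNeg u k)) ∧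
            (∀ t ∈ Ioo (t₀ - s) t₀,
              AnisoObstacle.sliceEnergy x₀ ρ α ξ (AnisoObstacle.truncNeg u k) t
                + C⁻¹ * AnisoObstacle.gradEnergy (AnisoObstacle.openCyl Ω T) p x₀ ρ α ξ
                    (AnisoObstacle.truncNeg u k) (t₀ - s) t
              ≤ AnisoObstacle.sliceEnergy x₀ ρ α ξ (AnisoObstacle.truncNeg u k) (t₀ - s)
                + C * AnisoObstacle.cutoffTerm p x₀ t₀ s ρ ξ (AnisoObstacle.truncNeg u k)) ∧
            BddAbove (AnisoObstacle.sliceEnergy x₀ ρ α ξ (AnisoObstacle.truncNeg u k)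
              '' Ioo (t₀ - s) t₀) ∧
            sSup (AnisoObstacle.sliceEnergy x₀ ρ α ξ (AnisoObstacle.truncNeg u k)
                '' Ioo (t₀ - s) t₀)
              + C⁻¹ * AnisoObstacle.gradEnergy (AnisoObstacle.openCyl Ω T) p x₀ ρ α ξ
                  (AnisoObstacle.truncNeg u k) (t₀ - s) t₀
            ≤ 2 * AnisoObstacle.sliceEnergy x₀ ρ α ξ (AnisoObstacle.truncNeg u k) (t₀ - s)
              + C * AnisoObstacle.cutoffTerm p x₀ t₀ s ρ ξ (AnisoObstacle.truncNeg u k)) ∧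
          -- the estimates for `(u - k)_+`, for every level `k ≥ sup_Q φ`
          (∀ k : ℝ, (∀ z ∈ AnisoObstacle.Q x₀ t₀ s ρ, φ z ≤ k) →
            (∀ i, AnisoObstacle.WeakDerivMemLp (AnisoObstacle.openCyl Ω T)
              (AnisoObstacle.dirX i) (p i) (AnisoObstacle.truncPos u k)) ∧
            (∀ t ∈ Ioo (t₀ - s) t₀,
              AnisoObstacle.sliceEnergy x₀ ρ α ξ (AnisoObstacle.truncPos u k) t
                + C⁻¹ * AnisoObstacle.gradEnergy (AnisoObstacle.openCyl Ω T) p x₀ ρ α ξ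
                    (AnisoObstacle.truncPos u k) (t₀ - s) t
              ≤ AnisoObstacle.sliceEnergy x₀ ρ α ξ (AnisoObstacle.truncPos u k) (t₀ - s)
                + C * AnisoObstacle.cutoffTerm p x₀ t₀ s ρ ξ (AnisoObstacle.truncPos u k)) ∧
            BddAbove (AnisoObstacle.sliceEnergy x₀ ρ α ξ (AnisoObstacle.truncPos u k)
              '' Ioo (t₀ - s) t₀) ∧
            sSup (AnisoObstacle.sliceEnergy x₀ ρ α ξ (AnisoObstacle.truncPos u k)
                '' Ioo (t₀ - s) t₀)
              + C⁻¹ * AnisoObstacle.gradEnergy (AnisoObstacle.openCyl Ω T) p x₀ ρ α ξ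
                  (AnisoObstacle.truncPos u k) (t₀ - s) t₀
            ≤ 2 * AnisoObstacle.sliceEnergy x₀ ρ α ξ (AnisoObstacle.truncPos u k) (t₀ - s)
              + C * AnisoObstacle.cutoffTerm p x₀ t₀ s ρ ξ (AnisoObstacle.truncPos u k)) := by
  have hN0 : 0 < N := by omega
  obtain ⟨C, hC, key⟩ := AnisoObstacle.exists_const_energy_estimate
    ((hp ⟨0, hN0⟩).trans (hα ⟨0, hN0⟩))
  refine ⟨C, hC, ?_⟩
  intro Ω T φ u hΩ _ hΩb _ hφ hK hu x₀ t₀ s ρ hs hρ hQ ξ hξ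
  have hQ' := AnisoObstacle.Q_subset_openCyl hQ
  refine ⟨fun k _ => ?_, fun k hk => ?_⟩
  · have hw := AnisoObstacle.isEnergySubsolution_truncNeg hN0 hp hΩ hΩb hφ hK hu
      AnisoObstacle.isOpen_Q hQ' k
    exact ⟨hw.weakDeriv_memLp, key hN0 hp hα hΩb hs hρ hQ' hξ hw⟩
  · have hw := AnisoObstacle.isEnergySubsolution_truncPos hN0 hp hΩ hΩb hφ hK hu
      AnisoObstacle.isOpen_Q hQ' hk
    exact ⟨hw.weakDeriv_memLp, key hN0 hp hα hΩb hs hρ hQ' hξ hw⟩
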